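/- **Setting.** Parties 1, 2, 3 (Alice, Bob, Charlie) communicate over pairwise private links $12,23,31$ in synchronous rounds. In each round every party draws, independently of the others, the two bit strings (possibly empty) that it sends, from a distribution depending on its own input and on what was sent so far on its two links. A protocol is required to be well-formed: in each direction of each link the message sent in a round is a codeword of a prefix-free code determined by the messages sent on that link in previous rounds, and with probability $1$ the protocol terminates (reaches a state from which all parties send only empty strings). The number of rounds need not be bounded, and the protocol may depend on the input distribution. The final transcript $M_{ij}$ of link $ij$ is the pair of bit strings obtained by concatenating everything sent in each direction. Let $M_1=(M_{12},M_{31})$, $M_2=(M_{12},M_{23})$, $M_3=(M_{23},M_{31})$. Alice has input $X$, Bob has input $Y$, $(X,Y)\sim p_{XY}$, and Charlie outputs $Z$, a randomized function of $M_3$. The protocol is *secure* for $(p_{XY},p_{Z|XY})$ if, given $X=x,Y=y$, the output $Z$ has law $p_{Z|X=x,Y=y}$ (correctness), and $M_1-X-(Y,Z)$, $M_2-Y-(X,Z)$, $M_3-Z-(X,Y)$ are Markov chains (privacy). The views are $V_1=(M_1,X)$, $V_2=(M_2,Y)$, $V_3=(M_3,Z)$. Entropies are in bits, with values in $[0,\infty]$,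 and $$\rho(p_{XY},p_{Z|XY})=\inf H(V_1,V_2,V_3\mid X,Y),$$ the infimum being over all secure protocols for $(p_{XY},p_{Z|XY})$. A secure protocol is *communication-ideal* for $(p_{XY},p_{Z|XY})$ if for each link $ij$ its $H(M_{ij})$ equals the infimum of $H(M_{ij})$ over all secure protocols for $(p_{XY},p_{Z|XY})$, and *randomness-optimal* if its $H(V_1,V_2,V_3\mid X,Y)$ equals $\rho(p_{XY},p_{Z|XY})$. **Remote $\binom m1$-OT$^n_2$.** $X=(X_0,\dots,X_{m-1})$ consists of $m$ bit strings of length $n$, $Y\in\{0,\dots,m-1\}$, and $Z=X_Y$. **FKN protocol.** Round 1: Alice draws $K_0,\dots,K_{m-1}\in\{0,1\}^n$ and $\pi\in\{0,\dots,m-1\}$ independently and uniformly and sends $(K_0,\dots,K_{m-1},\pi)$ to Bob. Round 2: Alice sends $M^{(i)}=X_{\pi+i}\oplus K_{\pi+i}$ $(0\le i<m$, indices mod $m)$ to Charlie; Bob sends $C=Y-\pi \bmod m$ and $K=K_Y$ to Charlie. Charlie outputs $M^{(C)}\oplus K$. (Indices in $\{0,\dots,m-1\}$ are sent as bit strings of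 length $\lceil\log_2 m\rceil$.) **Theorem.** Let $m\ge 2$, $n\ge 1$, and let $p_{XY}$ be an input distribution with full support. Every secure protocol for remote $\binom m1$-OT$^n_2$ with input distribution $p_{XY}$ satisfies $$H(M_{31})\ge nm,\qquad H(M_{23})\ge n+\log_2 m,\qquad H(M_{12})\ge nm+\log_2 m,$$ and $\rho(p_{XY},\text{remote-OT})\ge nm+\log_2 m$. Moreover, the FKN protocol is a secure protocol for this problem, it is communication-ideal and randomness-optimal, and it attains all four bounds with equality: $H(M_{31})=nm$, $H(M_{23})=n+\log_2 m$, $H(M_{12})=nm+\log_2 m$, and $H(V_1,V_2,V_3\mid X,Y)=nm+\log_2 m$. -/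

import Mathlib

open scoped ENNReal

noncomputable section

namespace SecureThreeParty

/-! ### Discrete information measures (logarithms to base 2)

A probability space is given by a mass function `J : Ω → ℝ≥0∞`, and a random variable is a function
on `Ω`. Entropies take values in `[0, ∞]`, since transcripts range over an infinite alphabet. -/

section Information

variable {Ω α β γ : Type*}

/-- Probability of an event. -/
def prob (J : Ω → ℝ≥0∞) (E : Set Ω) : ℝ≥0∞ := ∑' ω, E.indicator J ω

/-- Shannon entropy `H(A) = -∑ₐ P(a) log₂ P(a)`. -/
def entropy (J : Ω → ℝ≥0∞) (A : Ω → α) : ℝ≥0∞ :=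
  ∑' a, ENNReal.ofReal
    (-((prob J {ω | A ω = a}).toReal * Real.logb 2 (prob J {ω | A ω = a}).toReal))

/-- Conditional entropy `H(A | B) = -∑ P(a,b) log₂ (P(a,b) / P(b))`. -/
def condEntropy (J : Ω → ℝ≥0∞) (A : Ω → α) (B : Ω → β) : ℝ≥0∞ :=
  ∑' ab : α × β, ENNReal.ofReal
    (-((prob J {ω | A ω = ab.1 ∧ B ω = ab.2}).toReal *
      Real.logb 2 ((prob J {ω | A ω = ab.1 ∧ B ω = ab.2}).toReal /
        (prob J {ω | B ω = ab.2}).toReal)))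

/-- The Markov chain `A - B - C`: `A` and `C` are conditionally independent given `B`. -/
def Markov (J : Ω → ℝ≥0∞) (A : Ω → α) (B : Ω → β) (C : Ω → γ) : Prop :=
  ∀ a b c, prob J {ω | A ω = a ∧ B ω = b ∧ C ω = c} * prob J {ω | B ω = b} =
    prob J {ω | A ω = a ∧ B ω = b} * prob J {ω | B ω = b ∧ C ω = c}

end Information

/-! ### Three-party protocols -/

/-- A message sent in one round on one link in one direction; `[]` means that nothing is sent. -/
abbrev Msg := List Bool

/-- The messages of one round; `mij` is sent by party `i` to party `j`. -/
@[ext] structure Round where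
  m12 : Msg
  m21 : Msg
  m23 : Msg
  m32 : Msg
  m31 : Msg
  m13 : Msg

/-- The round in which nobody sends anything. -/
def Round.silent : Round := ⟨[], [], [], [], [], []⟩

/-- What has been sent on one link, round by round (oldest first), in the two directions. -/
abbrev LinkHistory := List (Msg × Msg)

/-- What has been sent on all links, round by round (oldest first). -/
abbrev History := List Round

def History.link12 (h : History) : LinkHistory := h.map fun r => (r.m12, r.m21)
def History.link23 (h : History) : LinkHistory := h.map fun r => (r.m23, r.m32)
def History.link31 (h : History) : LinkHistory := h.map fun r => (r.m31, r.m13)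

/-- The final transcript: on each link two bit strings, one for each direction. -/
@[ext] structure Transcript where
  /-- (sent by 1 to 2, sent by 2 to 1) -/
  link12 : Msg × Msg
  /-- (sent by 2 to 3, sent by 3 to 2) -/
  link23 : Msg × Msg
  /-- (sent by 3 to 1, sent by 1 to 3) -/
  link31 : Msg × Msg

/-- Concatenate all bits sent on a link, for each direction. -/
def LinkHistory.concat (g : LinkHistory) : Msg × Msg :=
  ((g.map Prod.fst).flatten, (g.map Prod.snd).flatten)

def History.transcript (h : History) : Transcript where
  link12 := LinkHistory.concat h.link12
  link23 := LinkHistory.concat h.link23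
  link31 := LinkHistory.concat h.link31

/-- A 3-party protocol. Party 1 has an input in `X`, party 2 an input in `Y`, and party 3 produces
an output in `Z`. In every round each party draws, independently of the others, the pair of messages
it sends from a distribution that depends on its input and on what has been sent on its two links.
In the end party 3 outputs a randomized function of the transcripts of its links. -/
structure Protocol (X Y Z : Type) where
  /-- arguments: input, link 12, link 31; result: (message to 2, message to 3) -/
  next1 : X → LinkHistory → LinkHistory → PMF (Msg × Msg)
  /-- arguments: input, link 12, link 23; result: (message to 1, message to 3) -/
  next2 : Y → LinkHistory → LinkHistory → PMF (Msg × Msg)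
  /-- arguments: link 23, link 31; result: (message to 1, message to 2) -/
  next3 : LinkHistory → LinkHistory → PMF (Msg × Msg)
  /-- arguments: final transcripts of link 23 and link 31 -/
  out3 : Msg × Msg → Msg × Msg → PMF Z

/-- Inputs, output and transcript of an execution. -/
@[ext] structure Outcome (X Y Z : Type) where
  x : X
  y : Y
  z : Z
  tr : Transcript

/-- No codeword is a proper prefix of another one. -/
def PrefixFree (C : Set Msg) : Prop := ∀ u ∈ C, ∀ v ∈ C, u <+: v → u = v

namespace Protocol

variable {X Y Z : Type}

/-- The distribution of the messages of the next round, on inputs `x`, `y`. -/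
def step (P : Protocol X Y Z) (x : X) (y : Y) (h : History) : PMF Round :=
  (P.next1 x h.link12 h.link31).bind fun a =>
    (P.next2 y h.link12 h.link23).bind fun b =>
      (P.next3 h.link23 h.link31).bind fun c =>
        PMF.pure
          { m12 := a.1, m13 := a.2, m21 := b.1, m23 := b.2, m31 := c.1, m32 := c.2 }

/-- The distribution of the history after `t` rounds, on inputs `x`, `y`. -/
def run (P : Protocol X Y Z) (x : X) (y : Y) : ℕ → PMF History
  | 0 => PMF.pure []
  | t + 1 => (P.run x y t).bind fun h => (P.step x y h).map fun r => h ++ [r]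

/-- A terminal state: from `h` on, every party sends only empty strings. -/
def Terminal (P : Protocol X Y Z) (x : X) (y : Y) (h : History) : Prop :=
  ∀ k, P.step x y (h ++ List.replicate k Round.silent) = PMF.pure Round.silent

/-- The probability that, on inputs `x`, `y`, the protocol reaches a terminal state and the final
transcript is `τ` (the supremum is over an increasing sequence, i.e. it is a limit). -/
def finalMass (P : Protocol X Y Z) (x : X) (y : Y) (τ : Transcript) : ℝ≥0∞ :=
  ⨆ t, (P.run x y t).toOuterMeasure {h | P.Terminal x y h ∧ h.transcript = τ}

/-- Well-formedness (for inputs distributed as `p`): the protocol terminates with probability 1, and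
in each direction of each link the message sent in a round is a codeword in a prefix-free code
that is determined by the messages sent on this link in the previous rounds. -/
structure WellFormed (P : Protocol X Y Z) (p : PMF (X × Y)) : Prop where
  terminates : ∀ x y, p (x, y) ≠ 0 → ∑' τ, P.finalMass x y τ = 1
  codes : ∃ C12 C21 C23 C32 C31 C13 : LinkHistory → Set Msg,
    (∀ g, PrefixFree (C12 g) ∧ PrefixFree (C21 g) ∧ PrefixFree (C23 g) ∧ PrefixFree (C32 g) ∧
      PrefixFree (C31 g) ∧ PrefixFree (C13 g)) ∧
    ∀ x y, p (x, y) ≠ 0 → ∀ (t : ℕ) (h : History) (r : Round),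
      h ∈ (P.run x y t).support → r ∈ (P.step x y h).support →
        r.m12 ∈ C12 h.link12 ∧ r.m21 ∈ C21 h.link12 ∧
        r.m23 ∈ C23 h.link23 ∧ r.m32 ∈ C32 h.link23 ∧
        r.m31 ∈ C31 h.link31 ∧ r.m13 ∈ C13 h.link31

/-- The joint distribution of inputs, output and transcript for inputs distributed as `p`. -/
def joint (P : Protocol X Y Z) (p : PMF (X × Y)) (ω : Outcome X Y Z) : ℝ≥0∞ :=
  p (ω.x, ω.y) * P.finalMass ω.x ω.y ω.tr * P.out3 ω.tr.link23 ω.tr.link31 ω.z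

/-- `P` is a perfectly secure protocol for the randomized function `q` (that is, `p_{Z|XY}`) and
the input distribution `p`, with privacy against one passively corrupt party. -/
structure IsSecure (P : Protocol X Y Z) (p : PMF (X × Y)) (q : X → Y → PMF Z) : Prop where
  wellFormed : P.WellFormed p
  correct : ∀ x y, p (x, y) ≠ 0 → ∀ z,
    ∑' τ : Transcript, P.finalMass x y τ * P.out3 τ.link23 τ.link31 z = q x y z
  private1 : Markov (P.joint p) (fun ω => (ω.tr.link12, ω.tr.link31)) (fun ω => ω.x)
    (fun ω => (ω.y, ω.z))
  private2 : Markov (P.joint p) (fun ω => (ω.tr.link12, ω.tr.link23)) (fun ω => ω.y)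
    (fun ω => (ω.x, ω.z))
  private3 : Markov (P.joint p) (fun ω => (ω.tr.link23, ω.tr.link31)) (fun ω => ω.z)
    (fun ω => (ω.x, ω.y))

/-- `H(M₁₂)` -/
def H12 (P : Protocol X Y Z) (p : PMF (X × Y)) : ℝ≥0∞ :=
  entropy (P.joint p) fun ω => ω.tr.link12

/-- `H(M₂₃)` -/
def H23 (P : Protocol X Y Z) (p : PMF (X × Y)) : ℝ≥0∞ :=
  entropy (P.joint p) fun ω => ω.tr.link23

/-- `H(M₃₁)` -/
def H31 (P : Protocol X Y Z) (p : PMF (X × Y)) : ℝ≥0∞ :=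
  entropy (P.joint p) fun ω => ω.tr.link31

/-- The view of party 1: the transcripts of its links, and its input. -/
def view1 (ω : Outcome X Y Z) : (Msg × Msg) × (Msg × Msg) × X := (ω.tr.link12, ω.tr.link31, ω.x)

/-- The view of party 2: the transcripts of its links, and its input. -/
def view2 (ω : Outcome X Y Z) : (Msg × Msg) × (Msg × Msg) × Y := (ω.tr.link12, ω.tr.link23, ω.y)

/-- The view of party 3: the transcripts of its links, and its output. -/
def view3 (ω : Outcome X Y Z) : (Msg × Msg) × (Msg × Msg) × Z := (ω.tr.link23, ω.tr.link31, ω.z)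

/-- The randomness used by `P`: `H(V₁, V₂, V₃ | X, Y)`. -/
def randomness (P : Protocol X Y Z) (p : PMF (X × Y)) : ℝ≥0∞ :=
  condEntropy (P.joint p) (fun ω => (view1 ω, view2 ω, view3 ω)) (fun ω => (ω.x, ω.y))

end Protocol

section Optimality

variable {X Y Z : Type}

/-- The randomness `ρ(p, q)` required to securely compute `q` for input distribution `p`. -/
def rho (p : PMF (X × Y)) (q : X → Y → PMF Z) : ℝ≥0∞ :=
  ⨅ (P : Protocol X Y Z) (_ : P.IsSecure p q), P.randomness p

/-- A secure protocol with the least possible entropy on all three links simultaneously. -/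
def Protocol.CommunicationIdeal (P : Protocol X Y Z) (p : PMF (X × Y)) (q : X → Y → PMF Z) : Prop :=
  P.IsSecure p q ∧
  P.H12 p = (⨅ (P' : Protocol X Y Z) (_ : P'.IsSecure p q), P'.H12 p) ∧
  P.H23 p = (⨅ (P' : Protocol X Y Z) (_ : P'.IsSecure p q), P'.H23 p) ∧
  P.H31 p = (⨅ (P' : Protocol X Y Z) (_ : P'.IsSecure p q), P'.H31 p)

/-- A secure protocol that uses the least possible amount of randomness. -/
def Protocol.RandomnessOptimal (P : Protocol X Y Z) (p : PMF (X × Y)) (q : X → Y → PMF Z) : Prop :=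
  P.IsSecure p q ∧ P.randomness p = rho p q

end Optimality

/-! ### Remote oblivious transfer and the protocol of Feige, Kilian and Naor -/

/-- `m` bit strings of length `n`. -/
abbrev Blocks (m n : ℕ) := Fin m → Fin n → Bool

/-- Remote `(m choose 1)`-OT of `n`-bit strings: the output is `Z = X_Y`. -/
def remoteOT (m n : ℕ) (x : Blocks m n) (y : Fin m) : PMF (Fin n → Bool) := PMF.pure (x y)

/-- Binary encoding of an index with `⌈log₂ m⌉` bits. -/
def encIndex {m : ℕ} (i : Fin m) : Msg :=
  List.ofFn fun j : Fin (Nat.clog 2 m) => i.val.testBit j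

/-- The concatenation of `m` blocks of `n` bits. -/
def encBlocks {m n : ℕ} (K : Blocks m n) : Msg :=
  (List.ofFn fun i => List.ofFn (K i)).flatten

/-- Encoding of `(K₀, …, K_{m-1}, π)`. -/
def encKey {m n : ℕ} (k : Blocks m n × Fin m) : Msg := encBlocks k.1 ++ encIndex k.2

/-- Encoding of `(C, K)`. -/
def encReply {m n : ℕ} (c : Fin m × (Fin n → Bool)) : Msg := encIndex c.1 ++ List.ofFn c.2

/-- Bitwise exclusive or. -/
def bxor {n : ℕ} (u v : Fin n → Bool) : Fin n → Bool := fun j => xor (u j) (v j)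

/-- The Feige-Kilian-Naor protocol. The injective encodings are decoded by `Function.invFun`.

Round 1: Alice draws uniformly distributed blocks `K₀, …, K_{m-1}` and a uniformly distributed
index `π`, and sends them to Bob.
Round 2: Alice sends `M⁽ⁱ⁾ = X_{π+i} ⊕ K_{π+i}`, `0 ≤ i < m`, to Charlie (indices mod `m`), and Bob
sends `C = Y - π` (mod `m`) and `K = K_Y` to Charlie.
Charlie outputs `M⁽ᶜ⁾ ⊕ K`. -/
def fkn (m n : ℕ) [NeZero m] : Protocol (Blocks m n) (Fin m) (Fin n → Bool) where
  next1 := fun x g12 _ =>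
    match g12 with
    | [] => (PMF.uniformOfFintype (Blocks m n × Fin m)).map fun k => (encKey k, [])
    | [(u, _)] =>
      let k : Blocks m n × Fin m := Function.invFun encKey u
      PMF.pure ([], encBlocks fun i => bxor (x (k.2 + i)) (k.1 (k.2 + i)))
    | _ => PMF.pure ([], [])
  next2 := fun y g12 _ =>
    match g12 with
    | [(u, _)] =>
      let k : Blocks m n × Fin m := Function.invFun encKey u
      PMF.pure ([], encReply (y - k.2, k.1 y))
    | _ => PMF.pure ([], [])
  next3 := fun _ _ => PMF.pure ([], [])
  out3 := fun l23 l31 =>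
    let c : Fin m × (Fin n → Bool) := Function.invFun encReply l23.1
    let M : Blocks m n := Function.invFun encBlocks l31.2
    PMF.pure (bxor (M c.1) c.2)

end SecureThreeParty

end

noncomputable section

namespace SecureThreeParty

/-! Since all inputs have positive probability, the Markov conditions say that, for every input
pair, the law of the transcripts on a party's two links depends only on that party's own input or
output (`Computes.markov_iff`). Overlapping these statements makes the law of each single link
independent of the inputs (`law12_eq`, `law23_eq`, `law31_eq`). The probability of a history is a
product of three factors, one for each party (`run_apply`), so an input can be exchanged between
executions that agree on its owner's links (`swap1`, `swap2`). With perfect correctness this shows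
that M₁₂ and M₃₁ determine X, and that M₁₂ and M₂₃ determine Y (`input1_unique`, `input2_unique`).

For links 31 and 23, counting suffices. Sum a probability over all inputs that leave its law
unchanged; once the remaining link is fixed at most one term survives, so each transcript has
probability at most 2^(-nm), respectively 1/(m 2^n) (`law31_le`, `law23_le`).

Link 12 is bounded on average. Give Alice the input (z,…,z), and let z and y range over all values;
this is legitimate because the link laws do not depend on the inputs. A history then has weight w =
A·B·C, one factor per party, with B summed over y. Factor the laws D₁₂ ≤ F₁₂S₁₂ and D₂₃ ≤ F₂₃S₂₃
into messages received by Bob (F) and messages sent by Bob (S). Now B·F₁₂·F₂₃ describes Bob facing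
two simulated neighbours, while A·S₁₂ and C·S₂₃ describe Alice and Charlie, joined by link 31, each
facing its own simulated Bob. Real and simulated weights are compared through three ratios of mean
at most 1 (`tsum_ratio1_le`, `tsum_ratio2_le`, `tsum_ratio3_le`) whose product is at least
2^(nm)·m·D₁₂ (`le_ratio_mul`). Taking logarithms, using log f ≤ f - 1 and averaging gives H(M₁₂) ≥
nm + log m (`log_le_tsum_law12`). The second and third ratios pass through a law in which, given
link 31, Alice's z and Charlie's output are drawn separately; compared with a single ratio this
gains a factor 2^n.

The randomness bound follows since M₁₂ is part of the views and independent of the inputs. For the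
FKN protocol everything is a function of the inputs and one uniform key, which gives the matching
upper bounds. -/

theorem ennreal_tsum_prod {α β : Type*} (f : α × β → ℝ≥0∞) :
    ∑' q, f q = ∑' a, ∑' b, f (a, b) :=
  ENNReal.tsum_prod (f := fun a b => f (a, b))

/-! ### Path weights -/

section PathWeight

variable {ρ σ U V : Type*}

/-- The product of the transition weights along a list read in reverse order. -/
def pathWeightRev (K : List ρ → ρ → ℝ≥0∞) : List ρ → ℝ≥0∞
  | [] => 1
  | r :: l => pathWeightRev K l * K l.reverse r

/-- The product of the weights `K (r₁, …, rᵢ) rᵢ₊₁` along a list. -/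
def pathWeight (K : List ρ → ρ → ℝ≥0∞) (l : List ρ) : ℝ≥0∞ := pathWeightRev K l.reverse

@[simp] theorem pathWeight_nil (K : List ρ → ρ → ℝ≥0∞) : pathWeight K [] = 1 := rfl

@[simp] theorem pathWeight_append (K : List ρ → ρ → ℝ≥0∞) (l : List ρ) (r : ρ) :
    pathWeight K (l ++ [r]) = pathWeight K l * K l r := by
  simp [pathWeight, pathWeightRev]

theorem pathWeight_mul (K K' : List ρ → ρ → ℝ≥0∞) (l : List ρ) :
    pathWeight (fun l r => K l r * K' l r) l = pathWeight K l * pathWeight K' l := by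
  induction l using List.reverseRecOn with
  | nil => simp
  | append_singleton l r ih => simp only [pathWeight_append, ih]; ring

theorem pathWeight_map (f : ρ → σ) (K : List σ → σ → ℝ≥0∞) (l : List ρ) :
    pathWeight (fun l r => K (l.map f) (f r)) l = pathWeight K (l.map f) := by
  induction l using List.reverseRecOn with
  | nil => simp
  | append_singleton l r ih => simp [ih]

/-- Appending a letter is a bijection from pairs (list of length `t`, letter) to lists of length `t
+ 1`. All inductions on the number of rounds use this form. -/
theorem tsum_length_succ (φ : List ρ → ℝ≥0∞) (t : ℕ) :
    ∑' l : List ρ, (if l.length = t + 1 then φ l else 0) =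
      ∑' l : List ρ, if l.length = t then ∑' r, φ (l ++ [r]) else 0 := by
  have hinj : Function.Injective fun q : List ρ × ρ => q.1 ++ [q.2] := by
    rintro ⟨l, r⟩ ⟨l', r'⟩ h
    obtain ⟨h1, h2⟩ := List.append_inj' h rfl
    simp_all
  rw [← hinj.tsum_eq]
  · rw [ennreal_tsum_prod]
    refine tsum_congr fun l => ?_
    by_cases h : l.length = t <;> simp [h]
  · intro l hl
    have hlen : l.length = t + 1 := by
      by_contra h
      simp [h] at hl
    have hne : l ≠ [] := by rintro rfl; simp at hlen
    exact ⟨(l.dropLast, l.getLast hne), List.dropLast_append_getLast hne⟩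

theorem tsum_length_zero (φ : List ρ → ℝ≥0∞) :
    ∑' l : List ρ, (if l.length = 0 then φ l else 0) = φ [] := by
  rw [tsum_eq_single []]
  · simp
  · intro l hl
    simp [hl]

/-- Summing out the last letter never increases the total. Subprobability kernels are enough, so
this also covers executions in which some parties are replaced by conditional weights. -/
theorem tsum_pathWeight_le_one {K : List ρ → ρ → ℝ≥0∞} (hK : ∀ l, ∑' r, K l r ≤ 1) (t : ℕ) :
    ∑' l : List ρ, (if l.length = t then pathWeight K l else 0) ≤ 1 := by
  induction t with
  | zero => rw [tsum_length_zero]; simp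
  | succ t ih =>
    rw [tsum_length_succ]
    refine le_trans (ENNReal.tsum_le_tsum fun l => ?_) ih
    split_ifs
    · simp only [pathWeight_append, ENNReal.tsum_mul_left]
      exact mul_le_of_le_one_right' (hK l)
    · exact le_rfl

/-- Conditional weight of the first component `u` of the next letter, for a marginal `Q` on
prefixes. -/
def condFst (Q : List ρ → ℝ≥0∞) (e : U × V ≃ ρ) (l : List ρ) (u : U) : ℝ≥0∞ :=
  (∑' v, Q (l ++ [e (u, v)])) / Q l

/-- Conditional weight of the second component of the next letter given the first one. -/
def condSnd (Q : List ρ → ℝ≥0∞) (e : U × V ≃ ρ) (l : List ρ) (u : U) (v : V) : ℝ≥0∞ :=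
  Q (l ++ [e (u, v)]) / ∑' v', Q (l ++ [e (u, v')])

theorem tsum_condFst_le_one {Q : List ρ → ℝ≥0∞} (e : U × V ≃ ρ)
    (hQ : ∀ l, ∑' r, Q (l ++ [r]) ≤ Q l) (l : List ρ) : ∑' u, condFst Q e l u ≤ 1 := by
  simp only [condFst, div_eq_mul_inv, ENNReal.tsum_mul_right]
  rw [← ENNReal.tsum_prod (f := fun u v => Q (l ++ [e (u, v)])),
    e.tsum_eq (fun r => Q (l ++ [r]))]
  exact (mul_le_mul_left (hQ l) _).trans ENNReal.div_self_le_one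

theorem tsum_condSnd_le_one (Q : List ρ → ℝ≥0∞) (e : U × V ≃ ρ) (l : List ρ) (u : U) :
    ∑' v, condSnd Q e l u v ≤ 1 := by
  simp only [condSnd, div_eq_mul_inv, ENNReal.tsum_mul_right]
  exact ENNReal.div_self_le_one

/-- The chain rule for a submultiplicative family of marginals. -/
theorem le_pathWeight_condFst_mul_condSnd {Q : List ρ → ℝ≥0∞} (e : U × V ≃ ρ) (h0 : Q [] ≤ 1)
    (hQ : ∀ l, ∑' r, Q (l ++ [r]) ≤ Q l) (l : List ρ) :
    Q l ≤ pathWeight (fun l r => condFst Q e l (e.symm r).1) l *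
      pathWeight (fun l r => condSnd Q e l (e.symm r).1 (e.symm r).2) l := by
  have h1 : ∀ l, Q l ≤ 1 := by
    intro l
    induction l using List.reverseRecOn with
    | nil => exact h0
    | append_singleton l r ih => exact ((ENNReal.le_tsum r).trans (hQ l)).trans ih
  induction l using List.reverseRecOn with
  | nil => simpa using h0
  | append_singleton l r ih =>
    obtain ⟨⟨u, v⟩, rfl⟩ := e.surjective r
    simp only [pathWeight_append, Equiv.symm_apply_apply]
    set S := ∑' v', Q (l ++ [e (u, v')]) with hS
    have hSl : S ≤ Q l := by
      refine le_trans ?_ (hQ l)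
      rw [← e.tsum_eq (fun r => Q (l ++ [r])), ennreal_tsum_prod]
      exact ENNReal.le_tsum (f := fun u => ∑' v, Q (l ++ [e (u, v)])) u
    have hle : Q (l ++ [e (u, v)]) ≤ S := ENNReal.le_tsum (f := fun v => Q (l ++ [e (u, v)])) v
    -- If `S = 0` the left side vanishes; otherwise `S` and `Q l` are nonzero and finite, and the
    -- telescoping quotients cancel.
    by_cases hz : S = 0
    · rw [hz] at hle
      exact hle.trans zero_le
    have hSt : S ≠ ∞ := ((hSl.trans (h1 l)).trans_lt ENNReal.one_lt_top).ne
    have hQz : Q l ≠ 0 := fun h => hz (le_antisymm (h ▸ hSl) zero_le)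
    have hQt : Q l ≠ ∞ := ((h1 l).trans_lt ENNReal.one_lt_top).ne
    calc Q (l ++ [e (u, v)]) = Q l * (S / Q l * (Q (l ++ [e (u, v)]) / S)) := by
          rw [← mul_assoc, ENNReal.mul_div_cancel hQz hQt, ENNReal.mul_div_cancel hz hSt]
      _ ≤ _ := by
          refine (mul_le_mul_left ih _).trans (le_of_eq ?_)
          simp only [condFst, condSnd, ← hS]
          ring

end PathWeight

/-! ### Runs of a protocol as path weights -/

/-- The messages of one round on the two links of party 1. -/
def Round.pair1 (r : Round) : (Msg × Msg) × (Msg × Msg) := ((r.m12, r.m21), (r.m31, r.m13))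

/-- The messages of one round on the two links of party 2. -/
def Round.pair2 (r : Round) : (Msg × Msg) × (Msg × Msg) := ((r.m12, r.m21), (r.m23, r.m32))

/-- The messages of one round on the two links of party 3. -/
def Round.pair3 (r : Round) : (Msg × Msg) × (Msg × Msg) := ((r.m23, r.m32), (r.m31, r.m13))

theorem History.map_fst_pair1 (h : History) : (h.map Round.pair1).map Prod.fst = h.link12 := by
  simp [History.link12, Round.pair1]
theorem History.map_snd_pair1 (h : History) : (h.map Round.pair1).map Prod.snd = h.link31 := by
  simp [History.link31, Round.pair1]
theorem History.map_fst_pair2 (h : History) : (h.map Round.pair2).map Prod.fst = h.link12 := by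
  simp [History.link12, Round.pair2]
theorem History.map_snd_pair2 (h : History) : (h.map Round.pair2).map Prod.snd = h.link23 := by
  simp [History.link23, Round.pair2]
theorem History.map_fst_pair3 (h : History) : (h.map Round.pair3).map Prod.fst = h.link23 := by
  simp [History.link23, Round.pair3]
theorem History.map_snd_pair3 (h : History) : (h.map Round.pair3).map Prod.snd = h.link31 := by
  simp [History.link31, Round.pair3]

theorem History.ext_links {h h' : History} (h12 : h.link12 = h'.link12)
    (h23 : h.link23 = h'.link23) (h31 : h.link31 = h'.link31) : h = h' := by
  induction h generalizing h' with
  | nil =>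
    have : h'.length = 0 := by simpa [History.link12] using (congrArg List.length h12).symm
    exact (List.length_eq_zero_iff.1 this).symm
  | cons r h ih =>
    cases h' with
    | nil => simp [History.link12] at h12
    | cons r' h' =>
      simp only [History.link12, History.link23, History.link31, List.map_cons, List.cons.injEq,
        Prod.mk.injEq] at h12 h23 h31
      rw [ih h12.2 h23.2 h31.2, Round.ext h12.1.1 h12.1.2 h23.1.1 h23.1.2 h31.1.1 h31.1.2]

/-- A round is a triple of pairs of messages, one pair sent by each party. -/
def roundEquiv : (Msg × Msg) × (Msg × Msg) × (Msg × Msg) ≃ Round where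
  toFun q := { m12 := q.1.1, m13 := q.1.2, m21 := q.2.1.1, m23 := q.2.1.2,
               m31 := q.2.2.1, m32 := q.2.2.2 }
  invFun r := ((r.m12, r.m13), (r.m21, r.m23), (r.m31, r.m32))
  left_inv _ := rfl
  right_inv _ := rfl

namespace Protocol

variable {X Y Z : Type}

/-- Transition weight of party 1. -/
def kernel1 (P : Protocol X Y Z) (x : X) (l : List ((Msg × Msg) × (Msg × Msg)))
    (r : (Msg × Msg) × (Msg × Msg)) : ℝ≥0∞ :=
  P.next1 x (l.map Prod.fst) (l.map Prod.snd) (r.1.1, r.2.2)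

/-- Transition weight of party 2. -/
def kernel2 (P : Protocol X Y Z) (y : Y) (l : List ((Msg × Msg) × (Msg × Msg)))
    (r : (Msg × Msg) × (Msg × Msg)) : ℝ≥0∞ :=
  P.next2 y (l.map Prod.fst) (l.map Prod.snd) (r.1.2, r.2.1)

/-- Transition weight of party 3. -/
def kernel3 (P : Protocol X Y Z) (l : List ((Msg × Msg) × (Msg × Msg)))
    (r : (Msg × Msg) × (Msg × Msg)) : ℝ≥0∞ :=
  P.next3 (l.map Prod.fst) (l.map Prod.snd) (r.2.1, r.1.2)

theorem step_eq_map (P : Protocol X Y Z) (x : X) (y : Y) (h : History) :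
    P.step x y h = ((P.next1 x h.link12 h.link31).bind fun a =>
      (P.next2 y h.link12 h.link23).bind fun b =>
        (P.next3 h.link23 h.link31).map fun c => roundEquiv (a, b, c)) := rfl

theorem step_apply (P : Protocol X Y Z) (x : X) (y : Y) (h : History) (r : Round) :
    P.step x y h r = P.next1 x h.link12 h.link31 (r.m12, r.m13) *
      P.next2 y h.link12 h.link23 (r.m21, r.m23) *
      P.next3 h.link23 h.link31 (r.m31, r.m32) := by
  rw [step_eq_map]
  simp only [PMF.bind_apply, PMF.map_apply]
  rw [tsum_eq_single (r.m12, r.m13), tsum_eq_single (r.m21, r.m23),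
    tsum_eq_single (r.m31, r.m32), if_pos, mul_assoc]
  · rfl
  · intro c hc
    rw [if_neg]
    intro he
    exact hc (congrArg (fun r => (r.m31, r.m32)) he).symm
  · intro b hb
    refine mul_eq_zero_of_right _ (ENNReal.tsum_eq_zero.2 fun c => ?_)
    rw [if_neg]
    intro he
    exact hb (congrArg (fun r => (r.m21, r.m23)) he).symm
  · intro a ha
    refine mul_eq_zero_of_right _ (ENNReal.tsum_eq_zero.2 fun b => ?_)
    refine mul_eq_zero_of_right _ (ENNReal.tsum_eq_zero.2 fun c => ?_)
    rw [if_neg]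
    intro he
    exact ha (congrArg (fun r => (r.m12, r.m13)) he).symm

/-- No party sees all three links, and the parties draw independently; hence one factor per party,
each depending on two links only. This is the source of the product form of histories. -/
theorem step_apply_kernel (P : Protocol X Y Z) (x : X) (y : Y) (h : History) (r : Round) :
    P.step x y h r = P.kernel1 x (h.map Round.pair1) r.pair1 *
      P.kernel2 y (h.map Round.pair2) r.pair2 * P.kernel3 (h.map Round.pair3) r.pair3 := by
  simp only [step_apply, kernel1, kernel2, kernel3, History.map_fst_pair1, History.map_snd_pair1,
    History.map_fst_pair2, History.map_snd_pair2, History.map_fst_pair3, History.map_snd_pair3]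
  rfl

theorem run_succ_apply (P : Protocol X Y Z) (x : X) (y : Y) (t : ℕ) (h : History) (r : Round) :
    P.run x y (t + 1) (h ++ [r]) = P.run x y t h * P.step x y h r := by
  simp only [run, PMF.bind_apply, PMF.map_apply]
  rw [tsum_eq_single h]
  · rw [tsum_eq_single r]
    · simp
    · intro r' hr
      simp [Ne.symm hr]
  · intro h' hh
    refine mul_eq_zero_of_right _ (ENNReal.tsum_eq_zero.2 fun r' => ?_)
    rw [if_neg]
    intro he
    exact hh (List.append_inj' he rfl).1.symm

theorem length_of_mem_support_run (P : Protocol X Y Z) (x : X) (y : Y) (t : ℕ) :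
    ∀ h ∈ (P.run x y t).support, h.length = t := by
  induction t with
  | zero => intro h hh; simpa [run] using hh
  | succ t ih =>
    intro h hh
    simp only [run, PMF.mem_support_bind_iff, PMF.mem_support_map_iff] at hh
    obtain ⟨h', hh', r, -, rfl⟩ := hh
    simp [ih h' hh']

theorem run_apply_eq_zero (P : Protocol X Y Z) (x : X) (y : Y) {t : ℕ} {h : History}
    (hh : h.length ≠ t) : P.run x y t h = 0 := by
  by_contra hc
  exact hh (P.length_of_mem_support_run x y t h hc)

/-- The weight of a history, as a product over the parties. -/
theorem run_apply (P : Protocol X Y Z) (x : X) (y : Y) (h : History) :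
    P.run x y h.length h = pathWeight (P.kernel1 x) (h.map Round.pair1) *
      pathWeight (P.kernel2 y) (h.map Round.pair2) * pathWeight P.kernel3 (h.map Round.pair3) := by
  induction h using List.reverseRecOn with
  | nil => simp [run]
  | append_singleton h r ih =>
    rw [List.length_append, List.length_singleton, run_succ_apply, ih, step_apply_kernel]
    simp only [List.map_append, List.map_cons, List.map_nil, pathWeight_append]
    ring

theorem tsum_run_succ (P : Protocol X Y Z) (x : X) (y : Y) (t : ℕ) (φ : History → ℝ≥0∞) :
    ∑' h, P.run x y (t + 1) h * φ h =
      ∑' h, P.run x y t h * ∑' r, P.step x y h r * φ (h ++ [r]) := by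
  have h1 : ∀ s (φ : History → ℝ≥0∞), ∑' h, P.run x y s h * φ h =
      ∑' h : History, if h.length = s then P.run x y s h * φ h else 0 := by
    intro s φ
    refine tsum_congr fun h => ?_
    split_ifs with hs
    · rfl
    · rw [P.run_apply_eq_zero x y hs, zero_mul]
  rw [h1, tsum_length_succ, h1]
  refine tsum_congr fun h => ?_
  split_ifs
  · simp only [run_succ_apply, mul_assoc, ENNReal.tsum_mul_left]
  · rfl

end Protocol

/-! ### Decoding of link histories -/

/-- All messages of a link history are codewords of the codes `C` and `C'`. -/
def Coded (C C' : LinkHistory → Set Msg) : LinkHistory → Prop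
  | [] => True
  | a :: g => a.1 ∈ C [] ∧ a.2 ∈ C' [] ∧ Coded (fun g => C (a :: g)) (fun g => C' (a :: g)) g

theorem coded_append (C C' : LinkHistory → Set Msg) (g : LinkHistory) (a : Msg × Msg) :
    Coded C C' (g ++ [a]) ↔ Coded C C' g ∧ a.1 ∈ C g ∧ a.2 ∈ C' g := by
  induction g generalizing C C' with
  | nil => simp [Coded]
  | cons b g ih => simp [Coded, ih, and_assoc]

theorem PrefixFree.eq_of_append {C : Set Msg} (hC : PrefixFree C) {u v s t : Msg} (hu : u ∈ C)
    (hv : v ∈ C) (h : u ++ s = v ++ t) : u = v := by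
  rcases List.prefix_or_prefix_of_prefix (List.prefix_append u s)
    (h ▸ List.prefix_append v t) with h1 | h1
  · exact hC u hu v hv h1
  · exact (hC v hv u hu h1).symm

/-- Decoding proceeds round by round: once the past agrees, both histories use the same code in the
next round, and prefix-freeness isolates the codeword. Equal lengths must be assumed because rounds
of empty words are invisible in the concatenation. -/
theorem Coded.eq_of_concat_eq {C C' : LinkHistory → Set Msg} (hC : ∀ g, PrefixFree (C g))
    (hC' : ∀ g, PrefixFree (C' g)) {g g' : LinkHistory} (hg : Coded C C' g)
    (hg' : Coded C C' g') (hlen : g.length = g'.length)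
    (hcat : LinkHistory.concat g = LinkHistory.concat g') : g = g' := by
  induction g generalizing C C' g' with
  | nil => exact (List.length_eq_zero_iff.1 hlen.symm).symm
  | cons a g ih =>
    cases g' with
    | nil => simp at hlen
    | cons b g' =>
      simp only [LinkHistory.concat, List.map_cons, List.flatten_cons, Prod.mk.injEq] at hcat
      have h1 : a = b := Prod.ext ((hC []).eq_of_append hg.1 hg'.1 hcat.1)
        ((hC' []).eq_of_append hg.2.1 hg'.2.1 hcat.2)
      subst h1
      simp only [List.append_cancel_left_eq] at hcat
      rw [ih (fun g => hC _) (fun g => hC' _) hg.2.2 hg'.2.2 (by simpa using hlen)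
        (Prod.ext hcat.1 hcat.2)]

theorem concat_append_nil (g : LinkHistory) :
    LinkHistory.concat (g ++ [([], [])]) = LinkHistory.concat g := by
  simp [LinkHistory.concat]

theorem transcript_append_silent (h : History) :
    History.transcript (h ++ [Round.silent]) = h.transcript := by
  simp [History.transcript, History.link12, History.link23, History.link31, concat_append_nil,
    Round.silent]

theorem transcript_append_replicate (h : History) (k : ℕ) :
    History.transcript (h ++ List.replicate k Round.silent) = h.transcript := by
  induction k with
  | zero => simp
  | succ k ih => rw [List.replicate_succ', ← List.append_assoc, transcript_append_silent, ih]

namespace Protocol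

variable {X Y Z : Type}

/-- The conditions on the codes in `WellFormed`, for all inputs. -/
theorem WellFormed.codes' {P : Protocol X Y Z} {p : PMF (X × Y)} (hP : P.WellFormed p)
    (hp : ∀ q, p q ≠ 0) : ∃ C12 C21 C23 C32 C31 C13 : LinkHistory → Set Msg,
    (∀ g, PrefixFree (C12 g) ∧ PrefixFree (C21 g) ∧ PrefixFree (C23 g) ∧ PrefixFree (C32 g) ∧
      PrefixFree (C31 g) ∧ PrefixFree (C13 g)) ∧
    ∀ x y (t : ℕ) (h : History) (r : Round),
      h ∈ (P.run x y t).support → r ∈ (P.step x y h).support →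
        r.m12 ∈ C12 h.link12 ∧ r.m21 ∈ C21 h.link12 ∧
        r.m23 ∈ C23 h.link23 ∧ r.m32 ∈ C32 h.link23 ∧
        r.m31 ∈ C31 h.link31 ∧ r.m13 ∈ C13 h.link31 := by
  obtain ⟨C12, C21, C23, C32, C31, C13, h1, h2⟩ := hP.codes
  exact ⟨C12, C21, C23, C32, C31, C13, h1, fun x y => h2 x y (hp _)⟩

/-- The history `h` has positive probability for some pair of inputs. -/
def Reachable (P : Protocol X Y Z) (h : History) : Prop :=
  ∃ x y, h ∈ (P.run x y h.length).support

theorem reachable_of_mem {P : Protocol X Y Z} {x : X} {y : Y} {t : ℕ} {h : History}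
    (hh : h ∈ (P.run x y t).support) : P.Reachable h :=
  ⟨x, y, (P.length_of_mem_support_run x y t h hh).symm ▸ hh⟩

/-- On each link, the histories of a well-formed protocol are uniquely decodable. -/
structure UniquelyDecodable (P : Protocol X Y Z) : Prop where
  link12 : ∀ h h', P.Reachable h → P.Reachable h' → h.length = h'.length →
    LinkHistory.concat h.link12 = LinkHistory.concat h'.link12 → h.link12 = h'.link12
  link23 : ∀ h h', P.Reachable h → P.Reachable h' → h.length = h'.length →
    LinkHistory.concat h.link23 = LinkHistory.concat h'.link23 → h.link23 = h'.link23
  link31 : ∀ h h', P.Reachable h → P.Reachable h' → h.length = h'.length →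
    LinkHistory.concat h.link31 = LinkHistory.concat h'.link31 → h.link31 = h'.link31
  /-- Termination of a history does not depend on the inputs. -/
  terminal : ∀ x y x' y' t h, h ∈ (P.run x y t).support → h ∈ (P.run x' y' t).support →
    P.Terminal x y h → P.Terminal x' y' h

theorem mem_support_run_succ {P : Protocol X Y Z} {x : X} {y : Y} {t : ℕ} {h : History}
    {r : Round} : h ++ [r] ∈ (P.run x y (t + 1)).support ↔
      h ∈ (P.run x y t).support ∧ r ∈ (P.step x y h).support := by
  simp [PMF.mem_support_iff, run_succ_apply]

theorem Terminal.step_eq {P : Protocol X Y Z} {x : X} {y : Y} {h : History}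
    (hh : P.Terminal x y h) : P.step x y h = PMF.pure Round.silent := by
  simpa using hh 0

theorem Terminal.append {P : Protocol X Y Z} {x : X} {y : Y} {h : History}
    (hh : P.Terminal x y h) : P.Terminal x y (h ++ [Round.silent]) := by
  intro k
  have := hh (k + 1)
  rwa [List.replicate_succ, ← List.singleton_append, ← List.append_assoc] at this

theorem Terminal.run_append {P : Protocol X Y Z} {x : X} {y : Y} {h : History} {t : ℕ}
    (hh : P.Terminal x y h) : P.run x y (t + 1) (h ++ [Round.silent]) = P.run x y t h := by
  rw [run_succ_apply, hh.step_eq]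
  simp

theorem Terminal.append_replicate {P : Protocol X Y Z} {x : X} {y : Y} {h : History}
    (hh : P.Terminal x y h) (k : ℕ) : P.Terminal x y (h ++ List.replicate k Round.silent) := by
  induction k with
  | zero => simpa
  | succ k ih => rw [List.replicate_succ', ← List.append_assoc]; exact ih.append

theorem Terminal.run_append_replicate {P : Protocol X Y Z} {x : X} {y : Y} {h : History} {t : ℕ}
    (hh : P.Terminal x y h) (k : ℕ) :
    P.run x y (t + k) (h ++ List.replicate k Round.silent) = P.run x y t h := by
  induction k with
  | zero => simp
  | succ k ih =>
    rw [List.replicate_succ', ← List.append_assoc, ← add_assoc,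
      (hh.append_replicate k).run_append, ih]

theorem WellFormed.uniquelyDecodable {P : Protocol X Y Z} {p : PMF (X × Y)}
    (hP : P.WellFormed p) (hp : ∀ q, p q ≠ 0) : P.UniquelyDecodable := by
  obtain ⟨C12, C21, C23, C32, C31, C13, h1, h2⟩ := hP.codes' hp
  have key : ∀ x y (h : History) t, h ∈ (P.run x y t).support → Coded C12 C21 h.link12 ∧
      Coded C23 C32 h.link23 ∧ Coded C31 C13 h.link31 := by
    intro x y h
    induction h using List.reverseRecOn with
    | nil => simp [Coded, History.link12, History.link23, History.link31]
    | append_singleton h r ih =>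
      intro t hh
      have hlen := P.length_of_mem_support_run x y t _ hh
      rw [List.length_append, List.length_singleton] at hlen
      subst hlen
      obtain ⟨h3, h4⟩ := mem_support_run_succ.1 hh
      obtain ⟨i1, i2, i3⟩ := ih _ h3
      obtain ⟨j1, j2, j3, j4, j5, j6⟩ := h2 x y _ h r h3 h4
      simp only [History.link12, History.link23, History.link31, List.map_append, List.map_cons,
        List.map_nil, coded_append] at *
      exact ⟨⟨i1, j1, j2⟩, ⟨i2, j3, j4⟩, i3, j5, j6⟩
  refine ⟨?_, ?_, ?_, ?_⟩
  · rintro h h' ⟨x, y, hh⟩ ⟨x', y', hh'⟩ hl hc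
    exact (key x y h _ hh).1.eq_of_concat_eq (fun g => (h1 g).1) (fun g => (h1 g).2.1)
      (key x' y' h' _ hh').1 (by simpa [History.link12] using hl) hc
  · rintro h h' ⟨x, y, hh⟩ ⟨x', y', hh'⟩ hl hc
    exact (key x y h _ hh).2.1.eq_of_concat_eq (fun g => (h1 g).2.2.1) (fun g => (h1 g).2.2.2.1)
      (key x' y' h' _ hh').2.1 (by simpa [History.link23] using hl) hc
  · rintro h h' ⟨x, y, hh⟩ ⟨x', y', hh'⟩ hl hc
    exact (key x y h _ hh).2.2.eq_of_concat_eq (fun g => (h1 g).2.2.2.2.1)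
      (fun g => (h1 g).2.2.2.2.2) (key x' y' h' _ hh').2.2
      (by simpa [History.link31] using hl) hc
  · intro x y x' y' t h hh hh' hT
    -- At a terminal history the empty word is a codeword in all six codes. It is a prefix of every
    -- word, so it is the only codeword, and any inputs that can reach this history must be silent
    -- as well.
    have hstep : ∀ t h, h ∈ (P.run x y t).support → h ∈ (P.run x' y' t).support →
        P.Terminal x y h → P.step x' y' h = PMF.pure Round.silent := by
      intro t h hh hh' hT
      have hs : Round.silent ∈ (P.step x y h).support := by rw [hT.step_eq]; simp
      have hall : ∀ r ∈ (P.step x' y' h).support, r = Round.silent := by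
        intro r hr
        obtain ⟨i1, i2, i3, i4, i5, i6⟩ := h2 x y t h _ hh hs
        obtain ⟨j1, j2, j3, j4, j5, j6⟩ := h2 x' y' t h r hh' hr
        obtain ⟨c1, c2, -, -, -, -⟩ := h1 h.link12
        obtain ⟨-, -, c3, c4, -, -⟩ := h1 h.link23
        obtain ⟨-, -, -, -, c5, c6⟩ := h1 h.link31
        exact Round.ext (c1 _ i1 _ j1 List.nil_prefix).symm (c2 _ i2 _ j2 List.nil_prefix).symm
          (c3 _ i3 _ j3 List.nil_prefix).symm (c4 _ i4 _ j4 List.nil_prefix).symm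
          (c5 _ i5 _ j5 List.nil_prefix).symm (c6 _ i6 _ j6 List.nil_prefix).symm
      have h0 : ∀ r, r ≠ Round.silent → P.step x' y' h r = 0 := by
        intro r hr
        by_contra hc
        exact hr (hall r hc)
      have h1 : P.step x' y' h Round.silent = 1 := by
        rw [← (P.step x' y' h).tsum_coe, tsum_eq_single Round.silent h0]
      ext r
      by_cases hr : r = Round.silent
      · subst hr; simp [h1]
      · simp [h0 r hr, hr]
    -- The silent continuation stays reachable for the other inputs, so the previous argument
    -- applies again after every further round.
    have hrun : ∀ k, h ++ List.replicate k Round.silent ∈ (P.run x' y' (t + k)).support := by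
      intro k
      induction k with
      | zero => simpa
      | succ k ih =>
        rw [List.replicate_succ', ← List.append_assoc, ← add_assoc, mem_support_run_succ]
        refine ⟨ih, ?_⟩
        rw [hstep (t + k) _ ?_ ih (hT.append_replicate k)]
        · simp
        · rw [PMF.mem_support_iff, hT.run_append_replicate]; exact hh
    intro k
    refine hstep (t + k) _ ?_ (hrun k) (hT.append_replicate k)
    rw [PMF.mem_support_iff, hT.run_append_replicate]; exact hh

end Protocol

/-! ### Final transcripts as limits of terminated histories -/

theorem tsum_iSup_of_monotone {α : Type*} {f : ℕ → α → ℝ≥0∞} (hf : ∀ a, Monotone fun t => f t a) :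
    ∑' a, ⨆ t, f t a = ⨆ t, ∑' a, f t a := by
  simp only [ENNReal.tsum_eq_iSup_sum]
  rw [iSup_comm]
  refine iSup_congr fun s => ?_
  exact ENNReal.finsetSum_iSup_of_monotone fun a => hf a

open scoped Classical

namespace Protocol

variable {X Y Z : Type}

/-- The probability that the history after `t` rounds is `h`, restricted to terminal states. -/
def termRun (P : Protocol X Y Z) (x : X) (y : Y) (t : ℕ) (h : History) : ℝ≥0∞ :=
  if P.Terminal x y h then P.run x y t h else 0

theorem termRun_le_run (P : Protocol X Y Z) (x : X) (y : Y) (t : ℕ) (h : History) :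
    P.termRun x y t h ≤ P.run x y t h := by
  rw [termRun]; split_ifs
  · exact le_rfl
  · exact zero_le

theorem termRun_ne_zero_iff {P : Protocol X Y Z} {x : X} {y : Y} {t : ℕ} {h : History} :
    P.termRun x y t h ≠ 0 ↔ P.Terminal x y h ∧ h ∈ (P.run x y t).support := by
  simp [termRun, PMF.mem_support_iff]

theorem toOuterMeasure_terminal (P : Protocol X Y Z) (x : X) (y : Y) (t : ℕ) (τ : Transcript) :
    (P.run x y t).toOuterMeasure {h | P.Terminal x y h ∧ h.transcript = τ} =
      ∑' h, if h.transcript = τ then P.termRun x y t h else 0 := by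
  rw [PMF.toOuterMeasure_apply]
  refine tsum_congr fun h => ?_
  by_cases h1 : P.Terminal x y h <;> by_cases h2 : h.transcript = τ <;>
    simp [Set.indicator, termRun, h1, h2]

/-- Terminal states persist. -/
theorem monotone_tsum_termRun (P : Protocol X Y Z) (x : X) (y : Y) (φ : Transcript → ℝ≥0∞) :
    Monotone fun t => ∑' h : History, P.termRun x y t h * φ h.transcript := by
  refine monotone_nat_of_le_succ fun t => ?_
  have hinj : Function.Injective fun h : History => h ++ [Round.silent] :=
    fun h h' hh => (List.append_inj' hh rfl).1
  refine le_trans (ENNReal.tsum_le_tsum fun h => ?_) (ENNReal.tsum_comp_le_tsum_of_injective hinj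
    fun h => P.termRun x y (t + 1) h * φ h.transcript)
  rw [transcript_append_silent]
  by_cases hh : P.Terminal x y h
  · simp [termRun, hh, hh.append, hh.run_append]
  · simp [termRun, hh]

theorem finalMass_eq_iSup (P : Protocol X Y Z) (x : X) (y : Y) (τ : Transcript) :
    P.finalMass x y τ =
      ⨆ t, ∑' h : History, P.termRun x y t h * if h.transcript = τ then 1 else 0 := by
  simp only [finalMass, toOuterMeasure_terminal, mul_ite, mul_one, mul_zero]

/-- Monotone convergence: terminated mass only accumulates, so the limit in time commutes with the
sum over transcripts. -/
theorem tsum_finalMass_mul (P : Protocol X Y Z) (x : X) (y : Y) (φ : Transcript → ℝ≥0∞) :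
    ∑' τ, P.finalMass x y τ * φ τ =
      ⨆ t, ∑' h : History, P.termRun x y t h * φ h.transcript := by
  simp only [finalMass_eq_iSup, ENNReal.iSup_mul]
  rw [tsum_iSup_of_monotone]
  · refine iSup_congr fun t => ?_
    simp only [← ENNReal.tsum_mul_right]
    rw [ENNReal.tsum_comm]
    refine tsum_congr fun h => ?_
    rw [tsum_eq_single h.transcript]
    · simp
    · intro τ hτ
      simp [Ne.symm hτ]
  · intro τ s t hst
    exact mul_le_mul_left (P.monotone_tsum_termRun x y
      (fun σ => if σ = τ then 1 else 0) hst) _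

theorem iSup_tsum_termRun (P : Protocol X Y Z) (x : X) (y : Y) :
    ⨆ t, ∑' h, P.termRun x y t h = ∑' τ, P.finalMass x y τ := by
  simpa using (P.tsum_finalMass_mul x y fun _ => 1).symm

theorem termRun_le_finalMass (P : Protocol X Y Z) (x : X) (y : Y) (t : ℕ) (h : History) :
    P.termRun x y t h ≤ P.finalMass x y h.transcript := by
  rw [finalMass_eq_iSup]
  refine le_trans ?_ (le_iSup _ t)
  refine le_trans ?_ (ENNReal.le_tsum h)
  simp

theorem exists_of_finalMass_ne_zero {P : Protocol X Y Z} {x : X} {y : Y} {τ : Transcript}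
    (h : P.finalMass x y τ ≠ 0) :
    ∃ t h, P.Terminal x y h ∧ h ∈ (P.run x y t).support ∧ h.transcript = τ := by
  rw [finalMass_eq_iSup, ← pos_iff_ne_zero, lt_iSup_iff] at h
  obtain ⟨t, ht⟩ := h
  obtain ⟨h, hh⟩ := not_forall.1 (fun hc => ht.ne' (ENNReal.tsum_eq_zero.2 hc))
  obtain ⟨h1, h2⟩ := mul_ne_zero_iff.1 hh
  obtain ⟨h3, h4⟩ := termRun_ne_zero_iff.1 h1
  exact ⟨t, h, h3, h4, by simpa using h2⟩

theorem finalMass_ne_zero_of_terminal {P : Protocol X Y Z} {x : X} {y : Y} {t : ℕ} {h : History}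
    (hT : P.Terminal x y h) (hh : h ∈ (P.run x y t).support) :
    P.finalMass x y h.transcript ≠ 0 :=
  fun hz => termRun_ne_zero_iff.2 ⟨hT, hh⟩ (le_antisymm (hz ▸ P.termRun_le_finalMass x y t h)
    zero_le)

/-- Padding with silent rounds realises a transcript at every sufficiently late time, so that two
transcripts can be compared through histories of equal length, as decoding requires. -/
theorem exists_forall_ge_of_finalMass_ne_zero {P : Protocol X Y Z} {x : X} {y : Y}
    {τ : Transcript} (h : P.finalMass x y τ ≠ 0) : ∃ t, ∀ s, t ≤ s →
      ∃ h, P.Terminal x y h ∧ h ∈ (P.run x y s).support ∧ h.transcript = τ := by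
  obtain ⟨t, h, h1, h2, h3⟩ := exists_of_finalMass_ne_zero h
  refine ⟨t, fun s hs => ⟨h ++ List.replicate (s - t) Round.silent, h1.append_replicate _, ?_,
    by rw [transcript_append_replicate, h3]⟩⟩
  rw [PMF.mem_support_iff]
  have := h1.run_append_replicate (t := t) (s - t)
  rw [Nat.add_sub_cancel' hs] at this
  rw [this]
  exact h2

theorem mem_support_run_iff {P : Protocol X Y Z} {x : X} {y : Y} {h : History} :
    h ∈ (P.run x y h.length).support ↔ pathWeight (P.kernel1 x) (h.map Round.pair1) ≠ 0 ∧
      pathWeight (P.kernel2 y) (h.map Round.pair2) ≠ 0 ∧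
      pathWeight P.kernel3 (h.map Round.pair3) ≠ 0 := by
  rw [PMF.mem_support_iff, run_apply, mul_ne_zero_iff, mul_ne_zero_iff, and_assoc]

theorem map_pair1_eq {h h' : History} (h12 : h.link12 = h'.link12) (h31 : h.link31 = h'.link31) :
    h.map Round.pair1 = h'.map Round.pair1 := by
  have : ∀ h : History, h.map Round.pair1 = h.link12.zip h.link31 := by
    intro h
    simp [History.link12, History.link31, List.zip_map', Round.pair1]
  rw [this, this, h12, h31]

theorem map_pair2_eq {h h' : History} (h12 : h.link12 = h'.link12) (h23 : h.link23 = h'.link23) :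
    h.map Round.pair2 = h'.map Round.pair2 := by
  have : ∀ h : History, h.map Round.pair2 = h.link12.zip h.link23 := by
    intro h
    simp [History.link12, History.link23, List.zip_map', Round.pair2]
  rw [this, this, h12, h23]

/-- Exchanging the input of party 1 between two executions that agree on the links of party 1. -/
theorem UniquelyDecodable.swap1 {P : Protocol X Y Z} (hP : P.UniquelyDecodable) {x x' : X}
    {y y' : Y} {τ τ' : Transcript} (h : P.finalMass x y τ ≠ 0) (h' : P.finalMass x' y' τ' ≠ 0)
    (h12 : τ.link12 = τ'.link12) (h31 : τ.link31 = τ'.link31) : P.finalMass x' y τ ≠ 0 := by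
  obtain ⟨t, ht⟩ := exists_forall_ge_of_finalMass_ne_zero h
  obtain ⟨t', ht'⟩ := exists_forall_ge_of_finalMass_ne_zero h'
  obtain ⟨g, hT, hg, rfl⟩ := ht _ (le_max_left t t')
  obtain ⟨g', hT', hg', rfl⟩ := ht' _ (le_max_right t t')
  have hl := P.length_of_mem_support_run _ _ _ _ hg
  have hl' := P.length_of_mem_support_run _ _ _ _ hg'
  have e12 := hP.link12 g g' (reachable_of_mem hg) (reachable_of_mem hg') (hl.trans hl'.symm) h12
  have e31 := hP.link31 g g' (reachable_of_mem hg) (reachable_of_mem hg') (hl.trans hl'.symm) h31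
  -- The input of party 1 enters only through the first of the three factors, and that factor
  -- depends only on links 12 and 31, where `g` and `g'` agree. The other two factors are those of
  -- `g`.
  have hm : g ∈ (P.run x' y (max t t')).support := by
    rw [← hl] at hg ⊢
    rw [← hl'] at hg'
    rw [mem_support_run_iff] at hg hg' ⊢
    exact ⟨map_pair1_eq e12 e31 ▸ hg'.1, hg.2⟩
  exact finalMass_ne_zero_of_terminal (hP.terminal _ _ _ _ _ _ hg hm hT) hm

/-- Exchanging the input of party 2 between two executions that agree on the links of party 2. -/
theorem UniquelyDecodable.swap2 {P : Protocol X Y Z} (hP : P.UniquelyDecodable) {x x' : X}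
    {y y' : Y} {τ τ' : Transcript} (h : P.finalMass x y τ ≠ 0) (h' : P.finalMass x' y' τ' ≠ 0)
    (h12 : τ.link12 = τ'.link12) (h23 : τ.link23 = τ'.link23) : P.finalMass x y' τ ≠ 0 := by
  obtain ⟨t, ht⟩ := exists_forall_ge_of_finalMass_ne_zero h
  obtain ⟨t', ht'⟩ := exists_forall_ge_of_finalMass_ne_zero h'
  obtain ⟨g, hT, hg, rfl⟩ := ht _ (le_max_left t t')
  obtain ⟨g', hT', hg', rfl⟩ := ht' _ (le_max_right t t')
  have hl := P.length_of_mem_support_run _ _ _ _ hg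
  have hl' := P.length_of_mem_support_run _ _ _ _ hg'
  have e12 := hP.link12 g g' (reachable_of_mem hg) (reachable_of_mem hg') (hl.trans hl'.symm) h12
  have e23 := hP.link23 g g' (reachable_of_mem hg) (reachable_of_mem hg') (hl.trans hl'.symm) h23
  have hm : g ∈ (P.run x y' (max t t')).support := by
    rw [← hl] at hg ⊢
    rw [← hl'] at hg'
    rw [mem_support_run_iff] at hg hg' ⊢
    exact ⟨hg.1, map_pair2_eq e12 e23 ▸ hg'.2.1, hg.2.2⟩
  exact finalMass_ne_zero_of_terminal (hP.terminal _ _ _ _ _ _ hg hm hT) hm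

/-! ### Marginals on one link -/

/-- The probability that the first rounds on a link (selected by `f`) are `g`. -/
def prefixProb (P : Protocol X Y Z) (x : X) (y : Y) (f : Round → Msg × Msg)
    (g : LinkHistory) : ℝ≥0∞ :=
  ∑' h, P.run x y g.length h * if h.map f = g then 1 else 0

theorem prefixProb_nil (P : Protocol X Y Z) (x : X) (y : Y) (f : Round → Msg × Msg) :
    P.prefixProb x y f [] ≤ 1 := by
  rw [← (P.run x y 0).tsum_coe]
  refine ENNReal.tsum_le_tsum fun h => mul_le_of_le_one_right' ?_
  split_ifs <;> simp

theorem tsum_prefixProb_le (P : Protocol X Y Z) (x : X) (y : Y) (f : Round → Msg × Msg)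
    (g : LinkHistory) : ∑' a, P.prefixProb x y f (g ++ [a]) ≤ P.prefixProb x y f g := by
  simp only [prefixProb, List.length_append, List.length_singleton, tsum_run_succ]
  rw [ENNReal.tsum_comm]
  refine ENNReal.tsum_le_tsum fun h => ?_
  rw [ENNReal.tsum_mul_left, ENNReal.tsum_comm]
  gcongr
  split_ifs with hh
  · rw [← (P.step x y h).tsum_coe]
    refine ENNReal.tsum_le_tsum fun r => ?_
    rw [ENNReal.tsum_mul_left, tsum_eq_single (f r)]
    · refine mul_le_of_le_one_right' ?_
      split_ifs <;> simp
    · intro a ha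
      rw [if_neg]
      intro hc
      rw [List.map_append] at hc
      have := (List.append_inj' hc rfl).2
      simp only [List.map_cons, List.map_nil, List.cons.injEq, and_true] at this
      exact ha this.symm
  · refine le_of_eq (ENNReal.tsum_eq_zero.2 fun r => ENNReal.tsum_eq_zero.2 fun a => ?_)
    rw [if_neg, mul_zero]
    intro hc
    rw [List.map_append] at hc
    exact hh (List.append_inj' hc rfl).1

/-- The rounds after time `t` sum to 1, so truncation recovers the law of the first `t` rounds. -/
theorem tsum_run_take (P : Protocol X Y Z) (x : X) (y : Y) (t k : ℕ) (φ : History → ℝ≥0∞) :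
    ∑' h, P.run x y (t + k) h * φ (h.take t) = ∑' h, P.run x y t h * φ h := by
  induction k with
  | zero =>
    refine tsum_congr fun h => ?_
    by_cases hh : h.length = t
    · rw [← hh]; simp
    · rw [add_zero, P.run_apply_eq_zero x y hh, zero_mul, zero_mul]
  | succ k ih =>
    rw [← ih, ← add_assoc, P.tsum_run_succ x y _ fun h => φ (h.take t)]
    refine tsum_congr fun h => ?_
    by_cases hh : h.length = t + k
    · have : ∀ r : Round, (h ++ [r]).take t = h.take t := fun r =>
        List.take_append_of_le_length (by omega)
      simp only [this, ENNReal.tsum_mul_right, PMF.tsum_coe, one_mul]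
    · rw [P.run_apply_eq_zero x y hh, zero_mul, zero_mul]

/-- The final probability of the transcript of a terminated link is at most the probability of
its history. -/
theorem tsum_finalMass_le_prefixProb {P : Protocol X Y Z} (f : Round → Msg × Msg)
    (hP : ∀ h h', P.Reachable h → P.Reachable h' → h.length = h'.length →
      LinkHistory.concat (h.map f) = LinkHistory.concat (h'.map f) → h.map f = h'.map f)
    (pr : Transcript → Msg × Msg) (hpr : ∀ h : History, pr h.transcript =
      LinkHistory.concat (h.map f)) (x x' : X) (y y' : Y) {t : ℕ} {h : History}
    (hT : P.Terminal x' y' h) (hh : h ∈ (P.run x' y' t).support) :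
    ∑' τ, P.finalMass x y τ * (if pr τ = pr h.transcript then 1 else 0) ≤
      P.prefixProb x y f (h.map f) := by
  rw [P.tsum_finalMass_mul x y fun τ => if pr τ = pr h.transcript then 1 else 0]
  have hl := P.length_of_mem_support_run _ _ _ _ hh
  refine iSup_le fun T => ?_
  -- Passing from time `T` to `t + T` makes every history at least as long as `h`, so that its first
  -- `t` rounds can be compared with `h`.
  refine ((P.monotone_tsum_termRun x y fun τ => if pr τ = pr h.transcript then 1 else 0)
    (Nat.le_add_left T t)).trans ?_
  rw [prefixProb, List.length_map, hl, ← P.tsum_run_take x y t T fun h' =>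
    if h'.map f = h.map f then 1 else 0]
  refine ENNReal.tsum_le_tsum fun g => ?_
  by_cases hg : P.termRun x y (t + T) g = 0
  · rw [hg, zero_mul]; exact zero_le
  refine mul_le_mul' (P.termRun_le_run _ _ _ _) ?_
  split_ifs with h1 h2 h2
  · exact le_rfl
  · exfalso
    apply h2
    obtain ⟨-, hg⟩ := termRun_ne_zero_iff.1 hg
    have hgl := P.length_of_mem_support_run _ _ _ _ hg
    -- Padded to length `t + T`, `h` keeps its transcript, and unique decodability identifies the
    -- two link histories.
    have hm : h ++ List.replicate T Round.silent ∈ (P.run x' y' (t + T)).support := by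
      rw [PMF.mem_support_iff, hT.run_append_replicate]; exact hh
    have := hP g _ (reachable_of_mem hg) (reachable_of_mem hm) (by simp [hgl, hl]) (by
      rw [← hpr, ← hpr, transcript_append_replicate, h1])
    rw [List.map_take, this, List.map_append, List.take_append_of_le_length (by simp [hl]),
      List.take_of_length_le (by simp [hl])]
  · exact zero_le
  · exact le_rfl

end Protocol

/-! ### Laws of the transcript, and privacy as invariance -/

/-- The components of an outcome, as an equivalence. -/
def outcomeEquiv (X Y Z : Type) : (X × Y) × Transcript × Z ≃ Outcome X Y Z where
  toFun q := ⟨q.1.1, q.1.2, q.2.2, q.2.1⟩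
  invFun ω := ((ω.x, ω.y), ω.tr, ω.z)
  left_inv _ := rfl
  right_inv _ := rfl

namespace Protocol

variable {X Y Z : Type} {α β γ : Type*}

/-- The law of a function of the final transcript, on inputs `x`, `y`. -/
def law (P : Protocol X Y Z) (x : X) (y : Y) (A : Transcript → α) (a : α) : ℝ≥0∞ :=
  ∑' τ, P.finalMass x y τ * if A τ = a then 1 else 0

theorem finalMass_le_law (P : Protocol X Y Z) (x : X) (y : Y) (A : Transcript → α)
    (τ : Transcript) : P.finalMass x y τ ≤ P.law x y A (A τ) := by
  refine le_trans ?_ (ENNReal.le_tsum τ)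
  simp

theorem tsum_law (P : Protocol X Y Z) (x : X) (y : Y) (A : Transcript → α) :
    ∑' a, P.law x y A a = ∑' τ, P.finalMass x y τ := by
  simp only [law]
  rw [ENNReal.tsum_comm]
  refine tsum_congr fun τ => ?_
  rw [tsum_eq_single (A τ)]
  · simp
  · intro a ha
    simp [Ne.symm ha]

theorem exists_of_law_ne_zero {P : Protocol X Y Z} {x : X} {y : Y} {A : Transcript → α} {a : α}
    (h : P.law x y A a ≠ 0) : ∃ τ, P.finalMass x y τ ≠ 0 ∧ A τ = a := by
  obtain ⟨τ, hτ⟩ := not_forall.1 (fun hc => h (ENNReal.tsum_eq_zero.2 hc))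
  obtain ⟨h1, h2⟩ := mul_ne_zero_iff.1 hτ
  exact ⟨τ, h1, by simpa using h2⟩

/-- The output is almost surely `f x y`. -/
def Computes (P : Protocol X Y Z) (f : X → Y → Z) : Prop :=
  (∀ x y, ∑' τ, P.finalMass x y τ = 1) ∧
    ∀ x y τ, P.finalMass x y τ ≠ 0 → P.out3 τ.link23 τ.link31 = PMF.pure (f x y)

/-- For a deterministic target, a wrong output has total probability 0, so each possible transcript
gives it probability 0. -/
theorem IsSecure.computes {P : Protocol X Y Z} {p : PMF (X × Y)} {f : X → Y → Z}
    (hp : ∀ q, p q ≠ 0) (hP : P.IsSecure p fun x y => PMF.pure (f x y)) : P.Computes f := by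
  refine ⟨fun x y => hP.wellFormed.terminates x y (hp _), fun x y τ hτ => ?_⟩
  have h0 : ∀ z, z ≠ f x y → P.out3 τ.link23 τ.link31 z = 0 := by
    intro z hz
    have := hP.correct x y (hp _) z
    rw [PMF.pure_apply, if_neg hz, ENNReal.tsum_eq_zero] at this
    exact (mul_eq_zero.1 (this τ)).resolve_left hτ
  have h1 : P.out3 τ.link23 τ.link31 (f x y) = 1 := by
    rw [← (P.out3 τ.link23 τ.link31).tsum_coe, tsum_eq_single _ h0]
  ext z
  by_cases hz : z = f x y
  · subst hz; simp [h1]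
  · simp [h0 z hz, hz]

theorem Computes.joint_eq {P : Protocol X Y Z} {f : X → Y → Z} (hP : P.Computes f)
    (p : PMF (X × Y)) (ω : Outcome X Y Z) : P.joint p ω =
      p (ω.x, ω.y) * (P.finalMass ω.x ω.y ω.tr * if ω.z = f ω.x ω.y then 1 else 0) := by
  rw [joint, mul_assoc]
  by_cases h : P.finalMass ω.x ω.y ω.tr = 0
  · simp [h]
  · rw [hP.2 _ _ _ h, PMF.pure_apply]

theorem Computes.prob_joint {P : Protocol X Y Z} {f : X → Y → Z} (hP : P.Computes f)
    (p : PMF (X × Y)) (E : Set (Outcome X Y Z)) : prob (P.joint p) E =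
      ∑' q : X × Y, p q * ∑' τ, P.finalMass q.1 q.2 τ *
        if (⟨q.1, q.2, f q.1 q.2, τ⟩ : Outcome X Y Z) ∈ E then 1 else 0 := by
  rw [prob, ← (outcomeEquiv X Y Z).tsum_eq, ennreal_tsum_prod]
  refine tsum_congr fun q => ?_
  rw [ennreal_tsum_prod, ← ENNReal.tsum_mul_left]
  refine tsum_congr fun τ => ?_
  rw [tsum_eq_single (f q.1 q.2)]
  · simp only [Set.indicator, outcomeEquiv, Equiv.coe_fn_mk, hP.joint_eq]
    split_ifs <;> simp
  · intro z hz
    simp only [Set.indicator, outcomeEquiv, Equiv.coe_fn_mk, hP.joint_eq]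
    simp [hz]

theorem Computes.prob_joint_and {P : Protocol X Y Z} {f : X → Y → Z} (hP : P.Computes f)
    (p : PMF (X × Y)) (A : Transcript → α) (a : α) (D : X → Y → Z → Prop) :
    prob (P.joint p) {ω | A ω.tr = a ∧ D ω.x ω.y ω.z} =
      ∑' q : X × Y, p q * (P.law q.1 q.2 A a * if D q.1 q.2 (f q.1 q.2) then 1 else 0) := by
  rw [hP.prob_joint]
  refine tsum_congr fun q => ?_
  rw [law, ← ENNReal.tsum_mul_right]
  congr 1
  refine tsum_congr fun τ => ?_
  simp only [Set.mem_ofPred_eq, mul_assoc]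
  congr 1
  by_cases h1 : A τ = a <;> by_cases h2 : D q.1 q.2 (f q.1 q.2) <;> simp [h1, h2]

theorem Computes.prob_joint_input {P : Protocol X Y Z} {f : X → Y → Z} (hP : P.Computes f)
    (p : PMF (X × Y)) (D : X → Y → Z → Prop) :
    prob (P.joint p) {ω | D ω.x ω.y ω.z} =
      ∑' q : X × Y, p q * if D q.1 q.2 (f q.1 q.2) then 1 else 0 := by
  have := hP.prob_joint_and p (fun _ => ()) () D
  simp only [true_and] at this
  rw [this]
  refine tsum_congr fun q => ?_
  simp [law, hP.1]

/-- Privacy as invariance of the conditional law of the transcript. -/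
theorem Computes.markov_iff {P : Protocol X Y Z} {f : X → Y → Z} (hP : P.Computes f)
    {p : PMF (X × Y)} (hp : ∀ q, p q ≠ 0) (A : Transcript → α) (B : X → Y → Z → β)
    (C : X → Y → Z → γ)
    (hinj : ∀ x y x' y', B x y (f x y) = B x' y' (f x' y') → C x y (f x y) = C x' y' (f x' y') →
      x = x' ∧ y = y') :
    Markov (P.joint p) (fun ω => A ω.tr) (fun ω => B ω.x ω.y ω.z) (fun ω => C ω.x ω.y ω.z) ↔
      ∀ x y x' y', B x y (f x y) = B x' y' (f x' y') → ∀ a, P.law x y A a = P.law x' y' A a := by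
  have e1 : ∀ a b c, prob (P.joint p) {ω | A ω.tr = a ∧ B ω.x ω.y ω.z = b ∧ C ω.x ω.y ω.z = c} =
      ∑' q : X × Y, p q * (P.law q.1 q.2 A a * if B q.1 q.2 (f q.1 q.2) = b ∧
        C q.1 q.2 (f q.1 q.2) = c then 1 else 0) := fun a b c => by
    convert hP.prob_joint_and p A a fun x y z => B x y z = b ∧ C x y z = c
  have e2 : ∀ a b, prob (P.joint p) {ω | A ω.tr = a ∧ B ω.x ω.y ω.z = b} =
      ∑' q : X × Y, p q * (P.law q.1 q.2 A a * if B q.1 q.2 (f q.1 q.2) = b then 1 else 0) :=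
    fun a b => hP.prob_joint_and p A a fun x y z => B x y z = b
  have e3 : ∀ b, prob (P.joint p) {ω | B ω.x ω.y ω.z = b} =
      ∑' q : X × Y, p q * if B q.1 q.2 (f q.1 q.2) = b then 1 else 0 :=
    fun b => hP.prob_joint_input p fun x y z => B x y z = b
  have e4 : ∀ b c, prob (P.joint p) {ω | B ω.x ω.y ω.z = b ∧ C ω.x ω.y ω.z = c} =
      ∑' q : X × Y, p q * if B q.1 q.2 (f q.1 q.2) = b ∧ C q.1 q.2 (f q.1 q.2) = c then 1 else 0 :=
    fun b c => by convert hP.prob_joint_input p fun x y z => B x y z = b ∧ C x y z = c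
  simp only [Markov, e1, e2, e3, e4]
  constructor
  · intro h x y x' y' hB a
    set S := ∑' q : X × Y, p q * if B q.1 q.2 (f q.1 q.2) = B x y (f x y) then 1 else 0 with hS
    have hS0 : S ≠ 0 := by
      intro hc
      have := ENNReal.tsum_eq_zero.1 hc (x, y)
      simp [hp] at this
    have hS1 : S ≠ ∞ := by
      refine ((?_ : S ≤ 1).trans_lt ENNReal.one_lt_top).ne
      rw [← p.tsum_coe]
      refine ENNReal.tsum_le_tsum fun q => mul_le_of_le_one_right' ?_
      split_ifs <;> simp
    -- The values of `B` and `C` together single out one input pair, so the Markov identity at that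
    -- point equates its law with the average over the fibre of `B`. That average is the same for
    -- all pairs in the fibre.
    have key : ∀ x' y', B x y (f x y) = B x' y' (f x' y') → P.law x' y' A a * S =
        ∑' q : X × Y, p q * (P.law q.1 q.2 A a * if B q.1 q.2 (f q.1 q.2) = B x y (f x y)
          then 1 else 0) := by
      intro x' y' hB
      have h1 := h a (B x y (f x y)) (C x' y' (f x' y'))
      have hz : ∀ q : X × Y, q ≠ (x', y') → ¬ (B q.1 q.2 (f q.1 q.2) = B x y (f x y) ∧
          C q.1 q.2 (f q.1 q.2) = C x' y' (f x' y')) := by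
        rintro ⟨x2, y2⟩ hq ⟨h2, h3⟩
        obtain ⟨rfl, rfl⟩ := hinj _ _ _ _ (h2.trans hB) h3
        exact hq rfl
      rw [tsum_eq_single (x', y') (fun q hq => by rw [if_neg (hz q hq), mul_zero, mul_zero]),
        if_pos ⟨hB.symm, rfl⟩,
        tsum_eq_single (f := fun q : X × Y => p q * if B q.1 q.2 (f q.1 q.2) = B x y (f x y) ∧
          C q.1 q.2 (f q.1 q.2) = C x' y' (f x' y') then (1 : ℝ≥0∞) else 0) (x', y')
          (fun q hq => by rw [if_neg (hz q hq), mul_zero]), if_pos ⟨hB.symm, rfl⟩, mul_one,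
        mul_one, ← hS, mul_assoc, mul_comm _ (p (x', y'))] at h1
      exact (ENNReal.mul_right_inj (hp _) (p.apply_ne_top _)).1 h1
    exact (ENNReal.mul_left_inj hS0 hS1).1 ((key x y rfl).trans (key x' y' hB).symm)
  · intro h a b c
    by_cases hb : ∃ x y, B x y (f x y) = b
    · obtain ⟨x, y, rfl⟩ := hb
      have k1 : ∀ D : X × Y → Prop, ∑' q : X × Y, p q * (P.law q.1 q.2 A a *
          if B q.1 q.2 (f q.1 q.2) = B x y (f x y) ∧ D q then 1 else 0) =
          P.law x y A a * ∑' q : X × Y, p q *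
            if B q.1 q.2 (f q.1 q.2) = B x y (f x y) ∧ D q then 1 else 0 := by
        intro D
        rw [← ENNReal.tsum_mul_left]
        refine tsum_congr fun q => ?_
        by_cases hq : B q.1 q.2 (f q.1 q.2) = B x y (f x y)
        · rw [h _ _ _ _ hq a, mul_left_comm]
        · simp [hq]
      have k2 := k1 fun _ => True
      simp only [and_true] at k2
      rw [k1 fun q => C q.1 q.2 (f q.1 q.2) = c, k2]
      ring
    · have : ∀ x y, B x y (f x y) ≠ b := fun x y hc => hb ⟨x, y, hc⟩
      simp [this]

end Protocol

/-! ### Consequences of privacy and correctness for remote OT -/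

/-- The form in which uniqueness is used: if only one input is compatible with given transcripts,
summing over all inputs costs no more than a single term. -/
theorem sum_le_of_subsingleton_support {ι : Type*} [Fintype ι] {f : ι → ℝ≥0∞} {B : ℝ≥0∞}
    (hs : ∀ i j, f i ≠ 0 → f j ≠ 0 → i = j) (hB : ∀ i, f i ≤ B) : ∑ i, f i ≤ B := by
  by_cases h : ∃ i, f i ≠ 0
  · obtain ⟨i, hi⟩ := h
    rw [Finset.sum_eq_single i]
    · exact hB i
    · intro j _ hj
      by_contra hc
      exact hj (hs j i hc hi)
    · simp
  · have h0 : ∀ i, f i = 0 := fun i => by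
      by_contra hc
      exact h ⟨i, hc⟩
    simp [h0]

/-- The transcripts on the links of party 1. -/
def Transcript.pair1 (τ : Transcript) : (Msg × Msg) × (Msg × Msg) := (τ.link12, τ.link31)

/-- The transcripts on the links of party 2. -/
def Transcript.pair2 (τ : Transcript) : (Msg × Msg) × (Msg × Msg) := (τ.link12, τ.link23)

/-- The transcripts on the links of party 3. -/
def Transcript.pair3 (τ : Transcript) : (Msg × Msg) × (Msg × Msg) := (τ.link23, τ.link31)

namespace Protocol

variable {X Y Z : Type} {α β γ : Type*}

theorem law_eq_tsum_pair (P : Protocol X Y Z) (x : X) (y : Y) (A : Transcript → α)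
    (B : Transcript → β) (a : α) :
    P.law x y A a = ∑' b, P.law x y (fun τ => (A τ, B τ)) (a, b) := by
  simp only [law]
  rw [ENNReal.tsum_comm]
  refine tsum_congr fun τ => ?_
  rw [tsum_eq_single (B τ)]
  · simp
  · intro b hb
    simp [Ne.symm hb]

theorem law_eq_tsum_pair' (P : Protocol X Y Z) (x : X) (y : Y) (A : Transcript → α)
    (B : Transcript → β) (b : β) :
    P.law x y B b = ∑' a, P.law x y (fun τ => (A τ, B τ)) (a, b) := by
  simp only [law]
  rw [ENNReal.tsum_comm]
  refine tsum_congr fun τ => ?_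
  rw [tsum_eq_single (A τ)]
  · simp
  · intro b hb
    simp [Ne.symm hb]

theorem law_pair_le_left (P : Protocol X Y Z) (x : X) (y : Y) (A : Transcript → α)
    (B : Transcript → β) (a : α) (b : β) :
    P.law x y (fun τ => (A τ, B τ)) (a, b) ≤ P.law x y A a := by
  rw [P.law_eq_tsum_pair x y A B]
  exact ENNReal.le_tsum b

theorem law_pair2 (P : Protocol X Y Z) (x : X) (y : Y) (a b : Msg × Msg) :
    P.law x y Transcript.pair2 (a, b) = ∑' c, P.finalMass x y ⟨a, b, c⟩ := by
  have hinj : Function.Injective fun c => (⟨a, b, c⟩ : Transcript) := by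
    intro c c' h; simpa using h
  rw [law, ← hinj.tsum_eq]
  · simp [Transcript.pair2]
  · intro τ hτ
    have : Transcript.pair2 τ = (a, b) := by
      by_contra hc
      simp [hc] at hτ
    simp only [Transcript.pair2, Prod.mk.injEq] at this
    exact ⟨τ.link31, Transcript.ext this.1.symm this.2.symm rfl⟩

theorem law_pair3 (P : Protocol X Y Z) (x : X) (y : Y) (b c : Msg × Msg) :
    P.law x y Transcript.pair3 (b, c) = ∑' a, P.finalMass x y ⟨a, b, c⟩ := by
  have hinj : Function.Injective fun a => (⟨a, b, c⟩ : Transcript) := by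
    intro c c' h; simpa using h
  rw [law, ← hinj.tsum_eq]
  · simp [Transcript.pair3]
  · intro τ hτ
    have : Transcript.pair3 τ = (b, c) := by
      by_contra hc
      simp [hc] at hτ
    simp only [Transcript.pair3, Prod.mk.injEq] at this
    exact ⟨τ.link12, Transcript.ext rfl this.1.symm this.2.symm⟩

/-- Security of a protocol for remote oblivious transfer in terms of the laws of the transcript. -/
structure PrivateOT {m n : ℕ} (P : Protocol (Blocks m n) (Fin m) (Fin n → Bool)) : Prop where
  decodable : P.UniquelyDecodable
  computes : P.Computes fun x y => x y
  private1 : ∀ x y y' a, P.law x y Transcript.pair1 a = P.law x y' Transcript.pair1 a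
  private2 : ∀ x x' y a, P.law x y Transcript.pair2 a = P.law x' y Transcript.pair2 a
  private3 : ∀ x y x' y', x y = x' y' → ∀ a,
    P.law x y Transcript.pair3 a = P.law x' y' Transcript.pair3 a

theorem IsSecure.privateOT {m n : ℕ} {P : Protocol (Blocks m n) (Fin m) (Fin n → Bool)}
    {p : PMF (Blocks m n × Fin m)} (hp : ∀ q, p q ≠ 0) (hP : P.IsSecure p (remoteOT m n)) :
    P.PrivateOT := by
  have hC : P.Computes fun x y => x y := IsSecure.computes hp hP
  refine ⟨hP.wellFormed.uniquelyDecodable hp, hC, fun x y y' => ?_, fun x x' y => ?_, ?_⟩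
  · refine (hC.markov_iff hp Transcript.pair1 (fun x _ _ => x) (fun _ y z => (y, z)) ?_).1
      hP.private1 x y x y' rfl
    intro x y x' y' h1 h2
    simp_all
  · refine (hC.markov_iff hp Transcript.pair2 (fun _ y _ => y) (fun x _ z => (x, z)) ?_).1
      hP.private2 x y x' y rfl
    intro x y x' y' h1 h2
    simp_all
  · refine (hC.markov_iff hp Transcript.pair3 (fun _ _ z => z) (fun x y _ => (x, y)) ?_).1
      hP.private3
    intro x y x' y' h1 h2
    simp_all

namespace PrivateOT

variable {m n : ℕ} {P : Protocol (Blocks m n) (Fin m) (Fin n → Bool)}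

theorem law31_congr (hP : P.PrivateOT) (x : Blocks m n) (y y' : Fin m) (c : Msg × Msg) :
    P.law x y Transcript.link31 c = P.law x y' Transcript.link31 c := by
  rw [P.law_eq_tsum_pair' x y Transcript.link12, P.law_eq_tsum_pair' x y' Transcript.link12]
  exact tsum_congr fun a => hP.private1 x y y' _

theorem law31_congr' (hP : P.PrivateOT) {x x' : Blocks m n} {y y' : Fin m} (h : x y = x' y')
    (c : Msg × Msg) : P.law x y Transcript.link31 c = P.law x' y' Transcript.link31 c := by
  rw [P.law_eq_tsum_pair' x y Transcript.link23, P.law_eq_tsum_pair' x' y' Transcript.link23]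
  exact tsum_congr fun a => hP.private3 x y x' y' h _

/-- The transcript of link 12 is independent of the inputs. -/
theorem law12_eq (hP : P.PrivateOT) (x x' : Blocks m n) (y y' : Fin m) (a : Msg × Msg) :
    P.law x y Transcript.link12 a = P.law x' y' Transcript.link12 a := by
  have h1 : P.law x y Transcript.link12 a = P.law x y' Transcript.link12 a := by
    rw [P.law_eq_tsum_pair x y _ Transcript.link31, P.law_eq_tsum_pair x y' _ Transcript.link31]
    exact tsum_congr fun c => hP.private1 x y y' _
  rw [h1, P.law_eq_tsum_pair x y' _ Transcript.link23, P.law_eq_tsum_pair x' y' _ Transcript.link23]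
  exact tsum_congr fun c => hP.private2 x x' y' _

/-- The transcript of link 23 is independent of the inputs. -/
theorem law23_eq (hP : P.PrivateOT) (x x' : Blocks m n) (y y' : Fin m) (b : Msg × Msg) :
    P.law x y Transcript.link23 b = P.law x' y' Transcript.link23 b := by
  have h1 : ∀ x x' y, P.law x y Transcript.link23 b = P.law x' y Transcript.link23 b := by
    intro x x' y
    rw [P.law_eq_tsum_pair' x y Transcript.link12, P.law_eq_tsum_pair' x' y Transcript.link12]
    exact tsum_congr fun a => hP.private2 x x' y _
  -- When all blocks coincide, changing `y` does not change the output, so privacy against party 3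
  -- applies.
  let x0 : Blocks m n := fun _ _ => false
  have h2 : P.law x0 y Transcript.link23 b = P.law x0 y' Transcript.link23 b := by
    rw [P.law_eq_tsum_pair x0 y _ Transcript.link31, P.law_eq_tsum_pair x0 y' _ Transcript.link31]
    exact tsum_congr fun a => hP.private3 x0 y x0 y' rfl _
  rw [h1 x x0, h2, h1 x0 x']

/-- The transcript of link 31 is independent of the inputs. -/
theorem law31_eq (hP : P.PrivateOT) (hm : 2 ≤ m) (x x' : Blocks m n) (y y' : Fin m)
    (c : Msg × Msg) : P.law x y Transcript.link31 c = P.law x' y' Transcript.link31 c := by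
  obtain ⟨y1, hy1⟩ : ∃ y1 : Fin m, y1 ≠ y := by
    have : Nontrivial (Fin m) := Fin.nontrivial_iff_two_le.2 hm
    exact exists_ne y
  -- A hybrid input giving the output of `x` at `y` and that of `x'` at another index `y1`. Privacy
  -- against party 3 replaces inputs with equal output, and privacy against party 1 moves the index;
  -- having a second index requires `2 ≤ m`.
  let x2 : Blocks m n := fun i => if i = y then x y else x' y1
  rw [hP.law31_congr' (x' := x2) (y' := y) (by simp [x2]), hP.law31_congr x2 y y1,
    hP.law31_congr' (x' := x') (y' := y1) (by simp [x2, hy1]), hP.law31_congr x' y1 y']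

/-- The input of party 1 is determined by the transcripts on its links. -/
theorem input1_unique (hP : P.PrivateOT) {x x' : Blocks m n} {y y' : Fin m} {τ τ' : Transcript}
    (h : P.finalMass x y τ ≠ 0) (h' : P.finalMass x' y' τ' ≠ 0)
    (he : τ.pair1 = τ'.pair1) : x = x' := by
  funext y2
  -- Privacy lets the view of party 1 occur with any index `y2`. Exchanging `x` for `x'` there keeps
  -- the transcript, hence the output, so the two inputs agree at block `y2`.
  have h1 : P.law x y2 Transcript.pair1 τ.pair1 ≠ 0 := by
    rw [hP.private1 x y2 y]
    exact fun hc => h (le_antisymm (hc ▸ P.finalMass_le_law x y Transcript.pair1 τ) zero_le)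
  obtain ⟨τ1, h2, h3⟩ := exists_of_law_ne_zero h1
  rw [he] at h3
  simp only [Transcript.pair1, Prod.mk.injEq] at h3
  have h4 := hP.decodable.swap1 h2 h' h3.1 h3.2
  have h5 := (hP.computes.2 _ _ _ h2).symm.trans (hP.computes.2 _ _ _ h4)
  by_contra hne
  have h6 := congrArg (fun q : PMF (Fin n → Bool) => q (x y2)) h5
  simp [hne] at h6

/-- The input of party 2 is determined by the transcripts on its links. -/
theorem input2_unique (hP : P.PrivateOT) (hn : 1 ≤ n) {x x' : Blocks m n} {y y' : Fin m}
    {τ τ' : Transcript} (h : P.finalMass x y τ ≠ 0) (h' : P.finalMass x' y' τ' ≠ 0)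
    (he : τ.pair2 = τ'.pair2) : y = y' := by
  by_contra hy
  -- An input whose block `y` differs from its block `y'`. Privacy against party 2 allows it in
  -- place of `x`, and exchanging `y` for `y'` would then change the output without changing the
  -- transcript.
  let x2 : Blocks m n := fun i _ => decide (i = y)
  have h1 : P.law x2 y Transcript.pair2 τ.pair2 ≠ 0 := by
    rw [hP.private2 x2 x y]
    exact fun hc => h (le_antisymm (hc ▸ P.finalMass_le_law x y Transcript.pair2 τ) zero_le)
  obtain ⟨τ1, h2, h3⟩ := exists_of_law_ne_zero h1
  rw [he] at h3
  simp only [Transcript.pair2, Prod.mk.injEq] at h3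
  have h4 := hP.decodable.swap2 h2 h' h3.1 h3.2
  have h5 := (hP.computes.2 _ _ _ h2).symm.trans (hP.computes.2 _ _ _ h4)
  have hne : x2 y ≠ x2 y' := by
    intro hc
    have := congrFun hc ⟨0, hn⟩
    simp [x2, Ne.symm hy] at this
  have h6 := congrArg (fun q : PMF (Fin n → Bool) => q (x2 y)) h5
  simp [hne] at h6

/-- The output is determined by the transcripts on the links of party 3. -/
theorem output_unique (hP : P.PrivateOT) {x x' : Blocks m n} {y y' : Fin m}
    {τ τ' : Transcript} (h : P.finalMass x y τ ≠ 0) (h' : P.finalMass x' y' τ' ≠ 0)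
    (he : τ.pair3 = τ'.pair3) : x y = x' y' := by
  simp only [Transcript.pair3, Prod.mk.injEq] at he
  have h5 := (hP.computes.2 _ _ _ h).symm.trans (he.1 ▸ he.2 ▸ hP.computes.2 _ _ _ h')
  by_contra hne
  have h6 := congrArg (fun q : PMF (Fin n → Bool) => q (x y)) h5
  simp [hne] at h6

/-- Replace the factor by a sum over all `x'`, which leaves the law of link 31 unchanged, and split
according to link 12. Links 12 and 31 fix `x'`, so each part is at most the probability of the
transcript of link 12. -/
theorem law31_le (hP : P.PrivateOT) (hm : 2 ≤ m) (x : Blocks m n) (y : Fin m) (c : Msg × Msg) :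
    (Fintype.card (Blocks m n) : ℝ≥0∞) * P.law x y Transcript.link31 c ≤ 1 := by
  have h1 : (Fintype.card (Blocks m n) : ℝ≥0∞) * P.law x y Transcript.link31 c =
      ∑ x' : Blocks m n, P.law x' y Transcript.link31 c := by
    rw [Finset.sum_congr rfl fun x' _ => hP.law31_eq hm x' x y y c]
    simp
  rw [h1, Finset.sum_congr rfl fun x' _ => P.law_eq_tsum_pair' x' y Transcript.link12 _ c,
    ← Summable.tsum_finsetSum fun _ _ => ENNReal.summable, ← hP.computes.1 x y,
    ← P.tsum_law x y Transcript.link12]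
  refine ENNReal.tsum_le_tsum fun a => sum_le_of_subsingleton_support ?_ fun x' => ?_
  · intro x1 x2 hx1 hx2
    obtain ⟨τ1, h1, h3⟩ := exists_of_law_ne_zero hx1
    obtain ⟨τ2, h2, h4⟩ := exists_of_law_ne_zero hx2
    exact hP.input1_unique h1 h2 (h3.trans h4.symm)
  · rw [hP.law12_eq x x' y y]
    exact P.law_pair_le_left _ _ _ _ _ _

/-- With all blocks equal to the output, Charlie's view has the same law for all `m` indices. Given
link 12 as well, only one index is possible, and its mass is bounded by the law of links 12 and 31.
-/
theorem law_pair3_le (hP : P.PrivateOT) (hm : 2 ≤ m) (hn : 1 ≤ n) (x : Blocks m n) (y : Fin m)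
    (b c : Msg × Msg) :
    (m : ℝ≥0∞) * P.law x y Transcript.pair3 (b, c) ≤ P.law x y Transcript.link31 c := by
  let x0 : Blocks m n := fun _ => x y
  have h1 : (m : ℝ≥0∞) * P.law x y Transcript.pair3 (b, c) =
      ∑ y', P.law x0 y' Transcript.pair3 (b, c) := by
    rw [Finset.sum_congr rfl fun y' _ => hP.private3 x0 y' x y rfl (b, c)]
    simp
  rw [h1, Finset.sum_congr rfl fun y' _ => P.law_pair3 x0 y' b c,
    ← Summable.tsum_finsetSum fun _ _ => ENNReal.summable, hP.law31_eq hm x x0 y y c,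
    P.law_eq_tsum_pair' x0 y Transcript.link12]
  refine ENNReal.tsum_le_tsum fun a => sum_le_of_subsingleton_support ?_ fun y' => ?_
  · intro y1 y2 hy1 hy2
    exact hP.input2_unique hn hy1 hy2 rfl
  · exact (P.finalMass_le_law x0 y' Transcript.pair1 ⟨a, b, c⟩).trans
      (hP.private1 x0 y' y _).le

theorem sum_law_pair3 (hP : P.PrivateOT) (x : Blocks m n) (y : Fin m) (b : Msg × Msg) :
    ∑' c, ∑ z : Fin n → Bool, P.law (fun _ => z) y Transcript.pair3 (b, c) =
      Fintype.card (Fin n → Bool) * P.law x y Transcript.link23 b := by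
  have h1 : ∀ z : Fin n → Bool, ∑' c, P.law (fun _ => z) y Transcript.pair3 (b, c) =
      P.law x y Transcript.link23 b := fun z =>
    (P.law_eq_tsum_pair (fun _ => z) y Transcript.link23 Transcript.link31 b).symm.trans
      (hP.law23_eq (fun _ => z) x y y b)
  rw [Summable.tsum_finsetSum fun _ _ => ENNReal.summable, Finset.sum_congr rfl fun z _ => h1 z]
  simp

/-- Sum over the 2^n outputs and split according to link 31. Links 23 and 31 fix the output, so one
term survives, and the factor `m` is absorbed by `law_pair3_le`. -/
theorem law23_le (hP : P.PrivateOT) (hm : 2 ≤ m) (hn : 1 ≤ n) (x : Blocks m n) (y : Fin m)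
    (b : Msg × Msg) : (m : ℝ≥0∞) * (Fintype.card (Fin n → Bool) *
      P.law x y Transcript.link23 b) ≤ 1 := by
  rw [← hP.sum_law_pair3, ← ENNReal.tsum_mul_left, ← hP.computes.1 x y,
    ← P.tsum_law x y Transcript.link31]
  refine ENNReal.tsum_le_tsum fun c => ?_
  rw [Finset.mul_sum]
  refine sum_le_of_subsingleton_support ?_ fun z => ?_
  · intro z1 z2 hz1 hz2
    obtain ⟨τ1, h1, h3⟩ := exists_of_law_ne_zero (mul_ne_zero_iff.1 hz1).2
    obtain ⟨τ2, h2, h4⟩ := exists_of_law_ne_zero (mul_ne_zero_iff.1 hz2).2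
    exact hP.output_unique h1 h2 (h3.trans h4.symm)
  · rw [hP.law31_eq hm x (fun _ => z) y y]
    exact hP.law_pair3_le hm hn _ _ _ _

/-- Bob's transcripts fix his index, so one `y'` survives. The factor becomes a sum over all `x'`;
given link 31 too, one `x'` survives and is bounded by Charlie's view for output `x' y'`. Summing
the latter over outputs leaves only 2^n, a gain of 2^(n(m-1)). -/
theorem sum_law_pair2_le (hP : P.PrivateOT) (hn : 1 ≤ n) (x : Blocks m n) (y : Fin m)
    (a b : Msg × Msg) :
    (Fintype.card (Blocks m n) : ℝ≥0∞) * ∑ y', P.law x y' Transcript.pair2 (a, b) ≤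
      Fintype.card (Fin n → Bool) * P.law x y Transcript.link23 b := by
  rw [Finset.mul_sum]
  refine sum_le_of_subsingleton_support ?_ fun y' => ?_
  · intro y1 y2 hy1 hy2
    obtain ⟨τ1, h1, h3⟩ := exists_of_law_ne_zero (mul_ne_zero_iff.1 hy1).2
    obtain ⟨τ2, h2, h4⟩ := exists_of_law_ne_zero (mul_ne_zero_iff.1 hy2).2
    exact hP.input2_unique hn h1 h2 (h3.trans h4.symm)
  have h1 : (Fintype.card (Blocks m n) : ℝ≥0∞) * P.law x y' Transcript.pair2 (a, b) =
      ∑ x', P.law x' y' Transcript.pair2 (a, b) := by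
    rw [Finset.sum_congr rfl fun x' _ => hP.private2 x' x y' (a, b)]
    simp
  rw [h1, Finset.sum_congr rfl fun x' _ => P.law_pair2 x' y' a b,
    ← Summable.tsum_finsetSum fun _ _ => ENNReal.summable, hP.law23_eq x x y y' b,
    ← hP.sum_law_pair3 x y' b]
  refine ENNReal.tsum_le_tsum fun c => sum_le_of_subsingleton_support ?_ fun x' => ?_
  · intro x1 x2 hx1 hx2
    exact hP.input1_unique hx1 hx2 rfl
  · refine (P.finalMass_le_law x' y' Transcript.pair3 ⟨a, b, c⟩).trans ?_
    rw [hP.private3 x' y' (fun _ => x' y') y' rfl]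
    exact Finset.single_le_sum
      (f := fun z : Fin n → Bool => P.law (fun _ => z) y' Transcript.pair3 (b, c))
      (fun _ _ => zero_le) (Finset.mem_univ _)

end PrivateOT
end Protocol

/-! ### Executions with simulated parties -/

section Simulation

variable {ρ U V : Type*}

/-- The product of the conditional weights of the first components of the letters. -/
def margFst (Q : List ρ → ℝ≥0∞) (e : U × V ≃ ρ) : List ρ → ℝ≥0∞ :=
  pathWeight fun l r => condFst Q e l (e.symm r).1

/-- The product of the conditional weights of the second components given the first ones. -/
def margSnd (Q : List ρ → ℝ≥0∞) (e : U × V ≃ ρ) : List ρ → ℝ≥0∞ :=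
  pathWeight fun l r => condSnd Q e l (e.symm r).1 (e.symm r).2

theorem tsum_prod_mul_mul {α β γ : Type*} (F : α → ℝ≥0∞) (A : β → ℝ≥0∞) (D : γ → ℝ≥0∞) :
    ∑' q : α × β × γ, F q.1 * A q.2.1 * D q.2.2 = (∑' a, F a) * (∑' b, A b) * ∑' c, D c := by
  rw [ennreal_tsum_prod]
  simp only [ennreal_tsum_prod, ENNReal.tsum_mul_left, ENNReal.tsum_mul_right]

/-- The four messages of a round on the links of party 2, those sent by party 2 first. -/
def pair2Equiv : (Msg × Msg) × Msg × Msg ≃ (Msg × Msg) × (Msg × Msg) where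
  toFun q := ((q.2.1, q.1.1), (q.1.2, q.2.2))
  invFun r := ((r.1.2, r.2.1), r.1.1, r.2.2)
  left_inv _ := rfl
  right_inv _ := rfl

/-- Here parties 1 and 3 are simulated: each message received by party 2 is drawn from the
conditional law of its link given the past of that link alone. On link 23 the components are
exchanged because the received message is listed second. -/
theorem tsum_simulation2_le_one {X Y Z : Type} (P : Protocol X Y Z) (y : Y)
    {Q12 Q23 : LinkHistory → ℝ≥0∞} (h12 : ∀ g, ∑' r, Q12 (g ++ [r]) ≤ Q12 g)
    (h23 : ∀ g, ∑' r, Q23 (g ++ [r]) ≤ Q23 g) (t : ℕ) :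
    ∑' l : List ((Msg × Msg) × (Msg × Msg)), (if l.length = t then
      pathWeight (P.kernel2 y) l * margFst Q12 (Equiv.refl _) (l.map Prod.fst) *
        margFst Q23 (Equiv.prodComm _ _) (l.map Prod.snd) else 0) ≤ 1 := by
  simp only [margFst, ← pathWeight_map, ← pathWeight_mul]
  refine tsum_pathWeight_le_one (fun l => ?_) t
  rw [← pair2Equiv.tsum_eq]
  simp only [pair2Equiv, Protocol.kernel2, Equiv.coe_fn_mk, Equiv.refl_symm, Equiv.refl_apply,
    Equiv.prodComm_symm, Equiv.prodComm_apply, Prod.swap]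
  rw [tsum_prod_mul_mul (fun q : Msg × Msg => P.next2 y (l.map Prod.fst) (l.map Prod.snd) q)]
  exact mul_le_one' (mul_le_one' (PMF.tsum_coe _).le (tsum_condFst_le_one _ h12 _))
    (tsum_condFst_le_one _ h23 _)

/-- The six messages of a round, those sent by parties 1 and 3 first. -/
def roundEquiv13 : ((Msg × Msg) × (Msg × Msg)) × Msg × Msg ≃ Round where
  toFun q := { m12 := q.1.1.1, m13 := q.1.1.2, m31 := q.1.2.1, m32 := q.1.2.2,
               m21 := q.2.1, m23 := q.2.2 }
  invFun r := (((r.m12, r.m13), (r.m31, r.m32)), r.m21, r.m23)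
  left_inv _ := rfl
  right_inv _ := rfl

/-- Here party 2 is simulated separately on its two links. Its message is conditioned also on the
message crossing it in the same round, so parties 1 and 3 are drawn first. This complements the
conditioning used when party 2 is real. -/
theorem tsum_simulation13_le_one {X Y Z : Type} (P : Protocol X Y Z) (x : X)
    (Q12 Q23 : LinkHistory → ℝ≥0∞) (t : ℕ) :
    ∑' h : History, (if h.length = t then
      pathWeight (P.kernel1 x) (h.map Round.pair1) *
        margSnd Q12 (Equiv.refl _) ((h.map Round.pair1).map Prod.fst) *
      (pathWeight P.kernel3 (h.map Round.pair3) *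
        margSnd Q23 (Equiv.prodComm _ _) ((h.map Round.pair3).map Prod.fst)) else 0) ≤ 1 := by
  simp only [margSnd, ← pathWeight_map, ← pathWeight_mul]
  refine tsum_pathWeight_le_one (fun h => ?_) t
  rw [← roundEquiv13.tsum_eq, ennreal_tsum_prod]
  simp only [roundEquiv13, Protocol.kernel1, Protocol.kernel3, Equiv.coe_fn_mk, Equiv.refl_symm,
    Equiv.refl_apply, Equiv.prodComm_symm, Equiv.prodComm_apply, Prod.swap, Round.pair1,
    Round.pair3]
  refine le_trans (b := ∑' q : (Msg × Msg) × (Msg × Msg),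
    P.next1 x ((h.map Round.pair1).map Prod.fst) ((h.map Round.pair1).map Prod.snd) q.1 *
    P.next3 ((h.map Round.pair3).map Prod.fst) ((h.map Round.pair3).map Prod.snd) q.2) ?_ ?_
  · refine ENNReal.tsum_le_tsum fun q => ?_
    rw [ennreal_tsum_prod]
    simp only [ENNReal.tsum_mul_left, ENNReal.tsum_mul_right]
    exact mul_le_mul' (mul_le_of_le_one_right' (tsum_condSnd_le_one _ _ _ _))
      (mul_le_of_le_one_right' (tsum_condSnd_le_one _ _ _ _))
  · rw [ennreal_tsum_prod]
    simp [ENNReal.tsum_mul_left]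

end Simulation

theorem tsum_le_of_subsingleton_support {ι : Type*} {f : ι → ℝ≥0∞} {B : ℝ≥0∞}
    (hs : ∀ i j, f i ≠ 0 → f j ≠ 0 → i = j) (hB : ∀ i, f i ≤ B) : ∑' i, f i ≤ B := by
  by_cases h : ∃ i, f i ≠ 0
  · obtain ⟨i, hi⟩ := h
    rw [tsum_eq_single i]
    · exact hB i
    · intro j hj
      by_contra hc
      exact hj (hs j i hc hi)
  · have h0 : ∀ i, f i = 0 := fun i => by
      by_contra hc
      exact h ⟨i, hc⟩
    simp [h0]

/-- Take logarithms and apply `log f ≤ f - 1` to the three factors. The three units stand on the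
left so that nothing is subtracted in `ℝ≥0∞`. -/
theorem log_add_three_le {K : ℝ} (hK : 1 ≤ K) {d f₁ f₂ f₃ : ℝ≥0∞} (hd : d ≠ 0) (hd1 : d ≤ 1)
    (h : ENNReal.ofReal K * d ≤ f₁ * f₂ * f₃) :
    ENNReal.ofReal (Real.log K) + 3 ≤ ENNReal.ofReal (-Real.log d.toReal) + (f₁ + f₂ + f₃) := by
  by_cases h1 : f₁ = ∞
  · simp [h1]
  by_cases h2 : f₂ = ∞
  · simp [h2]
  by_cases h3 : f₃ = ∞
  · simp [h3]
  have hdt : d ≠ ∞ := (hd1.trans_lt ENNReal.one_lt_top).ne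
  have hd0 : 0 < d.toReal := ENNReal.toReal_pos hd hdt
  have hdle : d.toReal ≤ 1 := by simpa using ENNReal.toReal_mono ENNReal.one_ne_top hd1
  have hr : K * d.toReal ≤ f₁.toReal * f₂.toReal * f₃.toReal := by
    have := ENNReal.toReal_mono (ENNReal.mul_ne_top (ENNReal.mul_ne_top h1 h2) h3) h
    simpa [ENNReal.toReal_ofReal (zero_le_one.trans hK)] using this
  have hK0 : 0 < K := zero_lt_one.trans_le hK
  have hp : 0 < f₁.toReal * f₂.toReal * f₃.toReal := (mul_pos hK0 hd0).trans_le hr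
  have hne : f₁.toReal ≠ 0 ∧ f₂.toReal ≠ 0 ∧ f₃.toReal ≠ 0 := by
    have := hp.ne'
    simp only [mul_ne_zero_iff] at this
    tauto
  have p1 : 0 < f₁.toReal := lt_of_le_of_ne ENNReal.toReal_nonneg hne.1.symm
  have p2 : 0 < f₂.toReal := lt_of_le_of_ne ENNReal.toReal_nonneg hne.2.1.symm
  have p3 : 0 < f₃.toReal := lt_of_le_of_ne ENNReal.toReal_nonneg hne.2.2.symm
  have hlog := Real.log_le_log (mul_pos hK0 hd0) hr
  rw [Real.log_mul hK0.ne' hd0.ne', Real.log_mul (mul_pos p1 p2).ne' p3.ne',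
    Real.log_mul p1.ne' p2.ne'] at hlog
  have l1 := Real.log_le_sub_one_of_pos p1
  have l2 := Real.log_le_sub_one_of_pos p2
  have l3 := Real.log_le_sub_one_of_pos p3
  rw [← ENNReal.ofReal_toReal h1, ← ENNReal.ofReal_toReal h2, ← ENNReal.ofReal_toReal h3,
    ← ENNReal.ofReal_add p1.le p2.le, ← ENNReal.ofReal_add (by positivity) p3.le,
    ← ENNReal.ofReal_add (by have := Real.log_nonpos hd0.le hdle; linarith) (by positivity),
    show (3 : ℝ≥0∞) = ENNReal.ofReal 3 by simp,
    ← ENNReal.ofReal_add (Real.log_nonneg hK) (by norm_num)]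
  exact ENNReal.ofReal_le_ofReal (by linarith)

/-! ### Merging the histories of the links of party 1 and of party 3 -/

/-- The links of party 1 and of party 3 cover all three links and overlap only in link 31; given
link 31, the two sides combine freely. -/
theorem exists_history_of_pairs : ∀ {l l' : List ((Msg × Msg) × (Msg × Msg))},
    l.map Prod.snd = l'.map Prod.snd →
      ∃ h : History, h.map Round.pair1 = l ∧ h.map Round.pair3 = l'
  | [], l', h => ⟨[], rfl, (List.map_eq_nil_iff.1 h.symm).symm⟩
  | _ :: _, [], h => by simp at h
  | r :: l, r' :: l', h => by
    simp only [List.map_cons, List.cons.injEq] at h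
    obtain ⟨g, h1, h2⟩ := exists_history_of_pairs h.2
    refine ⟨⟨r.1.1, r.1.2, r'.1.1, r'.1.2, r.2.1, r.2.2⟩ :: g, ?_, ?_⟩
    · simp [h1, Round.pair1]
    · simp [h2, Round.pair3, h.1]

theorem injective_pairs : Function.Injective fun h : History =>
    (h.map Round.pair1, h.map Round.pair3) := by
  intro h h' hh
  simp only [Prod.mk.injEq] at hh
  refine History.ext_links ?_ ?_ ?_
  · rw [← History.map_fst_pair1, ← History.map_fst_pair1, hh.1]
  · rw [← History.map_fst_pair3, ← History.map_fst_pair3, hh.2]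
  · rw [← History.map_snd_pair1, ← History.map_snd_pair1, hh.1]

/-- A sum over histories as a sum over the transcript of link 31 and the remaining parts. -/
theorem tsum_history_eq (φ ψ : List ((Msg × Msg) × (Msg × Msg)) → ℝ≥0∞)
    (κ : LinkHistory → ℝ≥0∞) :
    ∑' h : History, κ h.link31 * (φ (h.map Round.pair1) * ψ (h.map Round.pair3)) =
      ∑' c, κ c * ((∑' l, if l.map Prod.snd = c then φ l else 0) *
        ∑' l, if l.map Prod.snd = c then ψ l else 0) := by
  have h1 : ∑' h : History, κ h.link31 * (φ (h.map Round.pair1) * ψ (h.map Round.pair3)) =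
      ∑' q : List ((Msg × Msg) × (Msg × Msg)) × List ((Msg × Msg) × (Msg × Msg)),
        if q.1.map Prod.snd = q.2.map Prod.snd then κ (q.1.map Prod.snd) * (φ q.1 * ψ q.2)
          else 0 := by
    rw [← injective_pairs.tsum_eq]
    · refine tsum_congr fun h => ?_
      rw [if_pos]
      · simp only [History.map_snd_pair1]
      · simp only [History.map_snd_pair1, History.map_snd_pair3]
    · rintro ⟨l, l'⟩ hl
      have : l.map Prod.snd = l'.map Prod.snd := by
        by_contra hc
        simp [hc] at hl
      obtain ⟨h, h1, h2⟩ := exists_history_of_pairs this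
      exact ⟨h, Prod.ext h1 h2⟩
  rw [h1, ennreal_tsum_prod]
  simp only [← ENNReal.tsum_mul_right]
  simp only [← ENNReal.tsum_mul_left]
  rw [ENNReal.tsum_comm (α := LinkHistory)]
  refine tsum_congr fun l => ?_
  rw [ENNReal.tsum_comm]
  refine tsum_congr fun l' => ?_
  rw [tsum_eq_single (l.map Prod.snd)]
  · by_cases h : l.map Prod.snd = l'.map Prod.snd
    · simp [h]
    · simp [h, Ne.symm h]
  · intro c hc
    simp [Ne.symm hc]

theorem tsum_filter_eq {ι κ : Type*} [DecidableEq κ] (u : ι → κ) (w : ι → ℝ≥0∞) (v : κ → ℝ≥0∞) :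
    ∑' i, w i * v (u i) = ∑' k, (∑' i, if u i = k then w i else 0) * v k := by
  simp only [← ENNReal.tsum_mul_right]
  rw [ENNReal.tsum_comm]
  refine tsum_congr fun i => ?_
  rw [tsum_eq_single (u i)]
  · simp
  · intro k hk
    simp [Ne.symm hk]

/-! ### Executions in which all blocks of party 1 are equal -/

namespace Protocol

variable {m n : ℕ} (P : Protocol (Blocks m n) (Fin m) (Fin n → Bool))

/-- The weight of a terminal history after `t` rounds, for the input `(z, …, z)` of party 1,
summed over the inputs of party 2. -/
def constWeight (t : ℕ) (z : Fin n → Bool) (h : History) : ℝ≥0∞ :=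
  ∑ y : Fin m, P.termRun (fun _ => z) y t h

/-- The possible histories of the form counted by `constWeight`. -/
def Completed (t : ℕ) (h : History) : Prop :=
  ∃ x y, P.Terminal x y h ∧ h ∈ (P.run x y t).support

variable {P}

theorem tsum_constWeight_mul_le (t : ℕ) (z : Fin n → Bool) (φ : Transcript → ℝ≥0∞) :
    ∑' h : History, P.constWeight t z h * φ h.transcript ≤
      ∑ y : Fin m, ∑' τ, P.finalMass (fun _ => z) y τ * φ τ := by
  simp only [constWeight, Finset.sum_mul]
  rw [Summable.tsum_finsetSum fun _ _ => ENNReal.summable]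
  refine Finset.sum_le_sum fun y _ => ?_
  rw [tsum_finalMass_mul]
  exact le_iSup (fun t => ∑' h : History, P.termRun (fun _ => z) y t h * φ h.transcript) t

theorem tsum_constWeight_law_le {α : Type*} (A : Transcript → α) (t : ℕ) (z : Fin n → Bool)
    (p : History → Prop) [DecidablePred p] (a : α) (hp : ∀ h : History, p h → A h.transcript = a) :
    ∑' h : History, (if p h then P.constWeight t z h else 0) ≤
      ∑ y : Fin m, P.law (fun _ => z) y A a := by
  refine le_trans (ENNReal.tsum_le_tsum fun h => ?_)
    (tsum_constWeight_mul_le t z fun τ => if A τ = a then 1 else 0)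
  by_cases h1 : p h
  · simp [h1, hp h h1]
  · simp [h1]

/-- Termination with probability 1 means that no mass is lost in the limit; each pair (z, y)
contributes 1. -/
theorem iSup_tsum_constWeight (hC : P.Computes fun x y => x y) :
    ⨆ t, ∑ z : Fin n → Bool, ∑' h, P.constWeight t z h =
      (Fintype.card (Fin n → Bool) : ℝ≥0∞) * m := by
  have hmono : ∀ (z : Fin n → Bool) (y : Fin m),
      Monotone fun t => ∑' h, P.termRun (fun _ => z) y t h := by
    intro z y
    simpa using P.monotone_tsum_termRun (fun _ => z) y fun _ => 1
  simp only [constWeight, Summable.tsum_finsetSum fun _ _ => ENNReal.summable]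
  rw [← ENNReal.finsetSum_iSup_of_monotone (fun z s t hst =>
    Finset.sum_le_sum fun y _ => hmono z y hst)]
  simp only [← ENNReal.finsetSum_iSup_of_monotone (fun y => hmono _ y), iSup_tsum_termRun, hC.1]
  simp

theorem completed_of_constWeight_ne_zero {t : ℕ} {z : Fin n → Bool} {h : History}
    (hh : P.constWeight t z h ≠ 0) :
    ∃ y, P.Terminal (fun _ => z) y h ∧ h ∈ (P.run (fun _ => z) y t).support := by
  obtain ⟨y, -, hy⟩ := Finset.exists_ne_zero_of_sum_ne_zero hh
  exact ⟨y, termRun_ne_zero_iff.1 hy⟩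

/-- Termination does not depend on the inputs. If the history is terminal for one `y`, then for any
other `y'` it is either terminal too or of probability 0, so the restriction to terminal states
disappears and the three factors separate. -/
theorem PrivateOT.constWeight_eq (hP : P.PrivateOT) {t : ℕ} {z : Fin n → Bool} {h : History}
    (hh : P.constWeight t z h ≠ 0) : P.constWeight t z h =
      pathWeight (P.kernel1 fun _ => z) (h.map Round.pair1) *
        (∑ y, pathWeight (P.kernel2 y) (h.map Round.pair2)) *
          pathWeight P.kernel3 (h.map Round.pair3) := by
  obtain ⟨y, hT, hs⟩ := completed_of_constWeight_ne_zero hh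
  have hl := P.length_of_mem_support_run _ _ _ _ hs
  rw [constWeight, Finset.mul_sum, Finset.sum_mul]
  refine Finset.sum_congr rfl fun y' _ => ?_
  rw [← run_apply, hl, termRun]
  split_ifs with h1
  · rfl
  · by_contra hc
    exact h1 (hP.decodable.terminal _ _ _ _ _ _ hs (Ne.symm hc) hT)

theorem Completed.length_eq {t : ℕ} {h : History} (hh : P.Completed t h) : h.length = t := by
  obtain ⟨x, y, -, hs⟩ := hh
  exact P.length_of_mem_support_run _ _ _ _ hs

/-- The law of the transcript of link 31, as a function of the link histories after `t` rounds. -/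
def completedLaw31 (P : Protocol (Blocks m n) (Fin m) (Fin n → Bool)) (x : Blocks m n) (y : Fin m)
    (t : ℕ) (c : LinkHistory) : ℝ≥0∞ :=
  if ∃ h, P.Completed t h ∧ h.link31 = c then
    P.law x y Transcript.link31 (LinkHistory.concat c) else 0

theorem PrivateOT.tsum_completedLaw31_le (hP : P.PrivateOT) (x : Blocks m n) (y : Fin m) (t : ℕ) :
    ∑' c, P.completedLaw31 x y t c ≤ 1 := by
  rw [← hP.computes.1 x y, ← P.tsum_law x y Transcript.link31]
  have h1 : ∀ c, P.completedLaw31 x y t c = (if ∃ h, P.Completed t h ∧ h.link31 = c then 1 else 0) *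
      P.law x y Transcript.link31 (LinkHistory.concat c) := by
    intro c
    rw [completedLaw31]
    split_ifs <;> simp
  simp only [h1]
  rw [tsum_filter_eq LinkHistory.concat _ (P.law x y Transcript.link31)]
  refine ENNReal.tsum_le_tsum fun b => mul_le_of_le_one_left' ?_
  -- Among completed histories of the same length, the transcript of link 31 determines its link
  -- history, so no transcript is counted twice.
  refine tsum_le_of_subsingleton_support ?_ fun c => ?_
  · intro c c' hc hc'
    simp only [ne_eq, ite_eq_right_iff, Classical.not_imp, one_ne_zero, not_false_eq_true,
      and_true] at hc hc'
    obtain ⟨h1, h, hh, rfl⟩ := hc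
    obtain ⟨h2, h', hh', rfl⟩ := hc'
    have hl := hh.length_eq.trans hh'.length_eq.symm
    obtain ⟨x1, y1, -, hs⟩ := hh
    obtain ⟨x2, y2, -, hs'⟩ := hh'
    exact hP.decodable.link31 h h' (reachable_of_mem hs) (reachable_of_mem hs') hl
      (h1.trans h2.symm)
  · split_ifs <;> simp

end Protocol

/-! ### Three ratios of mean at most one -/

/-- The sum of `φ` over the histories of two links, given that of the second one. -/
def fiberSum (φ : List ((Msg × Msg) × (Msg × Msg)) → ℝ≥0∞) (c : LinkHistory) : ℝ≥0∞ :=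
  ∑' l, if l.map Prod.snd = c then φ l else 0

namespace Protocol

variable {m n : ℕ} (P : Protocol (Blocks m n) (Fin m) (Fin n → Bool))

/-- Party 1 with input `(z, …, z)`, interacting with a simulated party 2. -/
def simWeight1 (Q12 : LinkHistory → ℝ≥0∞) (z : Fin n → Bool)
    (l : List ((Msg × Msg) × (Msg × Msg))) : ℝ≥0∞ :=
  pathWeight (P.kernel1 fun _ => z) l * margSnd Q12 (Equiv.refl _) (l.map Prod.fst)

/-- Party 3, interacting with a simulated party 2. -/
def simWeight3 (Q23 : LinkHistory → ℝ≥0∞) (l : List ((Msg × Msg) × (Msg × Msg))) : ℝ≥0∞ :=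
  pathWeight P.kernel3 l * margSnd Q23 (Equiv.prodComm _ _) (l.map Prod.fst)

/-- Party 3, interacting with a simulated party 2 and producing the output `z`. -/
def simOutput3 (Q23 : LinkHistory → ℝ≥0∞) (z : Fin n → Bool)
    (l : List ((Msg × Msg) × (Msg × Msg))) : ℝ≥0∞ :=
  if P.out3 (LinkHistory.concat (l.map Prod.fst)) (LinkHistory.concat (l.map Prod.snd)) =
    PMF.pure z then P.simWeight3 Q23 l else 0

/-- Party 2, interacting with a simulated party 1 and a simulated party 3, for `t` rounds. -/
def simWeight2 (Q12 Q23 : LinkHistory → ℝ≥0∞) (t : ℕ)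
    (l : List ((Msg × Msg) × (Msg × Msg))) : ℝ≥0∞ :=
  if l.length = t then (∑ y, pathWeight (P.kernel2 y) l) *
    margFst Q12 (Equiv.refl _) (l.map Prod.fst) *
      margFst Q23 (Equiv.prodComm _ _) (l.map Prod.snd) else 0

theorem tsum_simWeight2_le {Q12 Q23 : LinkHistory → ℝ≥0∞}
    (h12 : ∀ g, ∑' r, Q12 (g ++ [r]) ≤ Q12 g) (h23 : ∀ g, ∑' r, Q23 (g ++ [r]) ≤ Q23 g) (t : ℕ) :
    ∑' l, P.simWeight2 Q12 Q23 t l ≤ m := by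
  have h1 : ∀ l, P.simWeight2 Q12 Q23 t l = ∑ y, if l.length = t then
      pathWeight (P.kernel2 y) l * margFst Q12 (Equiv.refl _) (l.map Prod.fst) *
        margFst Q23 (Equiv.prodComm _ _) (l.map Prod.snd) else 0 := by
    intro l
    rw [simWeight2]
    split_ifs
    · simp only [Finset.sum_mul]
    · simp
  simp only [h1]
  rw [Summable.tsum_finsetSum fun _ _ => ENNReal.summable]
  refine (Finset.sum_le_sum fun y _ => tsum_simulation2_le_one P y h12 h23 t).trans ?_
  simp

/-- An output law is a point mass at no more than one `z`, so the restricted weights have disjoint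
supports. -/
theorem sum_simOutput3_le (Q23 : LinkHistory → ℝ≥0∞) (c : LinkHistory) :
    ∑ z, fiberSum (P.simOutput3 Q23 z) c ≤ fiberSum (P.simWeight3 Q23) c := by
  simp only [fiberSum]
  rw [← Summable.tsum_finsetSum fun _ _ => ENNReal.summable]
  refine ENNReal.tsum_le_tsum fun l => sum_le_of_subsingleton_support ?_ fun z => ?_
  · intro z z' hz hz'
    simp only [simOutput3, ne_eq, ite_eq_right_iff, Classical.not_imp] at hz hz'
    by_contra hne
    have h6 := congrArg (fun q : PMF (Fin n → Bool) => q z) (hz.2.1.symm.trans hz'.2.1)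
    simp [hne] at h6
  · rw [simOutput3]
    split_ifs <;> simp

theorem tsum_sim13_le (Q12 Q23 : LinkHistory → ℝ≥0∞) (t : ℕ) :
    ∑' c : LinkHistory, (if c.length = t then (∑ z, fiberSum (P.simWeight1 Q12 z) c) *
      fiberSum (P.simWeight3 Q23) c else 0) ≤ Fintype.card (Fin n → Bool) := by
  have h1 : ∀ c : LinkHistory, (if c.length = t then (∑ z, fiberSum (P.simWeight1 Q12 z) c) *
      fiberSum (P.simWeight3 Q23) c else 0) = ∑ z, (if c.length = t then 1 else 0) *
        (fiberSum (P.simWeight1 Q12 z) c * fiberSum (P.simWeight3 Q23) c) := by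
    intro c
    split_ifs
    · simp only [one_mul, Finset.sum_mul]
    · simp
  simp only [h1]
  rw [Summable.tsum_finsetSum fun _ _ => ENNReal.summable]
  refine (Finset.sum_le_sum fun z _ => ?_).trans (b := ∑ z : Fin n → Bool, 1) (by simp)
  simp only [fiberSum]
  rw [← tsum_history_eq (P.simWeight1 Q12 z) (P.simWeight3 Q23) fun c =>
    if c.length = t then 1 else 0]
  refine le_trans (ENNReal.tsum_le_tsum fun h => ?_)
    (tsum_simulation13_le_one P (fun _ => z) Q12 Q23 t)
  rw [show h.link31.length = h.length by simp [History.link31]]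
  split_ifs
  · simp [simWeight1, simWeight3]
  · simp

/-- Charlie's output `z` is summed independently of Alice's input, which ranges over all values:
given link 31, the two are not required to agree. -/
theorem tsum_simOutput13_le (Q12 Q23 : LinkHistory → ℝ≥0∞) (t : ℕ) :
    ∑ z, ∑' c : LinkHistory, (if c.length = t then (∑ z, fiberSum (P.simWeight1 Q12 z) c) *
      fiberSum (P.simOutput3 Q23 z) c else 0) ≤ Fintype.card (Fin n → Bool) := by
  rw [← Summable.tsum_finsetSum fun _ _ => ENNReal.summable]
  refine le_trans (ENNReal.tsum_le_tsum fun c => ?_) (P.tsum_sim13_le Q12 Q23 t)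
  split_ifs
  · rw [← Finset.mul_sum]
    gcongr
    exact P.sum_simOutput3_le Q23 c
  · simp

variable {P}

theorem history_pair2_transcript (h : History) : h.transcript.pair2 =
    (LinkHistory.concat ((h.map Round.pair2).map Prod.fst),
      LinkHistory.concat ((h.map Round.pair2).map Prod.snd)) := by
  rw [History.map_fst_pair2, History.map_snd_pair2]; rfl

/-- The sum over the inputs `y` of the law of the transcripts on the links of party 2. -/
def sumLaw2 (P : Protocol (Blocks m n) (Fin m) (Fin n → Bool)) (x : Blocks m n)
    (l : List ((Msg × Msg) × (Msg × Msg))) : ℝ≥0∞ :=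
  ∑ y, P.law x y Transcript.pair2
    (LinkHistory.concat (l.map Prod.fst), LinkHistory.concat (l.map Prod.snd))

/-- Project to the links of party 2. By privacy the real weight there is at most `sumLaw2`, which
cancels the denominator; what remains is the total simulated weight of party 2. -/
theorem PrivateOT.tsum_ratio1_le (hP : P.PrivateOT) (x : Blocks m n)
    {Q12 Q23 : LinkHistory → ℝ≥0∞}
    (h12 : ∀ g, ∑' r, Q12 (g ++ [r]) ≤ Q12 g) (h23 : ∀ g, ∑' r, Q23 (g ++ [r]) ≤ Q23 g) (t : ℕ) :
    ∑ z, ∑' h : History, P.constWeight t z h *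
      (P.simWeight2 Q12 Q23 t (h.map Round.pair2) / P.sumLaw2 x (h.map Round.pair2)) ≤
        Fintype.card (Fin n → Bool) * m := by
  refine (Finset.sum_le_sum fun z _ => ?_).trans (b := ∑ z : Fin n → Bool, (m : ℝ≥0∞)) (by simp)
  rw [tsum_filter_eq (fun h : History => h.map Round.pair2) _
    (fun l => P.simWeight2 Q12 Q23 t l / P.sumLaw2 x l)]
  refine le_trans (ENNReal.tsum_le_tsum fun l => ?_) (P.tsum_simWeight2_le h12 h23 t)
  have h1 : ∑' h : History, (if h.map Round.pair2 = l then P.constWeight t z h else 0) ≤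
      P.sumLaw2 x l := by
    refine (tsum_constWeight_law_le Transcript.pair2 t z (fun h => h.map Round.pair2 = l)
      (LinkHistory.concat (l.map Prod.fst), LinkHistory.concat (l.map Prod.snd)) ?_).trans
      (Finset.sum_le_sum fun y _ => (hP.private2 _ _ _ _).le)
    rintro h rfl
    exact history_pair2_transcript h
  exact (mul_le_mul_left h1 _).trans ENNReal.mul_div_le

theorem inv_mul_mul_le {F Fb G : ℝ≥0∞} (hF : F ≤ Fb) : (Fb * G)⁻¹ * (F * G) ≤ F / Fb := by
  by_cases h0 : Fb = 0
  · have : F = 0 := le_antisymm (h0 ▸ hF) zero_le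
    simp [this]
  by_cases hG : G = ∞
  · simp [hG, ENNReal.mul_top h0]
  by_cases hG0 : G = 0
  · simp [hG0]
  rw [ENNReal.mul_inv (Or.inl h0) (Or.inr hG0), div_eq_mul_inv]
  calc Fb⁻¹ * G⁻¹ * (F * G) = F * Fb⁻¹ * (G * G⁻¹) := by ring
    _ ≤ _ := mul_le_of_le_one_right' (ENNReal.mul_inv_le_one _)

theorem PrivateOT.output_eq_pure (hP : P.PrivateOT) {t : ℕ} {z : Fin n → Bool} {h : History}
    (hh : P.constWeight t z h ≠ 0) :
    P.out3 (LinkHistory.concat ((h.map Round.pair3).map Prod.fst))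
      (LinkHistory.concat ((h.map Round.pair3).map Prod.snd)) = PMF.pure z := by
  obtain ⟨_, hT, hs⟩ := completed_of_constWeight_ne_zero hh
  rw [History.map_fst_pair3, History.map_snd_pair3]
  exact hP.computes.2 _ _ _ (finalMass_ne_zero_of_terminal hT hs)

theorem constWeight_ne_top (t : ℕ) (z : Fin n → Bool) (h : History) :
    P.constWeight t z h ≠ ∞ :=
  ENNReal.sum_ne_top.2 fun _ _ =>
    ((P.termRun_le_run _ _ _ _).trans_lt (PMF.apply_lt_top _ _)).ne

/-- The weight `w` cancels, and correctness restricts party 3 to output `z`. Given link 31, its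
factor cancels completely, while the factors of party 1 add up over `z` to at most 1; the law of
link 31 then sums to at most 1. -/
theorem PrivateOT.tsum_ratio2_le (hP : P.PrivateOT) (x : Blocks m n) (y : Fin m)
    (Q12 Q23 : LinkHistory → ℝ≥0∞) (K : ℝ≥0∞) (t : ℕ) :
    ∑ z, ∑' h : History, P.constWeight t z h *
      (K * (P.simWeight1 Q12 z (h.map Round.pair1) * P.simWeight3 Q23 (h.map Round.pair3)) *
        P.completedLaw31 x y t h.link31 * ((∑ z, fiberSum (P.simWeight1 Q12 z) h.link31) *
          fiberSum (P.simOutput3 Q23 z) h.link31)⁻¹ * (P.constWeight t z h)⁻¹) ≤ K := by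
  have h1 : ∀ z, ∑' h : History, P.constWeight t z h *
      (K * (P.simWeight1 Q12 z (h.map Round.pair1) * P.simWeight3 Q23 (h.map Round.pair3)) *
        P.completedLaw31 x y t h.link31 * ((∑ z, fiberSum (P.simWeight1 Q12 z) h.link31) *
          fiberSum (P.simOutput3 Q23 z) h.link31)⁻¹ * (P.constWeight t z h)⁻¹) ≤
      ∑' c, K * P.completedLaw31 x y t c *
        (fiberSum (P.simWeight1 Q12 z) c / ∑ z, fiberSum (P.simWeight1 Q12 z) c) := by
    intro z
    have h2 := tsum_history_eq (P.simWeight1 Q12 z) (P.simOutput3 Q23 z) fun c =>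
      K * P.completedLaw31 x y t c * ((∑ z, fiberSum (P.simWeight1 Q12 z) c) *
          fiberSum (P.simOutput3 Q23 z) c)⁻¹
    refine le_trans (ENNReal.tsum_le_tsum fun h => ?_) (h2.le.trans
      (ENNReal.tsum_le_tsum fun c => ?_))
    · by_cases h0 : P.constWeight t z h = 0
      · rw [h0, zero_mul]; exact zero_le
      · have h3 := ENNReal.mul_inv_cancel h0 (constWeight_ne_top t z h)
        rw [show P.simOutput3 Q23 z (h.map Round.pair3) = P.simWeight3 Q23 (h.map Round.pair3) from
          if_pos (hP.output_eq_pure h0)]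
        refine le_of_eq ?_
        calc _ = (P.constWeight t z h * (P.constWeight t z h)⁻¹) *
            (K * P.completedLaw31 x y t h.link31 * ((∑ z, fiberSum (P.simWeight1 Q12 z) h.link31) *
              fiberSum (P.simOutput3 Q23 z) h.link31)⁻¹ *
            (P.simWeight1 Q12 z (h.map Round.pair1) * P.simWeight3 Q23 (h.map Round.pair3))) := by
              ring
          _ = _ := by rw [h3, one_mul]
    · rw [mul_assoc]
      gcongr
      exact inv_mul_mul_le (Finset.single_le_sum (f := fun z => fiberSum (P.simWeight1 Q12 z) c)
        (fun _ _ => zero_le) (Finset.mem_univ z))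
  refine (Finset.sum_le_sum fun z _ => h1 z).trans ?_
  rw [← Summable.tsum_finsetSum fun _ _ => ENNReal.summable]
  refine (ENNReal.tsum_le_tsum fun c => ?_).trans (b := ∑' c, K * P.completedLaw31 x y t c) ?_
  · rw [← Finset.mul_sum]
    refine mul_le_of_le_one_right' ?_
    simp only [div_eq_mul_inv, ← Finset.sum_mul]
    exact (ENNReal.mul_inv_le_one _)
  · rw [ENNReal.tsum_mul_left]
    exact mul_le_of_le_one_right' (hP.tsum_completedLaw31_le x y t)

/-- Really, for each `z`, a history of link 31 has weight at most `m` times its law, whatever `z`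
is. This cancels the inverse law and leaves the simulation in which input and output are not
matched. -/
theorem PrivateOT.tsum_ratio3_le (hP : P.PrivateOT) (hm : 2 ≤ m) (x : Blocks m n) (y : Fin m)
    (Q12 Q23 : LinkHistory → ℝ≥0∞) (t : ℕ) :
    ∑ z, ∑' h : History, P.constWeight t z h *
      ((∑ z, fiberSum (P.simWeight1 Q12 z) h.link31) *
          fiberSum (P.simOutput3 Q23 z) h.link31 * (P.completedLaw31 x y t h.link31)⁻¹) ≤
      Fintype.card (Fin n → Bool) * m := by
  have h1 : ∀ z c, ∑' h : History, (if h.link31 = c then P.constWeight t z h else 0) ≤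
      m * P.completedLaw31 x y t c := by
    intro z c
    rw [completedLaw31]
    split_ifs with hc
    · refine (tsum_constWeight_law_le Transcript.link31 t z (fun h => h.link31 = c)
        (LinkHistory.concat c) ?_).trans ?_
      · rintro h rfl
        rfl
      · rw [Finset.sum_congr rfl fun y' _ => hP.law31_eq hm (fun _ => z) x y' y _]
        simp
    · rw [mul_zero, nonpos_iff_eq_zero, ENNReal.tsum_eq_zero]
      intro h
      split_ifs with h1
      · by_contra hw
        obtain ⟨y', h2, h3⟩ := completed_of_constWeight_ne_zero hw
        exact hc ⟨h, ⟨_, _, h2, h3⟩, h1⟩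
      · rfl
  refine le_trans (Finset.sum_le_sum fun z _ => ?_) (b := ∑ z, (m : ℝ≥0∞) * ∑' c : LinkHistory,
    (if c.length = t then (∑ z, fiberSum (P.simWeight1 Q12 z) c) *
      fiberSum (P.simOutput3 Q23 z) c else 0)) ?_
  · rw [tsum_filter_eq (fun h : History => h.link31) (P.constWeight t z) fun c =>
      (∑ z, fiberSum (P.simWeight1 Q12 z) c) * fiberSum (P.simOutput3 Q23 z) c *
        (P.completedLaw31 x y t c)⁻¹, ← ENNReal.tsum_mul_left]
    refine ENNReal.tsum_le_tsum fun c => ?_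
    by_cases hc : c.length = t
    · rw [if_pos hc]
      refine (mul_le_mul_left (h1 z c) _).trans ?_
      calc _ = (m : ℝ≥0∞) * ((∑ z, fiberSum (P.simWeight1 Q12 z) c) *
            fiberSum (P.simOutput3 Q23 z) c) *
            (P.completedLaw31 x y t c * (P.completedLaw31 x y t c)⁻¹) := by ring
        _ ≤ _ := mul_le_of_le_one_right' (ENNReal.mul_inv_le_one _)
    · have h2 : P.completedLaw31 x y t c = 0 := by
        rw [completedLaw31, if_neg]
        rintro ⟨h, hh, rfl⟩
        exact hc (by rw [← hh.length_eq]; simp [History.link31])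
      have h3 := h1 z c
      rw [h2, mul_zero, nonpos_iff_eq_zero] at h3
      rw [h3, zero_mul]
      exact zero_le
  · rw [← Finset.mul_sum, mul_comm]
    gcongr
    exact P.tsum_simOutput13_le Q12 Q23 t

end Protocol

/-! ### The entropy of link 12 -/

namespace Protocol

variable {m n : ℕ} {P : Protocol (Blocks m n) (Fin m) (Fin n → Bool)}

theorem PrivateOT.le_ratio_mul (hP : P.PrivateOT) (hm : 2 ≤ m) (hn : 1 ≤ n) (x : Blocks m n)
    (y : Fin m) {Q12 Q23 : LinkHistory → ℝ≥0∞} {t : ℕ} {z : Fin n → Bool} {h : History}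
    (hw : P.constWeight t z h ≠ 0)
    (hq12 : P.law x y Transcript.link12 h.transcript.link12 ≤
      margFst Q12 (Equiv.refl _) h.link12 * margSnd Q12 (Equiv.refl _) h.link12)
    (hq23 : P.law x y Transcript.link23 h.transcript.link23 ≤
      margFst Q23 (Equiv.prodComm _ _) h.link23 * margSnd Q23 (Equiv.prodComm _ _) h.link23) :
    Fintype.card (Blocks m n) * m * P.law x y Transcript.link12 h.transcript.link12 ≤
      P.simWeight2 Q12 Q23 t (h.map Round.pair2) / P.sumLaw2 x (h.map Round.pair2) *
      (Fintype.card (Fin n → Bool) * m *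
        (P.simWeight1 Q12 z (h.map Round.pair1) * P.simWeight3 Q23 (h.map Round.pair3)) *
        P.completedLaw31 x y t h.link31 * ((∑ z, fiberSum (P.simWeight1 Q12 z) h.link31) *
          fiberSum (P.simOutput3 Q23 z) h.link31)⁻¹ * (P.constWeight t z h)⁻¹) *
      ((∑ z, fiberSum (P.simWeight1 Q12 z) h.link31) *
          fiberSum (P.simOutput3 Q23 z) h.link31 * (P.completedLaw31 x y t h.link31)⁻¹) := by
  obtain ⟨y', hT, hs⟩ := completed_of_constWeight_ne_zero hw
  have hl := P.length_of_mem_support_run _ _ _ _ hs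
  have hfin : P.finalMass (fun _ => z) y' h.transcript ≠ 0 := finalMass_ne_zero_of_terminal hT hs
  have hlaw : ∀ {α : Type} (A : Transcript → α), P.law (fun _ => z) y' A (A h.transcript) ≠ 0 :=
    fun A hc => hfin (le_antisymm (hc ▸ P.finalMass_le_law _ _ A _) zero_le)
  have hD12 := hlaw Transcript.link12
  rw [hP.law12_eq _ x _ y] at hD12
  have hD23 := hlaw Transcript.link23
  rw [hP.law23_eq _ x _ y] at hD23
  have hD31 := hlaw Transcript.link31
  rw [hP.law31_eq hm _ x _ y] at hD31
  have hcl : P.completedLaw31 x y t h.link31 = P.law x y Transcript.link31 h.transcript.link31 :=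
    if_pos ⟨h, ⟨_, _, hT, hs⟩, rfl⟩
  have hle1 : ∀ {α : Type} (A : Transcript → α) (a : α) y, P.law x y A a ≤ 1 := by
    intro α A a y
    rw [← hP.computes.1 x y, ← P.tsum_law x y A]
    exact ENNReal.le_tsum a
  have hπ0 : P.completedLaw31 x y t h.link31 ≠ 0 := hcl ▸ hD31
  have hπ1 : P.completedLaw31 x y t h.link31 ≠ ∞ :=
    hcl ▸ ((hle1 _ _ _).trans_lt ENNReal.one_lt_top).ne
  have hweq := hP.constWeight_eq hw
  have hw0 := hw
  rw [hweq, mul_ne_zero_iff, mul_ne_zero_iff] at hw0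
  have e1 : P.simWeight1 Q12 z (h.map Round.pair1) =
      pathWeight (P.kernel1 fun _ => z) (h.map Round.pair1) *
        margSnd Q12 (Equiv.refl _) h.link12 := by
    rw [simWeight1, History.map_fst_pair1]
  have e3 : P.simWeight3 Q23 (h.map Round.pair3) = pathWeight P.kernel3 (h.map Round.pair3) *
      margSnd Q23 (Equiv.prodComm _ _) h.link23 := by
    rw [simWeight3, History.map_fst_pair3]
  have e2 : P.simWeight2 Q12 Q23 t (h.map Round.pair2) =
      (∑ y, pathWeight (P.kernel2 y) (h.map Round.pair2)) *
        margFst Q12 (Equiv.refl _) h.link12 * margFst Q23 (Equiv.prodComm _ _) h.link23 := by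
    rw [simWeight2, if_pos (by simpa using hl), History.map_fst_pair2, History.map_snd_pair2]
  have hm12 := (lt_of_lt_of_le (pos_iff_ne_zero.2 hD12) hq12).ne'
  have hm23 := (lt_of_lt_of_le (pos_iff_ne_zero.2 hD23) hq23).ne'
  rw [mul_ne_zero_iff] at hm12 hm23
  set X := (∑ z, fiberSum (P.simWeight1 Q12 z) h.link31) *
    fiberSum (P.simOutput3 Q23 z) h.link31 with hX
  -- The parts of `h` itself lie in the fibres over its link 31 and have positive simulated weight.
  -- Finiteness of `X` comes from the total bound for the simulation.
  have hX0 : X ≠ 0 := by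
    rw [hX, mul_ne_zero_iff]
    constructor
    · refine (lt_of_lt_of_le (b := P.simWeight1 Q12 z (h.map Round.pair1)) ?_ ?_).ne'
      · rw [pos_iff_ne_zero, e1]
        exact mul_ne_zero hw0.1.1 hm12.2
      · refine le_trans ?_ (Finset.single_le_sum
          (f := fun z => fiberSum (P.simWeight1 Q12 z) h.link31)
          (fun _ _ => zero_le) (Finset.mem_univ z))
        refine le_trans ?_ (ENNReal.le_tsum (h.map Round.pair1))
        rw [if_pos (History.map_snd_pair1 h)]
    · refine (lt_of_lt_of_le (b := P.simOutput3 Q23 z (h.map Round.pair3)) ?_ ?_).ne'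
      · rw [pos_iff_ne_zero, simOutput3, if_pos (hP.output_eq_pure hw), e3]
        exact mul_ne_zero hw0.2 hm23.2
      · refine le_trans ?_ (ENNReal.le_tsum (h.map Round.pair3))
        rw [if_pos (History.map_snd_pair3 h)]
  have hX1 : X ≠ ∞ := by
    refine ((?_ : X ≤ Fintype.card (Fin n → Bool)).trans_lt (ENNReal.natCast_lt_top _)).ne
    refine le_trans ?_ (P.tsum_simOutput13_le Q12 Q23 t)
    refine le_trans ?_ (Finset.single_le_sum (f := fun z => ∑' c : LinkHistory,
      (if c.length = t then (∑ z, fiberSum (P.simWeight1 Q12 z) c) *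
      fiberSum (P.simOutput3 Q23 z) c else 0)) (fun _ _ => zero_le) (Finset.mem_univ z))
    refine le_trans ?_ (ENNReal.le_tsum h.link31)
    rw [if_pos (by simpa [History.link31] using hl)]
  set S := P.sumLaw2 x (h.map Round.pair2) with hS
  have hSle : Fintype.card (Blocks m n) * S ≤ Fintype.card (Fin n → Bool) *
      P.law x y Transcript.link23 h.transcript.link23 := by
    have := hP.sum_law_pair2_le hn x y h.transcript.link12 h.transcript.link23
    rw [hS, sumLaw2, ← history_pair2_transcript]
    exact this
  have hS0 : S ≠ 0 := by
    have h1 := hlaw Transcript.pair2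
    rw [hP.private2 _ x, history_pair2_transcript] at h1
    rw [hS, sumLaw2]
    intro hc
    exact h1 (Finset.sum_eq_zero_iff.1 hc y' (Finset.mem_univ _))
  have hS1 : S ≠ ∞ := ENNReal.sum_ne_top.2 fun y _ =>
    ((hle1 _ _ _).trans_lt ENNReal.one_lt_top).ne
  rw [e1, e2, e3]
  set D12 := P.law x y Transcript.link12 h.transcript.link12
  set D23 := P.law x y Transcript.link23 h.transcript.link23
  have hww := ENNReal.mul_inv_cancel hw (constWeight_ne_top t z h)
  nth_rewrite 1 [hweq] at hww
  set wi := (P.constWeight t z h)⁻¹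
  -- The first step spends `sum_law_pair2_le` and introduces `D23`; then both link laws are split
  -- into received and sent messages. The rest inserts three products equal to 1 and regroups the
  -- factors by party.
  calc (Fintype.card (Blocks m n) : ℝ≥0∞) * m * D12
      ≤ (Fintype.card (Fin n → Bool) * D23 / S) * m * D12 := by
        gcongr
        rw [ENNReal.le_div_iff_mul_le (Or.inl hS0) (Or.inl hS1)]
        exact hSle
    _ = Fintype.card (Fin n → Bool) * m * S⁻¹ * (D12 * D23) := by rw [div_eq_mul_inv]; ring
    _ ≤ Fintype.card (Fin n → Bool) * m * S⁻¹ *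
        ((margFst Q12 (Equiv.refl _) h.link12 * margSnd Q12 (Equiv.refl _) h.link12) *
        (margFst Q23 (Equiv.prodComm _ _) h.link23 * margSnd Q23 (Equiv.prodComm _ _) h.link23)) := by
        gcongr
    _ = Fintype.card (Fin n → Bool) * m * S⁻¹ *
        ((margFst Q12 (Equiv.refl _) h.link12 * margSnd Q12 (Equiv.refl _) h.link12) *
        (margFst Q23 (Equiv.prodComm _ _) h.link23 *
          margSnd Q23 (Equiv.prodComm _ _) h.link23)) *
        (pathWeight (P.kernel1 fun _ => z) (h.map Round.pair1) *
        (∑ y, pathWeight (P.kernel2 y) (h.map Round.pair2)) *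
          pathWeight P.kernel3 (h.map Round.pair3) * wi) * (X * X⁻¹) *
        (P.completedLaw31 x y t h.link31 * (P.completedLaw31 x y t h.link31)⁻¹) := by
        rw [hww, ENNReal.mul_inv_cancel hX0 hX1, ENNReal.mul_inv_cancel hπ0 hπ1, mul_one, mul_one,
          mul_one]
    _ = _ := by rw [div_eq_mul_inv]; ring

theorem PrivateOT.law12_le_marg (hP : P.PrivateOT) (x : Blocks m n) (y : Fin m) {t : ℕ}
    {h : History} (hh : P.Completed t h) :
    P.law x y Transcript.link12 h.transcript.link12 ≤
      margFst (P.prefixProb x y fun r => (r.m12, r.m21)) (Equiv.refl _) h.link12 *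
        margSnd (P.prefixProb x y fun r => (r.m12, r.m21)) (Equiv.refl _) h.link12 := by
  obtain ⟨x', y', hT, hs⟩ := hh
  refine le_trans (tsum_congr fun τ => by congr).le
    ((tsum_finalMass_le_prefixProb _ hP.decodable.link12 Transcript.link12 (fun _ => rfl)
    x x' y y' hT hs).trans (le_pathWeight_condFst_mul_condSnd (Equiv.refl _)
      (P.prefixProb_nil x y _) (P.tsum_prefixProb_le x y _) _))

theorem PrivateOT.law23_le_marg (hP : P.PrivateOT) (x : Blocks m n) (y : Fin m) {t : ℕ}
    {h : History} (hh : P.Completed t h) :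
    P.law x y Transcript.link23 h.transcript.link23 ≤
      margFst (P.prefixProb x y fun r => (r.m23, r.m32)) (Equiv.prodComm _ _) h.link23 *
        margSnd (P.prefixProb x y fun r => (r.m23, r.m32)) (Equiv.prodComm _ _) h.link23 := by
  obtain ⟨x', y', hT, hs⟩ := hh
  refine le_trans (tsum_congr fun τ => by congr).le
    ((tsum_finalMass_le_prefixProb _ hP.decodable.link23 Transcript.link23 (fun _ => rfl)
    x x' y y' hT hs).trans (le_pathWeight_condFst_mul_condSnd (Equiv.prodComm _ _)
      (P.prefixProb_nil x y _) (P.tsum_prefixProb_le x y _) _))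

/-- The entropy bound for link 12, in nats. -/
theorem PrivateOT.log_le_tsum_law12 (hP : P.PrivateOT) (hm : 2 ≤ m) (hn : 1 ≤ n) (x : Blocks m n)
    (y : Fin m) : ENNReal.ofReal (Real.log (Fintype.card (Blocks m n) * m)) ≤
      ∑' a, P.law x y Transcript.link12 a *
        ENNReal.ofReal (-Real.log (P.law x y Transcript.link12 a).toReal) := by
  set L := ENNReal.ofReal (Real.log (Fintype.card (Blocks m n) * m)) with hL
  set H := ∑' a, P.law x y Transcript.link12 a *
        ENNReal.ofReal (-Real.log (P.law x y Transcript.link12 a).toReal) with hH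
  set N : ℝ≥0∞ := (Fintype.card (Fin n → Bool) : ℝ≥0∞) * m with hN
  have hN0 : N ≠ 0 := mul_ne_zero (by simp) (by simp; omega)
  have hN1 : N ≠ ∞ := ENNReal.mul_ne_top (ENNReal.natCast_ne_top _) (ENNReal.natCast_ne_top _)
  have hK : (1 : ℝ) ≤ Fintype.card (Blocks m n) * m := by
    have h1 : 1 ≤ Fintype.card (Blocks m n) * m :=
      Nat.mul_pos Fintype.card_pos (by omega)
    exact_mod_cast h1
  set Q12 := P.prefixProb x y fun r => (r.m12, r.m21) with hQ12
  set Q23 := P.prefixProb x y fun r => (r.m23, r.m32) with hQ23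
  -- At time `t` the total weight may still be below `N`. Each of the three ratios contributes at
  -- most `N`, matching the constant 3 on the left.
  have key : ∀ t, (∑ z : Fin n → Bool, ∑' h, P.constWeight t z h) * (L + 3) ≤ N * (H + 3) := by
    intro t
    have r1 := hP.tsum_ratio1_le x (P.tsum_prefixProb_le x y fun r => (r.m12, r.m21))
      (P.tsum_prefixProb_le x y fun r => (r.m23, r.m32)) t
    have r2 := hP.tsum_ratio2_le x y Q12 Q23 N t
    have r3 := hP.tsum_ratio3_le hm x y Q12 Q23 t
    have r0 : ∑ z, ∑' h : History, P.constWeight t z h * ENNReal.ofReal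
        (-Real.log (P.law x y Transcript.link12 h.transcript.link12).toReal) ≤ N * H := by
      refine (Finset.sum_le_sum fun z _ => tsum_constWeight_mul_le t z fun τ => ENNReal.ofReal
        (-Real.log (P.law x y Transcript.link12 τ.link12).toReal)).trans ?_
      -- The mean of `-log` of the law of link 12 is its entropy for every input pair, since that
      -- law is common to all of them.
      have h1 : ∀ x' y', ∑' τ, P.finalMass x' y' τ * ENNReal.ofReal
          (-Real.log (P.law x y Transcript.link12 τ.link12).toReal) = H := by
        intro x' y'
        rw [tsum_filter_eq Transcript.link12 _ fun a => ENNReal.ofReal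
          (-Real.log (P.law x y Transcript.link12 a).toReal), hH]
        refine tsum_congr fun a => ?_
        rw [← hP.law12_eq x' x y' y, law]
        simp
      simp [h1, hN, mul_assoc]
    refine le_trans ?_ ((add_le_add r0 (add_le_add (add_le_add r1 r2) r3)).trans (le_of_eq ?_))
    · rw [Finset.sum_mul]
      simp only [← Finset.sum_add_distrib, ← ENNReal.tsum_add, ← ENNReal.tsum_mul_right]
      refine Finset.sum_le_sum fun z _ => ENNReal.tsum_le_tsum fun h => ?_
      by_cases hw : P.constWeight t z h = 0
      · simp [hw]
      obtain ⟨y', hT, hs⟩ := completed_of_constWeight_ne_zero hw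
      simp only [← mul_add]
      refine mul_le_mul' le_rfl ?_
      refine log_add_three_le hK ?_ ?_ ?_
      · rw [hP.law12_eq x (fun _ => z) y y']
        exact fun hc => finalMass_ne_zero_of_terminal hT hs
          (le_antisymm (hc ▸ P.finalMass_le_law _ _ Transcript.link12 _) zero_le)
      · rw [← hP.computes.1 x y, ← P.tsum_law x y Transcript.link12]
        exact ENNReal.le_tsum _
      · refine le_trans (le_of_eq ?_) (hP.le_ratio_mul hm hn x y hw
          (hP.law12_le_marg x y ⟨_, _, hT, hs⟩) (hP.law23_le_marg x y ⟨_, _, hT, hs⟩))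
        rw [ENNReal.ofReal_mul (by positivity), ENNReal.ofReal_natCast, ENNReal.ofReal_natCast]
    · ring
  have h1 : N * (L + 3) ≤ N * (H + 3) := by
    -- In the limit of `t` the total weight on the left becomes exactly `N`, which can then be
    -- cancelled.
    rw [hN, ← iSup_tsum_constWeight hP.computes, ENNReal.iSup_mul]
    exact iSup_le fun t => (key t).trans (by rw [iSup_tsum_constWeight hP.computes])
  have h2 := (ENNReal.mul_le_mul_iff_right hN0 hN1).1 h1
  exact (ENNReal.add_le_add_iff_right (by norm_num)).1 h2

end Protocol

/-! ### Entropy estimates -/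

section EntropyBounds

variable {Ω α β : Type*}

theorem prob_mono (J : Ω → ℝ≥0∞) {E F : Set Ω} (h : E ⊆ F) : prob J E ≤ prob J F :=
  ENNReal.tsum_le_tsum fun ω => Set.indicator_le_indicator_of_subset h (fun _ => zero_le) ω

theorem tsum_prob_mul (J : Ω → ℝ≥0∞) (u : Ω → α) (ψ : α → ℝ≥0∞) :
    ∑' a, prob J {ω | u ω = a} * ψ a = ∑' ω, J ω * ψ (u ω) := by
  rw [tsum_filter_eq u J ψ]
  refine tsum_congr fun a => ?_
  congr 1

theorem tsum_prob (J : Ω → ℝ≥0∞) (u : Ω → α) :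
    ∑' a, prob J {ω | u ω = a} = ∑' ω, J ω := by
  simpa using tsum_prob_mul J u fun _ => 1

theorem ofReal_toReal_mul {d : ℝ≥0∞} (hd : d ≠ ∞) (r : ℝ) :
    ENNReal.ofReal (d.toReal * r) = d * ENNReal.ofReal r := by
  rw [ENNReal.ofReal_mul ENNReal.toReal_nonneg, ENNReal.ofReal_toReal hd]

/-- Conditional probabilities bounded below bound the conditional entropy from above. -/
theorem condEntropy_le_logb {J : Ω → ℝ≥0∞} (hJ : ∑' ω, J ω = 1) (A : Ω → α) (B : Ω → β) {K : ℕ}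
    (h : ∀ a b, prob J {ω | A ω = a ∧ B ω = b} ≠ 0 →
      prob J {ω | B ω = b} ≤ K * prob J {ω | A ω = a ∧ B ω = b}) :
    condEntropy J A B ≤ ENNReal.ofReal (Real.logb 2 K) := by
  have h1 : ∑' q : α × β, prob J {ω | A ω = q.1 ∧ B ω = q.2} = 1 := by
    rw [← hJ, ← tsum_prob J fun ω => (A ω, B ω)]
    simp [Prod.ext_iff]
  have hle : ∀ E, prob J E ≤ 1 := by
    intro E
    rw [← hJ]
    exact ENNReal.tsum_le_tsum fun ω => Set.indicator_le_self' (fun _ _ => zero_le) ω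
  rw [condEntropy, ← one_mul (ENNReal.ofReal _), ← h1, ← ENNReal.tsum_mul_right]
  refine ENNReal.tsum_le_tsum fun q => ?_
  set p := prob J {ω | A ω = q.1 ∧ B ω = q.2} with hp
  set r := prob J {ω | B ω = q.2} with hr
  have hpt : p ≠ ∞ := ((hle _).trans_lt ENNReal.one_lt_top).ne
  have hrt : r ≠ ∞ := ((hle _).trans_lt ENNReal.one_lt_top).ne
  by_cases h0 : p = 0
  · simp [h0]
  have hpr : p ≤ r := prob_mono J fun ω hω => hω.2
  have hp0 : 0 < p.toReal := ENNReal.toReal_pos h0 hpt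
  have hr0 : 0 < r.toReal := hp0.trans_le (ENNReal.toReal_mono hrt hpr)
  have h2 : r.toReal ≤ K * p.toReal := by
    have := ENNReal.toReal_mono (ENNReal.mul_ne_top (ENNReal.natCast_ne_top _) hpt) (h q.1 q.2 h0)
    simpa using this
  rw [← ofReal_toReal_mul hpt]
  refine ENNReal.ofReal_le_ofReal ?_
  rw [← mul_neg, ← Real.logb_inv]
  refine mul_le_mul_of_nonneg_left ?_ hp0.le
  refine Real.logb_le_logb_of_le one_lt_two (by positivity) ?_
  rw [inv_div, div_le_iff₀ hp0]
  exact h2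

theorem entropy_le_logb {J : Ω → ℝ≥0∞} (hJ : ∑' ω, J ω = 1) (A : Ω → α) {K : ℕ}
    (h : ∀ a, prob J {ω | A ω = a} ≠ 0 → 1 ≤ K * prob J {ω | A ω = a}) :
    entropy J A ≤ ENNReal.ofReal (Real.logb 2 K) := by
  have hle : ∀ E, prob J E ≤ 1 := by
    intro E
    rw [← hJ]
    exact ENNReal.tsum_le_tsum fun ω => Set.indicator_le_self' (fun _ _ => zero_le) ω
  rw [entropy, ← one_mul (ENNReal.ofReal _), ← hJ, ← tsum_prob J A, ← ENNReal.tsum_mul_right]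
  refine ENNReal.tsum_le_tsum fun a => ?_
  have hpt : prob J {ω | A ω = a} ≠ ∞ := ((hle _).trans_lt ENNReal.one_lt_top).ne
  by_cases h0 : prob J {ω | A ω = a} = 0
  · simp [h0]
  have hp0 := ENNReal.toReal_pos h0 hpt
  rw [← ofReal_toReal_mul hpt, ← mul_neg, ← Real.logb_inv]
  refine ENNReal.ofReal_le_ofReal (mul_le_mul_of_nonneg_left ?_ hp0.le)
  refine Real.logb_le_logb_of_le one_lt_two (by positivity) ?_
  rw [inv_eq_one_div, div_le_iff₀ hp0]
  simpa using ENNReal.toReal_mono (ENNReal.mul_ne_top (ENNReal.natCast_ne_top _) hpt) (h a h0)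

/-- Probabilities bounded above bound the entropy from below. -/
theorem logb_le_entropy {J : Ω → ℝ≥0∞} (hJ : ∑' ω, J ω = 1) (A : Ω → α) {K : ℕ} (hK : 1 ≤ K)
    (h : ∀ a, K * prob J {ω | A ω = a} ≤ 1) :
    ENNReal.ofReal (Real.logb 2 K) ≤ entropy J A := by
  have hle : ∀ E, prob J E ≤ 1 := by
    intro E
    rw [← hJ]
    exact ENNReal.tsum_le_tsum fun ω => Set.indicator_le_self' (fun _ _ => zero_le) ω
  rw [entropy, ← one_mul (ENNReal.ofReal _), ← hJ, ← tsum_prob J A, ← ENNReal.tsum_mul_right]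
  refine ENNReal.tsum_le_tsum fun a => ?_
  have hpt : prob J {ω | A ω = a} ≠ ∞ := ((hle _).trans_lt ENNReal.one_lt_top).ne
  by_cases h0 : prob J {ω | A ω = a} = 0
  · simp [h0]
  have hp0 := ENNReal.toReal_pos h0 hpt
  have hK0 : (0 : ℝ) < K := by exact_mod_cast hK
  rw [← ofReal_toReal_mul hpt, ← mul_neg, ← Real.logb_inv]
  refine ENNReal.ofReal_le_ofReal (mul_le_mul_of_nonneg_left ?_ hp0.le)
  refine Real.logb_le_logb_of_le one_lt_two hK0 ?_
  rw [inv_eq_one_div, le_div_iff₀ hp0]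
  simpa using ENNReal.toReal_mono ENNReal.one_ne_top (h a)

/-- A distribution on at most `K` points with weights at most `1 / K` is uniform. -/
theorem one_le_mul_of_le_one {ι : Type*} [Fintype ι] {D : α → ℝ≥0∞} (hD : ∑' a, D a = 1)
    (e : ι → α) (he : ∀ a, D a ≠ 0 → ∃ i, e i = a)
    (h : ∀ a, Fintype.card ι * D a ≤ 1) (a : α) (ha : D a ≠ 0) : 1 ≤ Fintype.card ι * D a := by
  by_contra hlt
  push Not at hlt
  set S := Finset.univ.image e with hS
  have hmem : ∀ a, D a ≠ 0 → a ∈ S := by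
    intro a ha
    obtain ⟨i, hi⟩ := he a ha
    exact Finset.mem_image.2 ⟨i, Finset.mem_univ _, hi⟩
  have h1 : ∑ b ∈ S, Fintype.card ι * D b = (Fintype.card ι : ℝ≥0∞) := by
    have h0 : ∀ b ∉ S, D b = 0 := fun b hb => by
      by_contra hc
      exact hb (hmem b hc)
    have h2 : ∑' b, D b = ∑ b ∈ S, D b := tsum_eq_sum h0
    rw [← Finset.mul_sum, ← h2, hD, mul_one]
  rw [← Finset.add_sum_erase S _ (hmem a ha)] at h1
  have h2 : ∑ b ∈ S.erase a, Fintype.card ι * D b ≤ ((S.erase a).card : ℝ≥0∞) := by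
    refine (Finset.sum_le_sum fun b _ => h b).trans ?_
    simp
  -- One weight strictly below `1 / K` and all others at most `1 / K`, on at most `K` points, would
  -- make the total less than 1.
  have h3 := ENNReal.add_lt_add_of_lt_of_le
    (h2.trans_lt (ENNReal.natCast_lt_top _)).ne hlt h2
  rw [h1] at h3
  have h4 : S.card ≤ Fintype.card ι := Finset.card_image_le.trans (by simp)
  have h5 : (S.erase a).card + 1 = S.card := Finset.card_erase_add_one (hmem a ha)
  have h6 : (1 : ℝ≥0∞) + ((S.erase a).card : ℝ≥0∞) = (S.card : ℕ) := by
    rw [← h5]; push_cast; ring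
  rw [h6] at h3
  have h7 : Fintype.card ι < S.card := by exact_mod_cast h3
  omega

end EntropyBounds

/-! ### Lower bounds for all secure protocols -/

namespace Protocol

variable {X Y Z : Type} {α : Type*}

theorem Computes.tsum_joint {P : Protocol X Y Z} {f : X → Y → Z} (hP : P.Computes f)
    (p : PMF (X × Y)) : ∑' ω, P.joint p ω = 1 := by
  have := hP.prob_joint_input p fun _ _ _ => True
  simp [prob] at this
  exact this

theorem Computes.prob_transcript {P : Protocol X Y Z} {f : X → Y → Z} (hP : P.Computes f)
    (p : PMF (X × Y)) {A : Transcript → α} {D : α → ℝ≥0∞} (h : ∀ x y a, P.law x y A a = D a)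
    (a : α) : prob (P.joint p) {ω | A ω.tr = a} = D a := by
  have := hP.prob_joint_and p A a fun _ _ _ => True
  simp only [and_true, if_true, mul_one, h, ENNReal.tsum_mul_right, PMF.tsum_coe, one_mul] at this
  exact this

variable {m n : ℕ} {P : Protocol (Blocks m n) (Fin m) (Fin n → Bool)}

theorem card_blocks (m n : ℕ) : Fintype.card (Blocks m n) = 2 ^ (n * m) := by
  simp [Blocks, pow_mul]

theorem logb_card_blocks (m n : ℕ) : Real.logb 2 (Fintype.card (Blocks m n) : ℕ) = n * m := by
  rw [card_blocks, Nat.cast_pow, Real.logb_pow]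
  simp

theorem logb_card_key {m n : ℕ} (hm : 2 ≤ m) :
    Real.logb 2 ((Fintype.card (Blocks m n) * m : ℕ)) = n * m + Real.logb 2 m := by
  rw [Nat.cast_mul, Real.logb_mul, logb_card_blocks]
  · simp
  · have : m ≠ 0 := by omega
    exact_mod_cast this

theorem logb_card_reply {m n : ℕ} (hm : 2 ≤ m) :
    Real.logb 2 ((m * Fintype.card (Fin n → Bool) : ℕ)) = n + Real.logb 2 m := by
  rw [Nat.cast_mul, Real.logb_mul, add_comm]
  · simp [Real.logb_pow]
  · have : m ≠ 0 := by omega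
    exact_mod_cast this
  · simp

theorem PrivateOT.le_H31 (hP : P.PrivateOT) (p : PMF (Blocks m n × Fin m)) (hm : 2 ≤ m) :
    ENNReal.ofReal ((n : ℝ) * m) ≤ P.H31 p := by
  have y : Fin m := ⟨0, by omega⟩
  let x : Blocks m n := fun _ _ => false
  rw [← logb_card_blocks]
  refine logb_le_entropy (hP.computes.tsum_joint p) _ Fintype.card_pos fun a => ?_
  rw [hP.computes.prob_transcript p (A := Transcript.link31)
    fun x' y' => hP.law31_eq hm x' x y' y]
  exact hP.law31_le hm x y a

theorem PrivateOT.le_H23 (hP : P.PrivateOT) (p : PMF (Blocks m n × Fin m)) (hm : 2 ≤ m)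
    (hn : 1 ≤ n) : ENNReal.ofReal ((n : ℝ) + Real.logb 2 m) ≤ P.H23 p := by
  have y : Fin m := ⟨0, by omega⟩
  let x : Blocks m n := fun _ _ => false
  rw [← logb_card_reply hm]
  refine logb_le_entropy (hP.computes.tsum_joint p) _
    (Nat.mul_pos (by omega) Fintype.card_pos) fun a => ?_
  rw [hP.computes.prob_transcript p (A := Transcript.link23)
    fun x' y' => hP.law23_eq x' x y' y, Nat.cast_mul, mul_assoc]
  exact hP.law23_le hm hn x y a

theorem PrivateOT.logb_le_tsum_law12 (hP : P.PrivateOT) (hm : 2 ≤ m) (hn : 1 ≤ n)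
    (x : Blocks m n) (y : Fin m) : ENNReal.ofReal ((n : ℝ) * m + Real.logb 2 m) ≤
      ∑' a, P.law x y Transcript.link12 a *
        ENNReal.ofReal (-Real.logb 2 (P.law x y Transcript.link12 a).toReal) := by
  rw [← logb_card_key hm]
  -- Division by `log 2` converts nats to bits.
  have h := mul_le_mul_left (hP.log_le_tsum_law12 hm hn x y) (ENNReal.ofReal (Real.log 2)⁻¹)
  rw [← ENNReal.tsum_mul_right, ← ENNReal.ofReal_mul'
    (inv_nonneg.2 (Real.log_nonneg one_le_two))] at h
  refine (le_of_eq ?_).trans (h.trans (le_of_eq ?_))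
  · rw [Real.logb, div_eq_mul_inv, Nat.cast_mul]
  · refine tsum_congr fun a => ?_
    rw [mul_assoc, ← ENNReal.ofReal_mul' (inv_nonneg.2 (Real.log_nonneg one_le_two)),
      Real.logb, div_eq_mul_inv, neg_mul]

theorem PrivateOT.law_ne_top (hP : P.PrivateOT) (x : Blocks m n) (y : Fin m) (A : Transcript → α)
    (a : α) : P.law x y A a ≠ ∞ := by
  refine ((?_ : P.law x y A a ≤ 1).trans_lt ENNReal.one_lt_top).ne
  rw [← hP.computes.1 x y, ← P.tsum_law x y A]
  exact ENNReal.le_tsum a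

theorem PrivateOT.le_H12 (hP : P.PrivateOT) (p : PMF (Blocks m n × Fin m)) (hm : 2 ≤ m)
    (hn : 1 ≤ n) : ENNReal.ofReal ((n : ℝ) * m + Real.logb 2 m) ≤ P.H12 p := by
  have y : Fin m := ⟨0, by omega⟩
  let x : Blocks m n := fun _ _ => false
  refine (hP.logb_le_tsum_law12 hm hn x y).trans (le_of_eq (tsum_congr fun a => ?_))
  rw [hP.computes.prob_transcript p (A := Transcript.link12)
    fun x' y' => hP.law12_eq x' x y' y, ← mul_neg, ofReal_toReal_mul (hP.law_ne_top _ _ _ _)]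

/-- The views contain the transcript of link 12, which is independent of the inputs. Hence the
conditional probability of the views is at most the law of that transcript, and the logarithms
compare term by term; no chain rule for possibly infinite entropies is needed. -/
theorem PrivateOT.le_randomness (hP : P.PrivateOT) (p : PMF (Blocks m n × Fin m)) (hm : 2 ≤ m)
    (hn : 1 ≤ n) : ENNReal.ofReal ((n : ℝ) * m + Real.logb 2 m) ≤ P.randomness p := by
  have y : Fin m := ⟨0, by omega⟩
  let x : Blocks m n := fun _ _ => false
  refine (hP.logb_le_tsum_law12 hm hn x y).trans ?_
  set D := P.law x y Transcript.link12 with hD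
  have hDt : ∀ a, D a ≠ ∞ := hP.law_ne_top _ _ _
  have h1 : ∀ a, prob (P.joint p) {ω | ω.tr.link12 = a} = D a :=
    hP.computes.prob_transcript p (A := Transcript.link12) fun x' y' => hP.law12_eq x' x y' y
  let V : Outcome (Blocks m n) (Fin m) (Fin n → Bool) → _ := fun ω => (view1 ω, view2 ω, view3 ω)
  let ψ : Msg × Msg → ℝ≥0∞ := fun a => ENNReal.ofReal (-Real.logb 2 (D a).toReal)
  have h2 : ∑' a, D a * ψ a = ∑' q, prob (P.joint p) {ω | (V ω, ω.x, ω.y) = q} * ψ q.1.1.1 := by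
    rw [tsum_prob_mul (P.joint p) (fun ω => (V ω, ω.x, ω.y)) fun q => ψ q.1.1.1]
    simp only [← h1]
    exact tsum_prob_mul (P.joint p) (fun ω => ω.tr.link12) ψ
  rw [h2]
  refine ENNReal.tsum_le_tsum fun q => ?_
  have hle : ∀ E, prob (P.joint p) E ≤ 1 := by
    intro E
    rw [← hP.computes.tsum_joint p]
    exact ENNReal.tsum_le_tsum fun ω => Set.indicator_le_self' (fun _ _ => zero_le) ω
  have e1 : {ω : Outcome (Blocks m n) (Fin m) (Fin n → Bool) | (V ω, ω.x, ω.y) = q} =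
      {ω | (view1 ω, view2 ω, view3 ω) = q.1 ∧ (ω.x, ω.y) = q.2} := by
    ext ω
    simp [V, Prod.ext_iff]
  rw [e1]
  set pr := prob (P.joint p) {ω | (view1 ω, view2 ω, view3 ω) = q.1 ∧ (ω.x, ω.y) = q.2} with hpr
  set r := prob (P.joint p) {ω | (ω.x, ω.y) = q.2} with hr
  have hpt : pr ≠ ∞ := ((hle _).trans_lt ENNReal.one_lt_top).ne
  have hrt : r ≠ ∞ := ((hle _).trans_lt ENNReal.one_lt_top).ne
  by_cases h0 : pr = 0
  · simp [h0]
  have hp0 := ENNReal.toReal_pos h0 hpt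
  have hr0 : 0 < r.toReal :=
    hp0.trans_le (ENNReal.toReal_mono hrt (prob_mono _ fun ω hω => hω.2))
  have h3 : pr ≤ D q.1.1.1 * r := by
    refine (prob_mono _ (F := {ω | ω.tr.link12 = q.1.1.1 ∧ (ω.x, ω.y) = q.2}) ?_).trans ?_
    · rintro ω ⟨hω, hω'⟩
      exact ⟨by rw [← hω]; rfl, hω'⟩
    · have h4 := hP.computes.prob_joint_and p Transcript.link12 q.1.1.1 fun x y _ => (x, y) = q.2
      have h5 := hP.computes.prob_joint_input p fun x y _ => (x, y) = q.2
      rw [h4, hr, h5, ← ENNReal.tsum_mul_left]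
      refine ENNReal.tsum_le_tsum fun q' => ?_
      rw [hP.law12_eq q'.1 x q'.2 y, mul_left_comm]
  have h4 : pr.toReal ≤ (D q.1.1.1).toReal * r.toReal := by
    rw [← ENNReal.toReal_mul]
    exact ENNReal.toReal_mono (ENNReal.mul_ne_top (hDt _) hrt) h3
  rw [← ofReal_toReal_mul hpt]
  refine ENNReal.ofReal_le_ofReal ?_
  rw [← mul_neg]
  refine mul_le_mul_of_nonneg_left (neg_le_neg ?_) hp0.le
  refine Real.logb_le_logb_of_le one_lt_two (div_pos hp0 hr0) ?_
  rwa [div_le_iff₀ hr0]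

end Protocol

/-! ### The protocol of Feige, Kilian and Naor -/

section Encodings

variable {m n : ℕ}

@[simp] theorem length_encIndex (i : Fin m) : (encIndex i).length = Nat.clog 2 m := by
  simp [encIndex]

@[simp] theorem length_encBlocks (K : Blocks m n) : (encBlocks K).length = m * n := by
  simp [encBlocks, List.length_flatten, List.map_ofFn, Function.comp_def, List.ofFn_const]

theorem encIndex_injective : Function.Injective (encIndex : Fin m → Msg) := by
  intro i j h
  have h1 := List.ofFn_injective h
  refine Fin.ext (Nat.eq_of_testBit_eq fun b => ?_)
  by_cases hb : b < Nat.clog 2 m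
  · exact congrFun h1 ⟨b, hb⟩
  · have h2 : m ≤ 2 ^ b := (Nat.le_pow_clog one_lt_two m).trans
      (Nat.pow_le_pow_right two_pos (not_lt.1 hb))
    rw [Nat.testBit_lt_two_pow (i.2.trans_le h2), Nat.testBit_lt_two_pow (j.2.trans_le h2)]

theorem encBlocks_injective : Function.Injective (encBlocks : Blocks m n → Msg) := by
  intro K K' h
  have h1 : List.ofFn (fun i => List.ofFn (K i)) = List.ofFn fun i => List.ofFn (K' i) := by
    rw [List.eq_iff_flatten_eq]
    exact ⟨h, by simp [List.map_ofFn, Function.comp_def]⟩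
  have h2 := List.ofFn_injective h1
  funext i
  exact List.ofFn_injective (congrFun h2 i)

theorem encKey_injective : Function.Injective (encKey : Blocks m n × Fin m → Msg) := by
  intro k k' h
  obtain ⟨h1, h2⟩ := List.append_inj h (by simp)
  exact Prod.ext (encBlocks_injective h1) (encIndex_injective h2)

theorem encReply_injective : Function.Injective (encReply : Fin m × (Fin n → Bool) → Msg) := by
  intro k k' h
  obtain ⟨h1, h2⟩ := List.append_inj h (by simp)
  exact Prod.ext (encIndex_injective h1) (List.ofFn_injective h2)

theorem bxor_cancel (u v : Fin n → Bool) : bxor (bxor u v) v = u := by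
  funext j
  simp [bxor]

theorem bxor_cancel_left (u v : Fin n → Bool) : bxor u (bxor u v) = v := by
  funext j
  simp [bxor]

end Encodings

variable {m n : ℕ}

/-- The blocks that Alice sends to Charlie. -/
def maskedBlocks (x : Blocks m n) (k : Blocks m n × Fin m) : Blocks m n :=
  fun i => bxor (x (k.2 + i)) (k.1 (k.2 + i))

/-- The first round of the protocol. -/
def fknRound1 (k : Blocks m n × Fin m) : Round := { Round.silent with m12 := encKey k }

/-- The second round of the protocol. -/
def fknRound2 (x : Blocks m n) (y : Fin m) (k : Blocks m n × Fin m) : Round :=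
  { Round.silent with
    m23 := encReply (y - k.2, k.1 y)
    m13 := encBlocks (maskedBlocks x k) }

/-- The transcript of the protocol, as a function of the inputs and of the key. -/
def fknTranscript (x : Blocks m n) (y : Fin m) (k : Blocks m n × Fin m) : Transcript where
  link12 := (encKey k, [])
  link23 := (encReply (y - k.2, k.1 y), [])
  link31 := ([], encBlocks (maskedBlocks x k))

theorem transcript_fkn (x : Blocks m n) (y : Fin m) (k : Blocks m n × Fin m) :
    History.transcript [fknRound1 k, fknRound2 x y k] = fknTranscript x y k := by
  simp [History.transcript, History.link12, History.link23, History.link31, LinkHistory.concat,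
    fknRound1, fknRound2, fknTranscript, Round.silent]

namespace Protocol

variable [NeZero m]

theorem fkn_step_nil (x : Blocks m n) (y : Fin m) : (fkn m n).step x y [] =
    (PMF.uniformOfFintype (Blocks m n × Fin m)).map fknRound1 := by
  simp [step, fkn, History.link12, History.link23, History.link31, PMF.map, PMF.bind_bind,
    PMF.pure_bind, Function.comp_def]
  rfl

theorem fkn_step_one (x : Blocks m n) (y : Fin m) (k : Blocks m n × Fin m) :
    (fkn m n).step x y [fknRound1 k] = PMF.pure (fknRound2 x y k) := by
  have h := Function.leftInverse_invFun (encKey_injective (m := m) (n := n)) k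
  simp only [step, fkn, History.link12, History.link23, History.link31, List.map_cons,
    List.map_nil, fknRound1, PMF.pure_bind, h]
  rfl

theorem fkn_step_of_two_le (x : Blocks m n) (y : Fin m) {h : History} (hh : 2 ≤ h.length) :
    (fkn m n).step x y h = PMF.pure Round.silent := by
  match h, hh with
  | r :: r' :: h, _ =>
    simp only [step, fkn, History.link12, History.link23, History.link31, List.map_cons,
      PMF.pure_bind]
    rfl

theorem fkn_terminal (x : Blocks m n) (y : Fin m) {h : History} (hh : 2 ≤ h.length) :
    (fkn m n).Terminal x y h := by
  intro k
  exact fkn_step_of_two_le x y (by rw [List.length_append]; omega)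

/-- After two rounds every history is terminal and its transcript is a function of the inputs and
the uniform key. -/
theorem fkn_tsum_run (x : Blocks m n) (y : Fin m) (φ : Transcript → ℝ≥0∞) (t : ℕ) :
    ∑' h : History, (fkn m n).termRun x y (t + 2) h * φ h.transcript =
      ∑ k, (Fintype.card (Blocks m n × Fin m) : ℝ≥0∞)⁻¹ * φ (fknTranscript x y k) := by
  have h1 : ∀ t, ∑' h : History, (fkn m n).termRun x y (t + 2) h * φ h.transcript =
      ∑' h : History, (fkn m n).run x y (t + 2) h * φ h.transcript := by
    intro t
    refine tsum_congr fun h => ?_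
    by_cases hl : h.length = t + 2
    · rw [termRun, if_pos (fkn_terminal x y (by omega))]
    · rw [termRun, run_apply_eq_zero _ x y hl]
      simp
  rw [h1]
  induction t with
  | zero =>
    rw [zero_add, tsum_run_succ, tsum_run_succ _ x y 0, tsum_eq_single []]
    · simp only [run, PMF.pure_apply, if_true, one_mul, List.nil_append, fkn_step_nil,
        PMF.map_apply, PMF.uniformOfFintype_apply]
      simp only [← ENNReal.tsum_mul_right]
      rw [ENNReal.tsum_comm, tsum_fintype]
      refine Finset.sum_congr rfl fun k _ => ?_
      rw [tsum_eq_single (fknRound1 k)]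
      · rw [if_pos rfl, fkn_step_one, tsum_eq_single (fknRound2 x y k)]
        · rw [PMF.pure_apply, if_pos rfl, one_mul, ← transcript_fkn]
          rfl
        · intro r hr
          rw [PMF.pure_apply, if_neg hr, zero_mul]
      · intro r hr
        rw [if_neg hr, zero_mul]
    · intro h hh
      simp [run, hh]
  | succ t ih =>
    rw [← ih, show t + 1 + 2 = t + 2 + 1 from rfl, tsum_run_succ]
    refine tsum_congr fun h => ?_
    by_cases hl : h.length = t + 2
    · rw [fkn_step_of_two_le x y (by omega), tsum_eq_single Round.silent]
      · simp [transcript_append_silent]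
      · intro r hr
        simp [hr]
    · rw [run_apply_eq_zero _ x y hl, zero_mul, zero_mul]

theorem fkn_tsum_finalMass (x : Blocks m n) (y : Fin m) (φ : Transcript → ℝ≥0∞) :
    ∑' τ, (fkn m n).finalMass x y τ * φ τ =
      ∑ k, (Fintype.card (Blocks m n × Fin m) : ℝ≥0∞)⁻¹ * φ (fknTranscript x y k) := by
  rw [tsum_finalMass_mul, ← ((fkn m n).monotone_tsum_termRun x y φ).iSup_nat_add 2]
  simp only [fkn_tsum_run, ciSup_const]

theorem fkn_law {α : Type*} (x : Blocks m n) (y : Fin m) (A : Transcript → α) (a : α) :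
    (fkn m n).law x y A a = ∑ k, (Fintype.card (Blocks m n × Fin m) : ℝ≥0∞)⁻¹ *
      if A (fknTranscript x y k) = a then 1 else 0 :=
  fkn_tsum_finalMass x y fun τ => if A τ = a then 1 else 0

theorem exists_of_fkn_law_ne_zero {α : Type*} {x : Blocks m n} {y : Fin m} {A : Transcript → α}
    {a : α} (h : (fkn m n).law x y A a ≠ 0) : ∃ k, A (fknTranscript x y k) = a := by
  rw [fkn_law] at h
  obtain ⟨k, -, hk⟩ := Finset.exists_ne_zero_of_sum_ne_zero h
  exact ⟨k, by simpa using (mul_ne_zero_iff.1 hk).2⟩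

theorem fkn_computes : (fkn m n).Computes fun x y => x y := by
  refine ⟨fun x y => ?_, fun x y τ hτ => ?_⟩
  · have := fkn_tsum_finalMass x y fun _ => 1
    simp only [mul_one] at this
    rw [this, Finset.sum_const, Finset.card_univ, nsmul_eq_mul]
    exact ENNReal.mul_inv_cancel (by simp [NeZero.ne m]) (ENNReal.natCast_ne_top _)
  · have h1 : (fkn m n).law x y id τ ≠ 0 :=
      fun hc => hτ (le_antisymm (hc ▸ (fkn m n).finalMass_le_law x y id τ) zero_le)
    obtain ⟨k, rfl⟩ := exists_of_fkn_law_ne_zero h1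
    have h2 := Function.leftInverse_invFun (encReply_injective (m := m) (n := n))
      (y - k.2, k.1 y)
    have h3 := Function.leftInverse_invFun (encBlocks_injective (m := m) (n := n))
      (maskedBlocks x k)
    simp only [fkn, fknTranscript, id, h2, h3]
    rw [maskedBlocks, add_sub_cancel, bxor_cancel]

/-- The change of variables from the key to the messages received by Charlie. -/
def keyEquiv (x : Blocks m n) (y : Fin m) : Blocks m n × Fin m ≃ Blocks m n × Fin m where
  toFun k := (maskedBlocks x k, y - k.2)
  invFun q := (fun j => bxor (x j) (q.1 (j - (y - q.2))), y - q.2)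
  left_inv k := by
    refine Prod.ext ?_ (by simp)
    funext j
    simp [maskedBlocks, bxor_cancel_left]
  right_inv q := by
    refine Prod.ext ?_ (by simp)
    funext j
    simp [maskedBlocks, bxor_cancel_left]

/-- For fixed inputs, the masked blocks and the shifted index are a bijective image of the key,
hence uniform. Bob's block is recovered from them and `x y`, so Charlie's view depends on the inputs
only through the output. -/
theorem fkn_law3 (x : Blocks m n) (y : Fin m) (a : (Msg × Msg) × (Msg × Msg)) :
    (fkn m n).law x y Transcript.pair3 a =
      ∑ q : Blocks m n × Fin m, (Fintype.card (Blocks m n × Fin m) : ℝ≥0∞)⁻¹ *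
        if ((encReply (q.2, bxor (x y) (q.1 q.2)), []), ([], encBlocks q.1)) = a
          then 1 else 0 := by
  rw [fkn_law]
  conv_rhs => rw [← (keyEquiv x y).sum_comp]
  refine Finset.sum_congr rfl fun k _ => ?_
  have h : maskedBlocks x k (y - k.2) = bxor (x y) (k.1 y) := by
    rw [maskedBlocks, add_sub_cancel]
  simp only [keyEquiv, Equiv.coe_fn_mk, Transcript.pair3, fknTranscript, h, bxor_cancel_left]
  congr

/-- The code of all words of a length that depends on the number of preceding rounds. -/
def fixedLengthCode (ℓ : ℕ → ℕ) (g : LinkHistory) : Set Msg := {u | u.length = ℓ g.length}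

theorem prefixFree_fixedLengthCode (ℓ : ℕ → ℕ) (g : LinkHistory) :
    PrefixFree (fixedLengthCode ℓ g) :=
  fun _ hu _ hv huv => huv.eq_of_length (Eq.trans hu (Eq.symm hv))

/-- In each direction of each link the message length is determined by the round number, and words
of one length form a prefix-free code. -/
theorem fkn_wellFormed (p : PMF (Blocks m n × Fin m)) : (fkn m n).WellFormed p := by
  refine ⟨fun x y _ => fkn_computes.1 x y, ?_⟩
  refine ⟨fixedLengthCode fun t => if t = 0 then m * n + Nat.clog 2 m else 0,
    fixedLengthCode fun _ => 0, fixedLengthCode fun t => if t = 1 then Nat.clog 2 m + n else 0,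
    fixedLengthCode fun _ => 0, fixedLengthCode fun _ => 0,
    fixedLengthCode fun t => if t = 1 then m * n else 0, fun g => ?_, fun x y _ t h r _ hr => ?_⟩
  · refine ⟨?_, ?_, ?_, ?_, ?_, ?_⟩ <;> exact prefixFree_fixedLengthCode _ g
  rw [PMF.mem_support_iff, step_apply, mul_ne_zero_iff, mul_ne_zero_iff] at hr
  obtain ⟨⟨h1, h2⟩, h3⟩ := hr
  simp only [fkn, PMF.pure_apply, ne_eq, ite_eq_right_iff, one_ne_zero, imp_false, not_not,
    Prod.mk.injEq] at h3
  match h with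
  | [] =>
    simp only [fkn, History.link12, List.map_nil, PMF.pure_apply, ne_eq, ite_eq_right_iff,
      one_ne_zero, imp_false, not_not, Prod.mk.injEq] at h2
    rw [← PMF.mem_support_iff] at h1
    simp only [fkn, History.link12, List.map_nil, PMF.mem_support_map_iff, Prod.mk.injEq] at h1
    obtain ⟨k, -, h4, h5⟩ := h1
    simp [fixedLengthCode, History.link12, History.link23, History.link31, h2, h3, ← h4, ← h5, encKey]
  | [r1] =>
    simp only [fkn, History.link12, List.map_cons, List.map_nil, PMF.pure_apply, ne_eq,
      ite_eq_right_iff, one_ne_zero, imp_false, not_not, Prod.mk.injEq] at h1 h2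
    simp [fixedLengthCode, History.link12, History.link23, History.link31, h1, h2, h3, encReply]
  | r1 :: r2 :: h =>
    simp only [fkn, History.link12, List.map_cons, PMF.pure_apply, ne_eq,
      ite_eq_right_iff, one_ne_zero, imp_false, not_not, Prod.mk.injEq] at h1 h2
    simp [fixedLengthCode, History.link12, History.link23, History.link31, h1, h2, h3]

theorem fkn_isSecure (p : PMF (Blocks m n × Fin m)) (hp : ∀ q, p q ≠ 0) :
    (fkn m n).IsSecure p (remoteOT m n) where
  wellFormed := fkn_wellFormed p
  correct x y _ z := by
    have h1 : ∀ τ, (fkn m n).finalMass x y τ * (fkn m n).out3 τ.link23 τ.link31 z =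
        (fkn m n).finalMass x y τ * remoteOT m n x y z := by
      intro τ
      by_cases h : (fkn m n).finalMass x y τ = 0
      · rw [h, zero_mul, zero_mul]
      · rw [fkn_computes.2 x y τ h]; rfl
    simp only [h1, ENNReal.tsum_mul_right, fkn_computes.1, one_mul]
  -- Given the key, links 12 and 31 do not involve `y`, and links 12 and 23 do not involve `x`; the
  -- two laws therefore agree term by term.
  private1 := (fkn_computes.markov_iff hp Transcript.pair1 (fun x _ _ => x)
    (fun _ y z => (y, z)) (by intro x y x' y' h1 h2; simp_all)).2 (by
      rintro x y x' y' rfl a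
      rw [fkn_law, fkn_law]
      rfl)
  private2 := (fkn_computes.markov_iff hp Transcript.pair2 (fun _ y _ => y)
    (fun x _ z => (x, z)) (by intro x y x' y' h1 h2; simp_all)).2 (by
      rintro x y x' y' rfl a
      rw [fkn_law, fkn_law]
      rfl)
  private3 := (fkn_computes.markov_iff hp Transcript.pair3 (fun _ _ z => z)
    (fun x y _ => (x, y)) (by intro x y x' y' h1 h2; simp_all)).2 (by
      intro x y x' y' h a
      rw [fkn_law3, fkn_law3, h])

theorem card_mul_inv_cancel (m n : ℕ) [NeZero m] :
    ((Fintype.card (Blocks m n) * m : ℕ) : ℝ≥0∞) *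
      (Fintype.card (Blocks m n × Fin m) : ℝ≥0∞)⁻¹ = 1 := by
  rw [Fintype.card_prod, Fintype.card_fin]
  exact ENNReal.mul_inv_cancel
    (by simp [NeZero.ne m]) (ENNReal.natCast_ne_top _)

/-- A possible transcript of link 12 has at least the probability of one key. -/
theorem fkn_H12_le (p : PMF (Blocks m n × Fin m)) (hp : ∀ q, p q ≠ 0) (hm : 2 ≤ m) :
    (fkn m n).H12 p ≤ ENNReal.ofReal ((n : ℝ) * m + Real.logb 2 m) := by
  have hP := (fkn_isSecure p hp).privateOT hp
  let x : Blocks m n := fun _ _ => false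
  rw [← logb_card_key hm]
  refine entropy_le_logb (hP.computes.tsum_joint p) _ fun a => ?_
  rw [hP.computes.prob_transcript p (A := Transcript.link12)
    fun x' y' => hP.law12_eq x' x y' 0]
  intro ha
  obtain ⟨k, rfl⟩ := exists_of_fkn_law_ne_zero ha
  rw [← card_mul_inv_cancel m n, fkn_law]
  gcongr
  refine le_trans ?_ (Finset.single_le_sum (fun _ _ => zero_le) (Finset.mem_univ k))
  simp

/-- The pointwise bound valid for all secure protocols, together with a support of at most 2^(nm)
words, forces uniformity; no direct computation of the law is needed. Link 23 is treated in the same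
way. -/
theorem fkn_H31_le (p : PMF (Blocks m n × Fin m)) (hp : ∀ q, p q ≠ 0) (hm : 2 ≤ m) :
    (fkn m n).H31 p ≤ ENNReal.ofReal ((n : ℝ) * m) := by
  have hP := (fkn_isSecure p hp).privateOT hp
  let x : Blocks m n := fun _ _ => false
  rw [← logb_card_blocks]
  refine entropy_le_logb (hP.computes.tsum_joint p) _ fun a => ?_
  rw [hP.computes.prob_transcript p (A := Transcript.link31)
    fun x' y' => hP.law31_eq hm x' x y' 0]
  refine one_le_mul_of_le_one (((fkn m n).tsum_law x 0 _).trans (fkn_computes.1 x 0))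
    (fun M : Blocks m n => ([], encBlocks M)) (fun a ha => ?_) (hP.law31_le hm x 0) a
  obtain ⟨k, rfl⟩ := exists_of_fkn_law_ne_zero ha
  exact ⟨_, rfl⟩

theorem fkn_H23_le (p : PMF (Blocks m n × Fin m)) (hp : ∀ q, p q ≠ 0) (hm : 2 ≤ m) (hn : 1 ≤ n) :
    (fkn m n).H23 p ≤ ENNReal.ofReal ((n : ℝ) + Real.logb 2 m) := by
  have hP := (fkn_isSecure p hp).privateOT hp
  let x : Blocks m n := fun _ _ => false
  have hc : Fintype.card (Fin m × (Fin n → Bool)) = m * Fintype.card (Fin n → Bool) := by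
    rw [Fintype.card_prod, Fintype.card_fin]
  rw [← logb_card_reply hm, ← hc]
  refine entropy_le_logb (hP.computes.tsum_joint p) _ fun a => ?_
  rw [hP.computes.prob_transcript p (A := Transcript.link23)
    fun x' y' => hP.law23_eq x' x y' 0]
  refine one_le_mul_of_le_one (((fkn m n).tsum_law x 0 _).trans (fkn_computes.1 x 0))
    (fun c : Fin m × (Fin n → Bool) => (encReply c, [])) (fun a ha => ?_) (fun a => ?_) a
  · obtain ⟨k, rfl⟩ := exists_of_fkn_law_ne_zero ha
    exact ⟨_, rfl⟩
  · rw [hc, Nat.cast_mul, mul_assoc]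
    exact hP.law23_le hm hn x 0 a

theorem fkn_randomness_le (p : PMF (Blocks m n × Fin m)) (hm : 2 ≤ m) :
    (fkn m n).randomness p ≤ ENNReal.ofReal ((n : ℝ) * m + Real.logb 2 m) := by
  rw [← logb_card_key hm]
  refine condEntropy_le_logb (fkn_computes.tsum_joint p) _ _ fun v q hvq => ?_
  have h1 : prob ((fkn m n).joint p) {ω | (ω.x, ω.y) = q} ≤ p q := by
    rw [fkn_computes.prob_joint_input p fun x y _ => (x, y) = q, tsum_eq_single q]
    · simp
    · rintro ⟨x, y⟩ hq
      simp [hq]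
  refine h1.trans ?_
  rw [fkn_computes.prob_joint] at hvq ⊢
  simp only [fun (q : Blocks m n × Fin m) (E : Set (Outcome (Blocks m n) (Fin m) (Fin n → Bool))) =>
    fkn_tsum_finalMass q.1 q.2 fun τ =>
      if (⟨q.1, q.2, q.1 q.2, τ⟩ : Outcome _ _ _) ∈ E then 1 else 0] at hvq ⊢
  -- A possible outcome comes from some key, and that key alone already has conditional probability
  -- 1/(2^(nm)·m) given the inputs.
  obtain ⟨q', hq'⟩ := not_forall.1 (fun hc => hvq (ENNReal.tsum_eq_zero.2 hc))
  obtain ⟨k, -, hk⟩ := Finset.exists_ne_zero_of_sum_ne_zero (mul_ne_zero_iff.1 hq').2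
  have hmem : (⟨q'.1, q'.2, q'.1 q'.2, fknTranscript q'.1 q'.2 k⟩ : Outcome _ _ _) ∈
      {ω : Outcome (Blocks m n) (Fin m) (Fin n → Bool) |
        (view1 ω, view2 ω, view3 ω) = v ∧ (ω.x, ω.y) = q} := by
    by_contra hc
    rw [if_neg hc, mul_zero] at hk
    exact hk rfl
  obtain rfl : q' = q := hmem.2
  refine le_trans ?_ (mul_le_mul' le_rfl (ENNReal.le_tsum q'))
  refine le_trans ?_ (mul_le_mul' le_rfl (mul_le_mul' le_rfl
    (Finset.single_le_sum (fun _ _ => zero_le) (Finset.mem_univ k))))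
  rw [if_pos hmem, mul_one, mul_left_comm, card_mul_inv_cancel, mul_one]

end Protocol

end SecureThreeParty

end

theorem mainTheorem7 (m n : ℕ) [NeZero m] (hm : 2 ≤ m) (hn : 1 ≤ n)
    (p : PMF (SecureThreeParty.Blocks m n × Fin m)) (hp : ∀ xy, p xy ≠ 0) :
    (∀ P : SecureThreeParty.Protocol (SecureThreeParty.Blocks m n) (Fin m) (Fin n → Bool),
      P.IsSecure p (SecureThreeParty.remoteOT m n) →
        ENNReal.ofReal ((n : ℝ) * m) ≤ P.H31 p ∧
        ENNReal.ofReal ((n : ℝ) + Real.logb 2 m) ≤ P.H23 p ∧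
        ENNReal.ofReal ((n : ℝ) * m + Real.logb 2 m) ≤ P.H12 p) ∧
    ENNReal.ofReal ((n : ℝ) * m + Real.logb 2 m) ≤
      SecureThreeParty.rho p (SecureThreeParty.remoteOT m n) ∧
    (SecureThreeParty.fkn m n).CommunicationIdeal p (SecureThreeParty.remoteOT m n) ∧
    (SecureThreeParty.fkn m n).RandomnessOptimal p (SecureThreeParty.remoteOT m n) ∧
    (SecureThreeParty.fkn m n).H31 p = ENNReal.ofReal ((n : ℝ) * m) ∧
    (SecureThreeParty.fkn m n).H23 p = ENNReal.ofReal ((n : ℝ) + Real.logb 2 m) ∧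
    (SecureThreeParty.fkn m n).H12 p = ENNReal.ofReal ((n : ℝ) * m + Real.logb 2 m) ∧
    (SecureThreeParty.fkn m n).randomness p =
      ENNReal.ofReal ((n : ℝ) * m + Real.logb 2 m) := by
  have hs := SecureThreeParty.Protocol.fkn_isSecure p hp
  have l31 : ∀ P : SecureThreeParty.Protocol (SecureThreeParty.Blocks m n) (Fin m) (Fin n → Bool),
      P.IsSecure p (SecureThreeParty.remoteOT m n) → ENNReal.ofReal ((n : ℝ) * m) ≤ P.H31 p :=
    fun P hP => (hP.privateOT hp).le_H31 p hm
  have l23 : ∀ P : SecureThreeParty.Protocol (SecureThreeParty.Blocks m n) (Fin m) (Fin n → Bool),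
      P.IsSecure p (SecureThreeParty.remoteOT m n) →
        ENNReal.ofReal ((n : ℝ) + Real.logb 2 m) ≤ P.H23 p :=
    fun P hP => (hP.privateOT hp).le_H23 p hm hn
  have l12 : ∀ P : SecureThreeParty.Protocol (SecureThreeParty.Blocks m n) (Fin m) (Fin n → Bool),
      P.IsSecure p (SecureThreeParty.remoteOT m n) →
        ENNReal.ofReal ((n : ℝ) * m + Real.logb 2 m) ≤ P.H12 p :=
    fun P hP => (hP.privateOT hp).le_H12 p hm hn
  have lr : ENNReal.ofReal ((n : ℝ) * m + Real.logb 2 m) ≤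
      SecureThreeParty.rho p (SecureThreeParty.remoteOT m n) :=
    le_iInf₂ fun P hP => (hP.privateOT hp).le_randomness p hm hn
  have u31 := SecureThreeParty.Protocol.fkn_H31_le p hp hm
  have u23 := SecureThreeParty.Protocol.fkn_H23_le p hp hm hn
  have u12 := SecureThreeParty.Protocol.fkn_H12_le p hp hm
  have ur := SecureThreeParty.Protocol.fkn_randomness_le p hm
  have hr : SecureThreeParty.rho p (SecureThreeParty.remoteOT m n) ≤
      (SecureThreeParty.fkn m n).randomness p :=
    iInf₂_le (f := fun (P : SecureThreeParty.Protocol _ _ _) (_ : P.IsSecure p (SecureThreeParty.remoteOT m n)) => P.randomness p) _ hs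
  refine ⟨fun P hP => ⟨l31 P hP, l23 P hP, l12 P hP⟩, lr, ⟨hs, ?_, ?_, ?_⟩, ⟨hs, ?_⟩,
    u31.antisymm (l31 _ hs), u23.antisymm (l23 _ hs), u12.antisymm (l12 _ hs),
    ur.antisymm (lr.trans hr)⟩
  · exact le_antisymm (u12.trans (le_iInf₂ l12)) (iInf₂_le (SecureThreeParty.fkn m n) hs)
  · exact le_antisymm (u23.trans (le_iInf₂ l23)) (iInf₂_le (SecureThreeParty.fkn m n) hs)
  · exact le_antisymm (u31.trans (le_iInf₂ l31)) (iInf₂_le (SecureThreeParty.fkn m n) hs)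
  · exact le_antisymm (ur.trans lr) hr
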